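/- Let $U\subset\mathbb R^2$ be a bounded domain (nonempty connected open set) such that every $x\in\partial U$ satisfies the Poincaré cone condition: there are a cone $V$ with apex $x$ and opening angle $\alpha>0$ and a number $h>0$ such that $V\cap B(x,h)\subset U^c$, where $B(x,h)$ is the open ball. Assume that $\partial U$ is computable in the following sense: there is a computable sequence $(C_n)_{n\in\mathbb N}$ such that, for each $n$, $C_n$ is a finite set of closed squares of the grid $2^{-n}\mathbb Z\times 2^{-n}\mathbb Z$ whose union is connected, contains $\partial U$, and has all of its points at distance at most $2^{-n+2}$ from $\partial U$. Let $\varphi:\partial U\to\mathbb R$ be computable in the following sense: there are real numbers $\varphi_n(\mathbf c)$, for $n\in\mathbb N$ and $\mathbf c\in C_n$, computable uniformly in $n$ and $\mathbf c$, and a computable sequence of real numbers $\epsilon(n)$ that tends to $0$ with a computable modulus of convergence, such that for all $n$: $|\varphi_n(\mathbf c)-\varphi(y)|\le\epsilon(n)$ for all $\mathbf c\in C_n$ and $y\in\partial U\cap\mathbf c$, and $|\varphi_n(\mathbf c)-\varphi_n(\mathbf c')|\le\epsilon(n)$ for all $\mathbf c,\mathbf c'\in C_n$ that share an edge. Then there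 is a unique continuous function $u:\overline U\to\mathbb R$ that is harmonic on $U$ and satisfies $u(x)=\varphi(x)$ for all $x\in\partial U$, and $u$ is computable on $\overline U$: there is an algorithm which, given as an oracle any sequence of dyadic points $(q_j)_{j\in\mathbb N}$, $q_j\in 2^{-j}\mathbb Z\times 2^{-j}\mathbb Z$, with $|x-q_j|\le 2^{-j}$ for all $j$, for a point $x\in\overline U$, and given $k\in\mathbb N$ as input, outputs an integer $r$ with $|u(x)-r2^{-k}|\le 2^{-k}$. -/

import Mathlib

/-! The plane is `ℂ`, with its Euclidean norm and its real inner product. -/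

/-- The closed cone with apex `x`, unit axis `v` and (half) opening angle `α`, for `0 < α < π`. -/
def planarCone (x v : ℂ) (α : ℝ) : Set ℂ :=
  {p | ‖p - x‖ * Real.cos α ≤ inner ℝ (p - x) v}

/-- The Poincaré cone condition for `U` at the point `x`. -/
def PoincareConeAt (U : Set ℂ) (x : ℂ) : Prop :=
  ∃ v : ℂ, ‖v‖ = 1 ∧ ∃ α : ℝ, 0 < α ∧ α < Real.pi ∧ ∃ h : ℝ, 0 < h ∧
    planarCone x v α ∩ Metric.ball x h ⊆ Uᶜ

/-- The closed square of the grid `2⁻ⁿℤ × 2⁻ⁿℤ` with lower left corner `2⁻ⁿ c`. -/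
def gridSquare (n : ℕ) (c : ℤ × ℤ) : Set ℂ :=
  {z | (c.1 : ℝ) / 2 ^ n ≤ z.re ∧ z.re ≤ ((c.1 : ℝ) + 1) / 2 ^ n ∧
       (c.2 : ℝ) / 2 ^ n ≤ z.im ∧ z.im ≤ ((c.2 : ℝ) + 1) / 2 ^ n}

/-- The union of a finite list of squares of the grid `2⁻ⁿℤ × 2⁻ⁿℤ`. -/
def gridUnion (n : ℕ) (L : List (ℤ × ℤ)) : Set ℂ :=
  ⋃ c ∈ L, gridSquare n c

/-- Two grid squares are adjacent when they are distinct and share an edge. -/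
def GridAdjacent (c d : ℤ × ℤ) : Prop :=
  |c.1 - d.1| + |c.2 - d.2| = 1

/-- The sequence `C` of finite sets of grid squares is a computable approximation of the
planar set `K`. -/
structure IsComputableApproximation (K : Set ℂ) (C : ℕ → List (ℤ × ℤ)) : Prop where
  computable : Computable C
  connected : ∀ n, IsConnected (gridUnion n (C n))
  covers : ∀ n, K ⊆ gridUnion n (C n)
  close : ∀ n, ∀ z ∈ gridUnion n (C n), ∃ y ∈ K, dist z y ≤ 4 / 2 ^ n

/-- The real numbers `f i`, for `i ∈ S`, are uniformly computable: a single algorithm produces, from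
`i ∈ S` and `k`, a dyadic number `m / 2ᵏ` within `2⁻ᵏ` of `f i`. -/
def UniformlyComputableOn {ι : Type*} [Primcodable ι] (S : Set ι) (f : ι → ℝ) : Prop :=
  ∃ g : ι → ℕ → ℤ, Computable₂ g ∧ ∀ i ∈ S, ∀ k : ℕ, |f i - (g i k : ℝ) / 2 ^ k| ≤ 1 / 2 ^ k

/-- The sequence `ε` tends to `0` with a computable modulus of convergence. -/
def TendsToZeroComputably (ε : ℕ → ℝ) : Prop :=
  ∃ m : ℕ → ℕ, Computable m ∧ ∀ k n : ℕ, m k ≤ n → |ε n| ≤ 1 / 2 ^ k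

/-- The function `φ` on `K` is computable relative to the approximation `C` of `K`: there are
uniformly computable values `ψ n c`, for `c` in `C n`, and a computable sequence `ε` tending
computably to `0`, such that `ψ n c` is `ε n`-close to the values of `φ` on `K ∩ c` and
`ε n`-close to `ψ n d` whenever the squares `c` and `d` of `C n` are adjacent. -/
def IsComputableCondition (K : Set ℂ) (C : ℕ → List (ℤ × ℤ)) (φ : ℂ → ℝ) : Prop :=
  ∃ (ψ : ℕ → ℤ × ℤ → ℝ) (ε : ℕ → ℝ),
    UniformlyComputableOn {p : ℕ × (ℤ × ℤ) | p.2 ∈ C p.1} (fun p => ψ p.1 p.2) ∧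
    UniformlyComputableOn Set.univ ε ∧
    TendsToZeroComputably ε ∧
    (∀ n, ∀ c ∈ C n, ∀ y ∈ K ∩ gridSquare n c, |ψ n c - φ y| ≤ ε n) ∧
    (∀ n, ∀ c ∈ C n, ∀ d ∈ C n, GridAdjacent c d → |ψ n c - ψ n d| ≤ ε n)

/-- The dyadic point `2⁻ᵏ a` of the plane. -/
noncomputable def dyadicPoint (k : ℕ) (a : ℤ × ℤ) : ℂ :=
  ⟨(a.1 : ℝ) / 2 ^ k, (a.2 : ℝ) / 2 ^ k⟩

/-- `a` is a name of `z`: a sequence of dyadic points whose `k`-th term is within `2⁻ᵏ` of `z`. -/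
def IsPointName (a : ℕ → ℤ × ℤ) (z : ℂ) : Prop :=
  ∀ k, dist z (dyadicPoint k (a k)) ≤ 1 / 2 ^ k

/-- The function `u` is computable on `S` (in the sense of computable analysis): a single algorithm
produces, from any name of any `z ∈ S` given as an oracle and any `k`, a dyadic number `r / 2ᵏ`
within `2⁻ᵏ` of `u z`. The algorithm `F` is run on longer and longer initial segments of the name;
on each of them it may ask for more (`none`) or give an answer, it must answer at some point, and
its answers must be right. -/
def IsComputableOn (u : ℂ → ℝ) (S : Set ℂ) : Prop :=
  ∃ F : List (ℤ × ℤ) → ℕ → Option ℤ, Computable₂ F ∧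
    ∀ z ∈ S, ∀ a : ℕ → ℤ × ℤ, IsPointName a z → ∀ k : ℕ,
      (∃ n r, F ((List.range n).map a) k = some r) ∧
      (∀ n r, F ((List.range n).map a) k = some r → |u z - (r : ℝ) / 2 ^ k| ≤ 1 / 2 ^ k)

/-- `u` is a solution of the Dirichlet problem on the open set `U` with boundary values `φ`
(only the values of `u` on the closure of `U` and of `φ` on the boundary of `U` matter). -/
structure IsDirichletSolution (U : Set ℂ) (φ u : ℂ → ℝ) : Prop where
  continuousOn : ContinuousOn u (closure U)
  harmonic : InnerProductSpace.HarmonicOnNhd u U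
  boundary : ∀ x ∈ frontier U, u x = φ x

/-! The boundary is a connected compact set, being a limit of connected unions of squares. Hence
near a boundary point `a` the function `z - a` has a continuous square root off the boundary, and
lifting along `s ↦ a + s ^ 2` shows that a solution bounded by `M` near `a` is bounded by
`(3 / 4) ^ j * M` on the disc whose radius is `16 ^ j` times smaller, if it vanishes on the
boundary near `a`. This explicit barrier yields a solution of the Dirichlet problem on both sides
of the boundary at once (by sweeping out), and it converts the given data into error bounds which
do not depend on a modulus of continuity of the boundary values.

The algorithm searches for a certificate: a rounded function on a fine grid which is approximately
discrete harmonic away from the boundary and approximately equal to the boundary values near it. The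
decay estimate and a discrete maximum principle show that every certificate approximates the
solution; the rounded values of the two-sided solution are a certificate on a fine enough grid, so
the search succeeds. -/

open Filter Topology Metric Set InnerProductSpace

/-! ## Subharmonic functions -/

/-- `v` is subharmonic at `z`, in the viscosity sense: a function harmonic near `z` can touch `v`
from above at `z`, up to a constant, only if `v` differs from it by a constant near `z`. Unlike the
sub-mean value property, this makes sense pointwise and is visibly invariant under local conformal
changes of variable. -/
def SubharmonicAt (v : ℂ → ℝ) (z : ℂ) : Prop :=
  ∀ h : ℂ → ℝ, HarmonicAt h z → (∀ᶠ w in 𝓝 z, v w - h w ≤ v z - h z) →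
    ∀ᶠ w in 𝓝 z, v w - h w = v z - h z

theorem exists_analyticAt_re_eq_of_harmonicAt {h : ℂ → ℝ} {z : ℂ} (hh : HarmonicAt h z) :
    ∃ F : ℂ → ℂ, AnalyticAt ℂ F z ∧ ∀ᶠ w in 𝓝 z, h w = (F w).re := by
  obtain ⟨r, hr, hball⟩ := Metric.isOpen_iff.1 (isOpen_setOfPred_harmonicAt (f := h)) z hh
  obtain ⟨F, hF, hFh⟩ := HarmonicOnNhd.exists_analyticOnNhd_ball_re_eq (fun _ hy => hball hy)
  exact ⟨F, hF z (mem_ball_self hr),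
    eventually_of_mem (ball_mem_nhds z hr) fun w hw => (hFh hw).symm⟩

theorem eventually_eq_of_harmonicAt_of_eventually_le {h : ℂ → ℝ} {z : ℂ} (hh : HarmonicAt h z)
    (hmax : ∀ᶠ w in 𝓝 z, h w ≤ h z) : ∀ᶠ w in 𝓝 z, h w = h z := by
  obtain ⟨F, hF, hFh⟩ := exists_analyticAt_re_eq_of_harmonicAt hh
  have hdiff : ∀ᶠ w in 𝓝 z, DifferentiableAt ℂ (fun w => Complex.exp (F w)) w := by
    filter_upwards [hF.eventually_analyticAt] with w hw using hw.differentiableAt.cexp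
  have hnorm_max : IsLocalMax (norm ∘ fun w => Complex.exp (F w)) z := by
    filter_upwards [hmax, hFh] with w hw hFw
    simp only [Function.comp, Complex.norm_exp]
    rw [← hFw, ← hFh.self_of_nhds]
    exact Real.exp_le_exp.2 hw
  filter_upwards [Complex.eventually_eq_of_isLocalMax_norm hdiff hnorm_max, hFh] with w hw hFw
  have hre := congrArg norm hw
  rw [Complex.norm_exp, Complex.norm_exp, Real.exp_eq_exp] at hre
  rw [hFw, hre, hFh.self_of_nhds]

theorem subharmonicAt_of_harmonicAt {v : ℂ → ℝ} {z : ℂ} (hv : HarmonicAt v z) :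
    SubharmonicAt v z :=
  fun _ hh hmax => eventually_eq_of_harmonicAt_of_eventually_le (hv.sub hh) hmax

theorem harmonicAt_const (c : ℝ) (z : ℂ) : HarmonicAt (fun _ : ℂ => c) z :=
  harmonicOnNhd_const (s := univ) c z (mem_univ z)

theorem harmonicAt_re_mul_add (p q z : ℂ) : HarmonicAt (fun w : ℂ => (p * w + q).re) z :=
  AnalyticAt.harmonicAt_re (f := fun w => p * w + q) (by fun_prop)

namespace SubharmonicAt

variable {v w : ℂ → ℝ} {z : ℂ}

theorem of_le (hv : SubharmonicAt v z) (hle : ∀ᶠ y in 𝓝 z, v y ≤ w y) (heq : v z = w z) :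
    SubharmonicAt w z := by
  intro g hg hmax
  have hvg := hv g hg (by filter_upwards [hmax, hle] with y h1 h2; linarith)
  filter_upwards [hvg, hmax, hle] with y h1 h2 h3
  linarith

theorem congr (hv : SubharmonicAt v z) (h : v =ᶠ[𝓝 z] w) : SubharmonicAt w z :=
  hv.of_le h.le h.self_of_nhds

theorem sub_harmonicAt {g : ℂ → ℝ} (hv : SubharmonicAt v z) (hg : HarmonicAt g z) :
    SubharmonicAt (fun w => v w - g w) z := by
  intro h hh hmax
  have hvgh := hv (g + h) (hg.add hh) (by
    filter_upwards [hmax] with y hy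
    simp only [Pi.add_apply]
    linarith)
  filter_upwards [hvgh] with y hy
  simp only [Pi.add_apply] at hy
  linarith

theorem sub_const (hv : SubharmonicAt v z) (c : ℝ) : SubharmonicAt (fun w => v w - c) z :=
  hv.sub_harmonicAt (harmonicAt_const c z)

theorem max (hv : SubharmonicAt v z) (hw : SubharmonicAt w z) :
    SubharmonicAt (fun y => max (v y) (w y)) z := by
  rcases le_total (v z) (w z) with h | h
  · exact hw.of_le (Eventually.of_forall fun y => le_max_right _ _) (max_eq_right h).symm
  · exact hv.of_le (Eventually.of_forall fun y => le_max_left _ _) (max_eq_left h).symm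

theorem of_supporting_affine {p : ℂ} (hp : ∀ᶠ w in 𝓝 z, v z + (p * (w - z)).re ≤ v w) :
    SubharmonicAt v z := by
  refine (subharmonicAt_of_harmonicAt (harmonicAt_re_mul_add p (v z - p * z) z)).of_le ?_ (by simp)
  filter_upwards [hp] with y hy
  rw [mul_sub, Complex.sub_re] at hy
  simp only [Complex.add_re, Complex.sub_re, Complex.ofReal_re]
  linarith

end SubharmonicAt

theorem exists_analyticAt_localInverse_add_sq {s : ℂ} (hs : s ≠ 0) (a : ℂ) :
    ∃ τ : ℂ → ℂ, AnalyticAt ℂ τ (a + s ^ 2) ∧ τ (a + s ^ 2) = s ∧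
      (∀ᶠ z in 𝓝 (a + s ^ 2), a + τ z ^ 2 = z) ∧ ∀ᶠ t in 𝓝 s, τ (a + t ^ 2) = t := by
  have han : AnalyticAt ℂ (fun t : ℂ => a + t ^ 2) s := by fun_prop
  have hderiv_ne : deriv (fun t : ℂ => a + t ^ 2) s ≠ 0 := by simpa using hs
  have hderiv := han.hasStrictDerivAt
  have hleft := HasStrictDerivAt.eventually_left_inverse hderiv hderiv_ne
  have hright := HasStrictDerivAt.eventually_right_inverse hderiv hderiv_ne
  exact ⟨hderiv.localInverse _ _ _ hderiv_ne, han.analyticAt_localInverse hderiv_ne,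
    hleft.self_of_nhds, hright, hleft⟩

theorem SubharmonicAt.comp_add_sq {f : ℂ → ℝ} {a s : ℂ} (hs : s ≠ 0)
    (hf : SubharmonicAt f (a + s ^ 2)) : SubharmonicAt (fun t => f (a + t ^ 2)) s := by
  intro h hh hmax
  obtain ⟨τ, hτ, hτs, hright, hleft⟩ := exists_analyticAt_localInverse_add_sq hs a
  have hτ_tendsto : Tendsto τ (𝓝 (a + s ^ 2)) (𝓝 s) := by
    simpa only [hτs] using hτ.continuousAt.tendsto
  obtain ⟨F, hF, hFh⟩ := exists_analyticAt_re_eq_of_harmonicAt hh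
  have hFτ : AnalyticAt ℂ (fun z => F (τ z)) (a + s ^ 2) := AnalyticAt.fun_comp (by rwa [hτs]) hτ
  have hhτ : HarmonicAt (fun z => h (τ z)) (a + s ^ 2) :=
    (harmonicAt_congr_nhds (f₁ := fun z => h (τ z)) (hτ_tendsto.eventually hFh)).2 hFτ.harmonicAt_re
  have hconst := hf _ hhτ (by
    filter_upwards [hτ_tendsto.eventually hmax, hright] with z hz hτz
    rw [hτz] at hz
    rwa [hτs])
  have hsq_tendsto : Tendsto (fun t : ℂ => a + t ^ 2) (𝓝 s) (𝓝 (a + s ^ 2)) :=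
    Continuous.tendsto (by fun_prop) s
  filter_upwards [hsq_tendsto.eventually hconst, hleft] with t ht hτt
  rwa [hτt, hτs] at ht

theorem SubharmonicAt.exists_re_lt_of_isMaxOn {g : ℂ → ℝ} {q : ℂ} {D : Set ℂ}
    (hg : SubharmonicAt g q) (hD : D ∈ 𝓝 q) (hmax : IsMaxOn g D q) :
    ∃ w ∈ D, g w = g q ∧ q.re < w.re := by
  have hconst := hg (fun _ => 0) (harmonicAt_const 0 q) (by
    filter_upwards [hD] with w hw
    rw [sub_zero, sub_zero]
    exact hmax hw)
  obtain ⟨ε, hε, hball⟩ := Metric.mem_nhds_iff.1 (hconst.and hD)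
  have hmem : q + (ε / 2 : ℝ) ∈ ball q ε := by
    rw [mem_ball, dist_eq_norm, add_sub_cancel_left, Complex.norm_real, Real.norm_eq_abs,
      abs_of_pos (half_pos hε)]
    exact half_lt_self hε
  refine ⟨_, (hball hmem).2, by simpa only [sub_zero] using (hball hmem).1, ?_⟩
  rw [Complex.add_re, Complex.ofReal_re]
  exact lt_add_of_pos_right _ (half_pos hε)

theorem nonpos_of_subharmonicAt {D : Set ℂ} (hD : IsOpen D) (hb : Bornology.IsBounded D)
    {g : ℂ → ℝ} (hg : ContinuousOn g (closure D)) (hsub : ∀ z ∈ D, SubharmonicAt g z)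
    (hle : ∀ z ∈ frontier D, g z ≤ 0) : ∀ z ∈ closure D, g z ≤ 0 := by
  by_contra! hcon
  obtain ⟨z₀, hz₀, hpos⟩ := hcon
  have hcompact : IsCompact (closure D) := hb.isCompact_closure
  obtain ⟨p, hp, hp_max⟩ := hcompact.exists_isMaxOn ⟨z₀, hz₀⟩ hg
  have hlevel : IsCompact (closure D ∩ g ⁻¹' {g p}) :=
    hcompact.of_isClosed_subset
      (hg.preimage_isClosed_of_isClosed isClosed_closure isClosed_singleton) inter_subset_left
  -- a point where the maximum is attained, chosen as far to the right as possible
  obtain ⟨q, ⟨hq, hqp⟩, hq_right⟩ :=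
    hlevel.exists_isMaxOn ⟨p, hp, rfl⟩ Complex.continuous_re.continuousOn
  replace hqp : g q = g p := hqp
  have hqD : q ∈ D := by
    by_contra hn
    have := hle q (by rw [hD.frontier_eq]; exact ⟨hq, hn⟩)
    exact (hpos.trans_le (hp_max hz₀)).not_ge (hqp ▸ this)
  obtain ⟨w, hwD, hwq, hre⟩ := (hsub q hqD).exists_re_lt_of_isMaxOn (hD.mem_nhds hqD)
    fun w hw => hqp ▸ hp_max (subset_closure hw)
  exact (hq_right ⟨subset_closure hwD, hwq.trans hqp⟩).not_gt hre

theorem le_of_subharmonicAt_of_harmonicContOnCl {D : Set ℂ} (hD : IsOpen D)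
    (hb : Bornology.IsBounded D) {v H : ℂ → ℝ} (hv : ContinuousOn v (closure D))
    (hsub : ∀ z ∈ D, SubharmonicAt v z) (hH : HarmonicContOnCl H D)
    (hle : ∀ z ∈ frontier D, v z ≤ H z) : ∀ z ∈ closure D, v z ≤ H z := fun z hz =>
  sub_nonpos.1 <| nonpos_of_subharmonicAt hD hb (hv.sub hH.continuousOn)
    (fun z hz => (hsub z hz).sub_harmonicAt (hH.harmonicOnNhd z hz))
    (fun z hz => sub_nonpos.2 (hle z hz)) z hz

/-! ## The Poisson integral -/

section PoissonKernel

variable {c w z : ℂ} {R : ℝ}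

theorem continuousOn_poissonKernel (hw : w ∈ ball c R) :
    ContinuousOn (poissonKernel c w) (sphere c |R|) := by
  rw [poissonKernel_eq_re_herglotzRieszKernel]
  exact Complex.continuous_re.comp_continuousOn (continuousOn_herglotzRieszKernel_sphere hw)

theorem poissonKernel_le (hw : w ∈ ball c R) (hz : z ∈ sphere c R) :
    poissonKernel c w z ≤ (R + ‖w - c‖) / (R - ‖w - c‖) := by
  rw [poissonKernel_eq_re_herglotzRieszKernel]
  exact re_herglotzRieszKernel_le hz hw

theorem le_poissonKernel (hw : w ∈ ball c R) (hz : z ∈ sphere c R) :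
    (R - ‖w - c‖) / (R + ‖w - c‖) ≤ poissonKernel c w z := by
  rw [poissonKernel_eq_re_herglotzRieszKernel]
  exact le_re_herglotzRieszKernel hz hw

theorem poissonKernel_nonneg (hw : w ∈ ball c R) (hz : z ∈ sphere c R) :
    0 ≤ poissonKernel c w z := by
  have hwR : ‖w - c‖ < R := mem_ball_iff_norm.1 hw
  have := norm_nonneg (w - c)
  exact (div_nonneg (by linarith) (by linarith)).trans (le_poissonKernel hw hz)

theorem poissonKernel_self (hR : R ≠ 0) (hz : z ∈ sphere c R) : poissonKernel c c z = 1 := by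
  rw [poissonKernel, sub_self, sub_zero, norm_zero, mem_sphere_iff_norm.1 hz]
  simp [hR]

theorem poissonKernel_add (c h z : ℂ) :
    poissonKernel c (c + h) z = (((z - c) + h) / ((z - c) - h)).re := by
  rw [poissonKernel_eq_re_herglotzRieszKernel, Function.comp_apply, herglotzRieszKernel_def,
    add_sub_cancel_left]

theorem abs_poissonKernel_sub_one_le (hR : 0 < R) (hz : z ∈ sphere c R)
    (hw : dist w c ≤ R / 2) :
    |poissonKernel c w z - 1| ≤ 4 * (dist w c / R) := by
  have hzc : ‖z - c‖ = R := mem_sphere_iff_norm.1 hz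
  obtain ⟨h, rfl⟩ : ∃ h, w = c + h := ⟨w - c, (add_sub_cancel c w).symm⟩
  rw [dist_self_add_left] at hw ⊢
  have hfar : R / 2 ≤ ‖(z - c) - h‖ := by linarith [norm_sub_norm_le (z - c) h]
  have hne : (z - c) - h ≠ 0 := norm_pos_iff.1 (by linarith)
  have hkernel : poissonKernel c (c + h) z - 1 = (2 * h / ((z - c) - h)).re := by
    rw [poissonKernel_add, ← Complex.one_re, ← Complex.sub_re, div_sub_one hne]
    ring_nf
  rw [hkernel]
  refine (Complex.abs_re_le_norm _).trans ?_
  rw [norm_div, norm_mul, Complex.norm_ofNat, div_le_iff₀ (norm_pos_iff.2 hne)]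
  calc 2 * ‖h‖ = 4 * (‖h‖ / R) * (R / 2) := by field_simp; ring
    _ ≤ 4 * (‖h‖ / R) * ‖(z - c) - h‖ := by gcongr

theorem sub_pow_four_eq_mul (ζ h : ℂ) : ζ ^ 4 - h ^ 4 =
    (ζ - h) * (ζ + h) * ((ζ - h * Complex.I) * (ζ + h * Complex.I)) := by
  linear_combination ((ζ ^ 2 - h ^ 2) * h ^ 2) * Complex.I_sq

theorem sum_div_fourth_roots {ζ h : ℂ} (hne : ζ ^ 4 - h ^ 4 ≠ 0) :
    (ζ + h) / (ζ - h) + (ζ - h) / (ζ + h) +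
        (ζ + h * Complex.I) / (ζ - h * Complex.I) + (ζ - h * Complex.I) / (ζ + h * Complex.I) =
      4 + 8 * h ^ 4 / (ζ ^ 4 - h ^ 4) := by
  have hfactors := hne
  rw [sub_pow_four_eq_mul, mul_ne_zero_iff, mul_ne_zero_iff, mul_ne_zero_iff] at hfactors
  obtain ⟨⟨h₁, h₂⟩, h₃, h₄⟩ := hfactors
  rw [add_assoc, div_add_div _ _ h₁ h₂, div_add_div _ _ h₃ h₄,
    div_add_div _ _ (mul_ne_zero h₁ h₂) (mul_ne_zero h₃ h₄), ← sub_pow_four_eq_mul, add_comm 4,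
    div_add' _ _ _ hne]
  congr 1
  linear_combination (-4 * h ^ 4) * Complex.I_sq

/-- Summed over the fourth roots of unity `ω`, the expansion `(ζ + ωh) / (ζ - ωh) = 1 + 2 ∑ (ωh/ζ)ⁿ`
keeps only the powers divisible by `4`. -/
theorem abs_sum_poissonKernel_stencil_le {h : ℂ} (hR : 0 < R) (hz : z ∈ sphere c R)
    (hh : ‖h‖ ≤ R / 2) :
    |poissonKernel c (c + h) z + poissonKernel c (c - h) z +
      poissonKernel c (c + h * Complex.I) z + poissonKernel c (c - h * Complex.I) z - 4| ≤
      16 * (‖h‖ / R) ^ 4 := by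
  set ζ := z - c with hζ
  have hζR : ‖ζ‖ = R := mem_sphere_iff_norm.1 hz
  have hfar : R ^ 4 / 2 ≤ ‖ζ ^ 4 - h ^ 4‖ := by
    have hle := norm_sub_norm_le (ζ ^ 4) (h ^ 4)
    rw [norm_pow, norm_pow, hζR] at hle
    have hpow : ‖h‖ ^ 4 ≤ (R / 2) ^ 4 := by gcongr
    have : 0 < R ^ 4 := by positivity
    rw [div_pow] at hpow
    linarith
  have hne : ζ ^ 4 - h ^ 4 ≠ 0 := norm_pos_iff.1 (lt_of_lt_of_le (by positivity) hfar)
  have hkernel : poissonKernel c (c + h) z + poissonKernel c (c - h) z +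
      poissonKernel c (c + h * Complex.I) z + poissonKernel c (c - h * Complex.I) z - 4 =
      (8 * h ^ 4 / (ζ ^ 4 - h ^ 4)).re := by
    have hre := congrArg Complex.re (sum_div_fourth_roots hne)
    simp only [Complex.add_re, Complex.re_ofNat] at hre
    rw [sub_eq_add_neg c h, sub_eq_add_neg c (h * Complex.I)]
    simp only [poissonKernel_add, ← hζ, sub_neg_eq_add]
    simp only [← sub_eq_add_neg]
    linarith
  rw [hkernel]
  refine (Complex.abs_re_le_norm _).trans ?_
  rw [norm_div, norm_mul, norm_pow, Complex.norm_ofNat, div_le_iff₀ (norm_pos_iff.2 hne)]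
  calc 8 * ‖h‖ ^ 4 = 16 * (‖h‖ / R) ^ 4 * (R ^ 4 / 2) := by field_simp; ring
    _ ≤ 16 * (‖h‖ / R) ^ 4 * ‖ζ ^ 4 - h ^ 4‖ := by gcongr

end PoissonKernel

/-- The Poisson integral of `f` over the circle of centre `c` and radius `R`: inside the circle, the
harmonic function with boundary values `f`. -/
noncomputable def poissonIntegral (c : ℂ) (R : ℝ) (f : ℂ → ℝ) (w : ℂ) : ℝ :=
  Real.circleAverage (fun ζ => poissonKernel c w ζ * f ζ) c R

section PoissonIntegral

variable {c w : ℂ} {R : ℝ} {f g : ℂ → ℝ}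

theorem circleIntegrable_poissonKernel_mul (hw : w ∈ ball c R) (hf : CircleIntegrable f c R) :
    CircleIntegrable (fun ζ => poissonKernel c w ζ * f ζ) c R :=
  hf.continuousOn_smul (continuousOn_poissonKernel hw)

theorem poissonIntegral_mono (hw : w ∈ ball c R) (hf : CircleIntegrable f c R)
    (hg : CircleIntegrable g c R) (h : ∀ ζ ∈ sphere c R, f ζ ≤ g ζ) :
    poissonIntegral c R f w ≤ poissonIntegral c R g w := by
  refine Real.circleAverage_mono (circleIntegrable_poissonKernel_mul hw hf)
    (circleIntegrable_poissonKernel_mul hw hg) fun ζ hζ => ?_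
  rw [abs_of_pos (pos_of_mem_ball hw)] at hζ
  exact mul_le_mul_of_nonneg_left (h ζ hζ) (poissonKernel_nonneg hw hζ)

theorem poissonIntegral_of_harmonicContOnCl (hf : HarmonicContOnCl f (ball c R))
    (hw : w ∈ ball c R) : poissonIntegral c R f w = f w :=
  hf.circleAverage_poissonKernel_smul hw

theorem poissonIntegral_const (hw : w ∈ ball c R) (a : ℝ) :
    poissonIntegral c R (fun _ => a) w = a :=
  poissonIntegral_of_harmonicContOnCl harmonicContOnCl_const hw

theorem poissonIntegral_sub (hw : w ∈ ball c R) (hf : CircleIntegrable f c R)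
    (hg : CircleIntegrable g c R) :
    poissonIntegral c R (fun z => f z - g z) w =
      poissonIntegral c R f w - poissonIntegral c R g w := by
  simp only [poissonIntegral, mul_sub]
  exact Real.circleAverage_fun_sub (circleIntegrable_poissonKernel_mul hw hf)
    (circleIntegrable_poissonKernel_mul hw hg)

theorem poissonIntegral_translate :
    poissonIntegral c R f w = poissonIntegral 0 R (fun z => f (z + c)) (w - c) := by
  rw [poissonIntegral, poissonIntegral, ← Real.circleAverage_map_add_const]
  simp [poissonKernel]

theorem harmonicAt_poissonIntegral (hf : CircleIntegrable f c R) (hw : w ∈ ball c R) :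
    HarmonicAt (poissonIntegral c R f) w := by
  have hf0 : CircleIntegrable (fun z => f (z + c)) 0 R := by
    simpa [CircleIntegrable, circleMap, add_comm] using hf
  have hf1 : CircleIntegrable (fun z => (f (z + c) : ℂ)) 0 R := by
    simp only [CircleIntegrable, intervalIntegrable_iff] at hf0 ⊢
    exact Complex.ofRealCLM.integrable_comp hf0
  have h1 := analyticOnNhd_circleAverage_herglotzRieszKernel_smul hf1
  have hw0 : ∀ y ∈ ball c R, y - c ∈ ball 0 R := fun y hy => by simpa using mem_ball_iff_norm.1 hy
  have h2 : AnalyticAt ℂ (fun y => Real.circleAverage (fun ζ => herglotzRieszKernel 0 (y - c) ζ •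
      (f (ζ + c) : ℂ)) 0 R) w :=
    AnalyticAt.fun_comp (g := fun y => Real.circleAverage (fun ζ => herglotzRieszKernel 0 y ζ •
      (f (ζ + c) : ℂ)) 0 R) (f := fun y => y - c) (h1 _ (hw0 w hw)) (by fun_prop)
  refine (harmonicAt_congr_nhds ?_).2 h2.harmonicAt_re
  filter_upwards [isOpen_ball.mem_nhds hw] with y hy
  rw [poissonIntegral_translate, re_circleAverage_herglotzRieszKernel_smul hf0 (hw0 y hy),
    poissonIntegral, poissonKernel_eq_re_herglotzRieszKernel]
  rfl

theorem abs_poissonIntegral_sub_le {G : ℂ → ℝ} {a : ℝ} (hw : w ∈ ball c R)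
    (hf : CircleIntegrable f c R) (hG : HarmonicContOnCl G (ball c R))
    (hle : ∀ ζ ∈ sphere c R, |f ζ - a| ≤ G ζ) : |poissonIntegral c R f w - a| ≤ G w := by
  have hR : 0 ≤ R := (pos_of_mem_ball hw).le
  have hGi : CircleIntegrable G c R :=
    (hG.continuousOn_ball.mono sphere_subset_closedBall).circleIntegrable hR
  have ha : CircleIntegrable (fun _ : ℂ => a) c R := continuousOn_const.circleIntegrable hR
  have hupper := poissonIntegral_mono hw (hf.sub ha) hGi fun ζ hζ => (abs_le.1 (hle ζ hζ)).2
  have hlower := poissonIntegral_mono hw (ha.sub hf) hGi fun ζ hζ => by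
    rw [Pi.sub_apply]
    linarith [(abs_le.1 (hle ζ hζ)).1]
  rw [poissonIntegral_of_harmonicContOnCl hG hw] at hupper hlower
  have hfa := poissonIntegral_sub hw hf ha
  have haf := poissonIntegral_sub hw ha hf
  rw [poissonIntegral_const hw] at hfa haf
  exact abs_le.2 ⟨by linarith [haf.symm.trans_le hlower], hfa.symm.trans_le hupper⟩

theorem exists_forall_abs_sub_le_add_mul_dist_sq {X : Type*} [PseudoMetricSpace X] {K : Set X}
    (hK : IsCompact K) {f : X → ℝ} (hf : ContinuousOn f K) {ε : ℝ} (hε : 0 < ε) :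
    ∃ C, 0 ≤ C ∧ ∀ x ∈ K, ∀ y ∈ K, |f x - f y| ≤ ε + C * dist x y ^ 2 := by
  obtain ⟨M, hM⟩ := hK.exists_bound_of_continuousOn hf
  obtain ⟨δ, hδ, hδf⟩ :=
    Metric.uniformContinuousOn_iff.1 (hK.uniformContinuousOn_of_continuous hf) ε hε
  refine ⟨2 * |M| / δ ^ 2, by positivity, fun x hx y hy => ?_⟩
  by_cases hd : dist x y < δ
  · have hsmall := hδf x hx y hy hd
    rw [Real.dist_eq] at hsmall
    exact hsmall.le.trans (le_add_of_nonneg_right (by positivity))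
  · have hfar : 2 * |M| ≤ 2 * |M| / δ ^ 2 * dist x y ^ 2 := by
      rw [div_mul_eq_mul_div, le_div_iff₀ (by positivity)]
      gcongr
      exact not_lt.1 hd
    have hfx : |f x| ≤ |M| := (hM x hx).trans (le_abs_self M)
    have hfy : |f y| ≤ |M| := (hM y hy).trans (le_abs_self M)
    linarith [abs_sub (f x) (f y)]

theorem exists_harmonic_eq_dist_sq_on_sphere {ζ₀ : ℂ} (hζ₀ : ζ₀ ∈ sphere c R) :
    ∃ L : ℂ → ℝ, Continuous L ∧ (∀ z, HarmonicAt L z) ∧ ∀ ζ ∈ sphere c R, L ζ = dist ζ ζ₀ ^ 2 := by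
  set p : ℂ := -2 * (starRingEnd ℂ) (ζ₀ - c)
  set q : ℂ := 2 * R ^ 2 - p * c
  refine ⟨fun w => (p * w + q).re, by fun_prop, harmonicAt_re_mul_add p q, fun ζ hζ => ?_⟩
  have hsq : ∀ ξ ∈ sphere c R, R ^ 2 = (ξ.re - c.re) ^ 2 + (ξ.im - c.im) ^ 2 := fun ξ hξ => by
    rw [← mem_sphere_iff_norm.1 hξ, ← Complex.normSq_eq_norm_sq, Complex.normSq_apply,
      Complex.sub_re, Complex.sub_im]
    ring
  rw [dist_eq_norm, ← Complex.normSq_eq_norm_sq, Complex.normSq_apply]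
  simp [p, q, ← Complex.ofReal_pow]
  linear_combination hsq ζ hζ + hsq ζ₀ hζ₀

theorem tendsto_poissonIntegral (hR : 0 ≤ R) (hf : ContinuousOn f (sphere c R)) {ζ₀ : ℂ}
    (hζ₀ : ζ₀ ∈ sphere c R) :
    Tendsto (poissonIntegral c R f) (𝓝[ball c R] ζ₀) (𝓝 (f ζ₀)) := by
  rw [Metric.tendsto_nhds]
  intro ε hε
  obtain ⟨C, -, hC⟩ :=
    exists_forall_abs_sub_le_add_mul_dist_sq (isCompact_sphere c R) hf (half_pos hε)
  obtain ⟨L, hLc, hL, hLs⟩ := exists_harmonic_eq_dist_sq_on_sphere hζ₀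
  have hG : HarmonicContOnCl ((fun _ => ε / 2) + C • L) (ball c R) :=
    harmonicContOnCl_const.add ((HarmonicOnNhd.harmonicContOnCl fun z _ => hL z).const_smul C)
  have hsmall : ∀ᶠ w in 𝓝 ζ₀, C * L w < ε / 2 := by
    refine ((hLc.const_mul C).tendsto ζ₀).eventually_lt_const ?_
    rw [hLs ζ₀ hζ₀, dist_self]
    linarith
  filter_upwards [self_mem_nhdsWithin, mem_nhdsWithin_of_mem_nhds hsmall] with w hw hLw
  have hle := abs_poissonIntegral_sub_le hw (hf.circleIntegrable hR) hG fun ζ hζ => by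
    simpa only [Pi.add_apply, Pi.smul_apply, smul_eq_mul, hLs ζ hζ] using hC ζ hζ ζ₀ hζ₀
  simp only [Pi.add_apply, Pi.smul_apply, smul_eq_mul] at hle
  rw [Real.dist_eq]
  linarith

end PoissonIntegral

theorem abs_sum_le_of_abs_sum_poissonKernel_le {ι : Type*} {s : Finset ι} {a : ι → ℝ} {w : ι → ℂ}
    {c : ℂ} {R M ε : ℝ} {u : ℂ → ℝ} (hR : 0 < R) (hw : ∀ i ∈ s, w i ∈ ball c R)
    (hu : HarmonicContOnCl u (ball c R)) (hM : ∀ z ∈ sphere c R, |u z| ≤ M)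
    (hε : ∀ z ∈ sphere c R, |∑ i ∈ s, a i * poissonKernel c (w i) z| ≤ ε) :
    |∑ i ∈ s, a i * u (w i)| ≤ ε * M := by
  have hus : ContinuousOn u (sphere c R) := hu.continuousOn_ball.mono sphere_subset_closedBall
  have hks : ContinuousOn (fun z => (∑ i ∈ s, a i * poissonKernel c (w i) z) * u z)
      (sphere c R) := by
    refine (continuousOn_finsetSum s fun i hi => continuousOn_const.mul ?_).mul hus
    simpa only [abs_of_pos hR] using continuousOn_poissonKernel (hw i hi)
  have hsum : ∑ i ∈ s, a i * u (w i) =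
      Real.circleAverage (fun z => (∑ i ∈ s, a i * poissonKernel c (w i) z) * u z) c R := by
    simp only [Finset.sum_mul, mul_assoc]
    simp only [← smul_eq_mul (a _)]
    rw [Real.circleAverage_fun_sum fun i hi => (circleIntegrable_poissonKernel_mul (hw i hi)
      (hus.circleIntegrable hR.le)).const_fun_smul]
    refine Finset.sum_congr rfl fun i hi => ?_
    rw [Real.circleAverage_fun_smul, ← poissonIntegral_of_harmonicContOnCl hu (hw i hi),
      poissonIntegral]
  rw [hsum]
  refine Real.abs_circleAverage_le_circleAverage_abs.trans ?_
  refine Real.circleAverage_mono_on_of_le_circle (hks.abs.circleIntegrable hR.le) fun z hz => ?_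
  rw [abs_of_pos hR] at hz
  rw [Pi.abs_apply, abs_mul]
  exact mul_le_mul (hε z hz) (hM z hz) (abs_nonneg _) ((abs_nonneg _).trans (hε z hz))

theorem abs_sub_le_of_harmonicContOnCl {c w : ℂ} {R M : ℝ} {u : ℂ → ℝ} (hR : 0 < R)
    (hu : HarmonicContOnCl u (ball c R)) (hM : ∀ z ∈ sphere c R, |u z| ≤ M)
    (hw : dist w c ≤ R / 2) : |u w - u c| ≤ 4 * (dist w c / R) * M := by
  have hmem : ∀ i ∈ Finset.univ, ![w, c] i ∈ ball c R := by
    simp only [Finset.mem_univ, true_imp_iff, Fin.forall_fin_two, Matrix.cons_val]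
    exact ⟨mem_ball.2 (by linarith), mem_ball_self hR⟩
  have hbound := abs_sum_le_of_abs_sum_poissonKernel_le (a := ![1, -1]) hR hmem hu hM
    (ε := 4 * (dist w c / R)) fun z hz => by
      simpa only [Fin.sum_univ_two, Matrix.cons_val, poissonKernel_self hR.ne' hz, one_mul, mul_one,
        ← sub_eq_add_neg] using abs_poissonKernel_sub_one_le hR hz hw
  simpa only [Fin.sum_univ_two, Matrix.cons_val, one_mul, neg_one_mul, ← sub_eq_add_neg]
    using hbound

theorem abs_stencil_sum_le_of_harmonicContOnCl {c h : ℂ} {R M : ℝ} {u : ℂ → ℝ} (hR : 0 < R)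
    (hu : HarmonicContOnCl u (ball c R)) (hM : ∀ z ∈ sphere c R, |u z| ≤ M) (hh : ‖h‖ ≤ R / 2) :
    |u (c + h) + u (c - h) + u (c + h * Complex.I) + u (c - h * Complex.I) - 4 * u c| ≤
      16 * (‖h‖ / R) ^ 4 * M := by
  have hhR : ‖h‖ < R := by linarith
  have hmem : ∀ i ∈ Finset.univ,
      ![c + h, c - h, c + h * Complex.I, c - h * Complex.I, c] i ∈ ball c R := by
    simp [Fin.forall_fin_succ, hhR, hR]
  have hbound := abs_sum_le_of_abs_sum_poissonKernel_le (a := ![1, 1, 1, 1, -4]) hR hmem hu hM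
    (ε := 16 * (‖h‖ / R) ^ 4) fun z hz => by
      simpa only [Fin.sum_univ_five, Matrix.cons_val, poissonKernel_self hR.ne' hz, one_mul,
        mul_one, ← sub_eq_add_neg] using abs_sum_poissonKernel_stencil_le hR hz hh
  simpa only [Fin.sum_univ_five, Matrix.cons_val, one_mul, neg_mul, ← sub_eq_add_neg] using hbound

theorem poissonIntegral_le_of_circleAverage_le {c w : ℂ} {R M : ℝ} {f : ℂ → ℝ} (hR : 0 < R)
    (hM : 0 ≤ M) (hf : CircleIntegrable f c R) (hfM : ∀ z ∈ sphere c R, f z ≤ M)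
    (havg : Real.circleAverage f c R ≤ M / 2) (hw : ‖w - c‖ ≤ R / 4) :
    poissonIntegral c R f w ≤ 3 / 4 * M := by
  have hwR : w ∈ ball c R := mem_ball_iff_norm.2 (by linarith)
  have hMi : CircleIntegrable (fun _ : ℂ => M) c R := continuousOn_const.circleIntegrable hR.le
  have hMf : CircleIntegrable (fun z => M - f z) c R := hMi.sub hf
  have hkernel : ∀ z ∈ sphere c R, 3 / 5 ≤ poissonKernel c w z := fun z hz => by
    refine le_trans ?_ (le_poissonKernel hwR hz)
    rw [le_div_iff₀ (by positivity)]
    linarith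
  have hle : Real.circleAverage (fun z => (3 / 5 : ℝ) • (M - f z)) c R ≤
      poissonIntegral c R (fun z => M - f z) w := by
    refine Real.circleAverage_mono hMf.const_fun_smul (circleIntegrable_poissonKernel_mul hwR hMf)
      fun z hz => ?_
    rw [abs_of_pos hR] at hz
    exact mul_le_mul_of_nonneg_right (hkernel z hz) (sub_nonneg.2 (hfM z hz))
  rw [Real.circleAverage_fun_smul, Real.circleAverage_fun_sub hMi hf, Real.circleAverage_const,
    smul_eq_mul, poissonIntegral_sub hwR hMi hf, poissonIntegral_const hwR] at hle
  linarith

section DominatedConvergence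

variable {c w : ℂ} {R C : ℝ} {f : ℕ → ℂ → ℝ} {u : ℂ → ℝ}

theorem circleIntegrable_of_tendsto_of_abs_le (hR : 0 ≤ R) (hf : ∀ n, Measurable (f n))
    (hC : ∀ n, ∀ z ∈ sphere c R, |f n z| ≤ C)
    (hlim : ∀ z, Tendsto (fun n => f n z) atTop (𝓝 (u z))) : CircleIntegrable u c R := by
  have hu : Measurable u := measurable_of_tendsto_metrizable hf (tendsto_pi_nhds.2 hlim)
  refine (intervalIntegrable_const (c := C)).mono_fun
    (hu.comp (continuous_circleMap c R).measurable).aestronglyMeasurable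
    (Eventually.of_forall fun θ => ?_)
  exact (le_of_tendsto' (hlim _).abs fun n => hC n _ (circleMap_mem_sphere c hR θ)).trans
    (le_abs_self C)

theorem tendsto_poissonIntegral_of_tendsto_of_abs_le (hw : w ∈ ball c R)
    (hf : ∀ n, Measurable (f n)) (hC : ∀ n, ∀ z ∈ sphere c R, |f n z| ≤ C)
    (hlim : ∀ z, Tendsto (fun n => f n z) atTop (𝓝 (u z))) :
    Tendsto (fun n => poissonIntegral c R (f n) w) atTop (𝓝 (poissonIntegral c R u w)) := by
  have hsphere : ∀ θ, circleMap c R θ ∈ sphere c R :=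
    circleMap_mem_sphere c (pos_of_mem_ball hw).le
  have hkernel : Measurable (poissonKernel c w) := by
    unfold poissonKernel
    fun_prop
  refine Tendsto.const_smul (intervalIntegral.tendsto_integral_filter_of_dominated_convergence
    (fun _ => (R + ‖w - c‖) / (R - ‖w - c‖) * C) (Eventually.of_forall fun n => ?_)
    (Eventually.of_forall fun n => Eventually.of_forall fun θ _ => ?_) intervalIntegrable_const
    (Eventually.of_forall fun θ _ => (hlim _).const_mul _)) _
  · exact ((hkernel.mul (hf n)).comp (continuous_circleMap c R).measurable).aestronglyMeasurable
  · have hk := poissonKernel_nonneg hw (hsphere θ)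
    have hkle := poissonKernel_le hw (hsphere θ)
    rw [norm_mul, Real.norm_eq_abs, Real.norm_eq_abs, abs_of_nonneg hk]
    exact mul_le_mul hkle (hC n _ (hsphere θ)) (abs_nonneg _) (hk.trans hkle)

end DominatedConvergence

section PoissonModification

variable {c w : ℂ} {R : ℝ} {f : ℂ → ℝ}

/-- The Poisson modification of `f` in the disc of centre `c` and radius `R`: `f` is replaced by its
Poisson integral inside the disc, and is unchanged outside. -/
noncomputable def poissonModification (c : ℂ) (R : ℝ) (f : ℂ → ℝ) : ℂ → ℝ :=
  open Classical in fun w => if w ∈ ball c R then poissonIntegral c R f w else f w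

theorem poissonModification_of_mem (hw : w ∈ ball c R) :
    poissonModification c R f w = poissonIntegral c R f w :=
  if_pos hw

theorem poissonModification_of_notMem (hw : w ∉ ball c R) : poissonModification c R f w = f w :=
  if_neg hw

theorem harmonicAt_poissonModification (hf : CircleIntegrable f c R) (hw : w ∈ ball c R) :
    HarmonicAt (poissonModification c R f) w := by
  refine (harmonicAt_congr_nhds ?_).2 (harmonicAt_poissonIntegral hf hw)
  filter_upwards [isOpen_ball.mem_nhds hw] with y hy using poissonModification_of_mem hy

theorem continuousOn_poissonModification (hR : 0 < R) {s : Set ℂ} (hs : closedBall c R ⊆ s)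
    (hf : ContinuousOn f s) : ContinuousOn (poissonModification c R f) s := by
  have hfs : ContinuousOn f (sphere c R) := hf.mono (sphere_subset_closedBall.trans hs)
  intro z hz
  by_cases hzb : z ∈ ball c R
  · exact (harmonicAt_poissonModification (hfs.circleIntegrable hR.le)
      hzb).1.continuousAt.continuousWithinAt
  have houtside : Tendsto (poissonModification c R f) (𝓝[s ∩ (ball c R)ᶜ] z) (𝓝 (f z)) := by
    refine ((hf z hz).mono inter_subset_left).congr' ?_
    filter_upwards [self_mem_nhdsWithin] with y hy using (poissonModification_of_notMem hy.2).symm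
  have hinside : Tendsto (poissonModification c R f) (𝓝[s ∩ ball c R] z) (𝓝 (f z)) := by
    by_cases hzs : z ∈ sphere c R
    · refine ((tendsto_poissonIntegral hR.le hfs hzs).mono_left
        (nhdsWithin_mono z inter_subset_right)).congr' ?_
      filter_upwards [self_mem_nhdsWithin] with y hy using (poissonModification_of_mem hy.2).symm
    · have hbot : 𝓝[s ∩ ball c R] z = ⊥ := by
        refine notMem_closure_iff_nhdsWithin_eq_bot.1 fun hcl => ?_
        have hz' := closure_ball_subset_closedBall (closure_mono inter_subset_right hcl)
        rw [← sphere_union_ball] at hz'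
        exact hz'.elim hzs hzb
      rw [hbot]
      exact tendsto_bot
  rw [ContinuousWithinAt, poissonModification_of_notMem hzb]
  have := houtside.sup hinside
  rwa [← nhdsWithin_union, union_comm, inter_union_compl] at this

theorem le_poissonModification (hR : 0 < R) (hf : ContinuousOn f (closedBall c R))
    (hs : ∀ z ∈ ball c R, SubharmonicAt f z) (w : ℂ) : f w ≤ poissonModification c R f w := by
  by_cases hw : w ∈ ball c R
  · have hcl : closure (ball c R) = closedBall c R := closure_ball c hR.ne'
    have hfi := (hf.mono sphere_subset_closedBall).circleIntegrable hR.le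
    refine le_of_subharmonicAt_of_harmonicContOnCl isOpen_ball isBounded_ball (by rwa [hcl]) hs
      ⟨fun z hz => harmonicAt_poissonModification hfi hz,
        by rw [hcl]; exact continuousOn_poissonModification hR subset_rfl hf⟩
      (fun z hz => ?_) w (subset_closure hw)
    rw [frontier_ball c hR.ne'] at hz
    rw [poissonModification_of_notMem fun hzb => (mem_ball.1 hzb).ne hz]
  · rw [poissonModification_of_notMem hw]

theorem subharmonicAt_poissonModification (hR : 0 < R) (hf : ContinuousOn f (closedBall c R))
    (hs : ∀ z ∈ ball c R, SubharmonicAt f z) (hw : SubharmonicAt f w) :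
    SubharmonicAt (poissonModification c R f) w := by
  by_cases h : w ∈ ball c R
  · exact subharmonicAt_of_harmonicAt (harmonicAt_poissonModification
      ((hf.mono sphere_subset_closedBall).circleIntegrable hR.le) h)
  · exact hw.of_le (Eventually.of_forall (le_poissonModification hR hf hs))
      (poissonModification_of_notMem h).symm

theorem poissonModification_le {M : ℝ} (hR : 0 < R) (hf : ContinuousOn f (sphere c R))
    (hM : ∀ z ∈ closedBall c R, f z ≤ M) (hw : w ∈ closedBall c R) :
    poissonModification c R f w ≤ M := by
  by_cases h : w ∈ ball c R
  · rw [poissonModification_of_mem h, ← poissonIntegral_const h M]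
    exact poissonIntegral_mono h (hf.circleIntegrable hR.le)
      (continuousOn_const.circleIntegrable hR.le) fun z hz => hM z (sphere_subset_closedBall hz)
  · rw [poissonModification_of_notMem h]
    exact hM w hw

end PoissonModification

/-! ## Decay at points where the complement is not thin -/

theorem circleAverage_comp_neg (f : ℂ → ℝ) (R : ℝ) :
    Real.circleAverage (fun z => f (-z)) 0 R = Real.circleAverage f 0 R := by
  rw [← Real.circleAverage_neg_radius (f := f)]
  simp [Real.circleAverage, circleMap]

theorem circleAverage_le_half_of_add_neg_le {f : ℂ → ℝ} {R M : ℝ} (hR : 0 ≤ R)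
    (hf : ContinuousOn f (sphere 0 R)) (hM : ∀ z ∈ sphere (0 : ℂ) R, f z + f (-z) ≤ M) :
    Real.circleAverage f 0 R ≤ M / 2 := by
  have hfi := hf.circleIntegrable hR
  have hfi' : CircleIntegrable (fun z => f (-z)) 0 R :=
    (hf.comp continuous_neg.continuousOn fun z hz => by simpa using hz).circleIntegrable hR
  have havg := Real.circleAverage_mono_on_of_le_circle (hfi.add hfi')
    (by rwa [abs_of_nonneg hR])
  rw [Real.circleAverage_add hfi hfi', circleAverage_comp_neg] at havg
  linarith

/-- The function `z - a` has a continuous square root on `W`. -/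
def HasSqrtOn (W : Set ℂ) (a : ℂ) : Prop :=
  ∃ σ : ℂ → ℂ, ContinuousOn σ W ∧ ∀ z ∈ W, σ z ^ 2 = z - a

theorem HasSqrtOn.mono {W W' : Set ℂ} {a : ℂ} (h : HasSqrtOn W a) (hW : W' ⊆ W) :
    HasSqrtOn W' a :=
  h.imp fun _ hσ => ⟨hσ.1.mono hW, fun z hz => hσ.2 z (hW hz)⟩

/-- The complement of `V` is not thin at `a`, at the scale `r`: away from the complement of `V`, the
function `z - a` has a continuous square root in the disc of centre `a` and radius `r`. -/
def NonThinAt (V : Set ℂ) (a : ℂ) (r : ℝ) : Prop :=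
  ∀ δ > 0, HasSqrtOn {z | z ∈ ball a r ∧ ∀ w ∉ V, δ ≤ dist z w} a

theorem NonThinAt.mono {V : Set ℂ} {a : ℂ} {r r' : ℝ} (h : NonThinAt V a r) (hr : r' ≤ r) :
    NonThinAt V a r' :=
  fun δ hδ => (h δ hδ).mono fun _ hz => ⟨ball_subset_ball hr hz.1, hz.2⟩

theorem NonThinAt.exists_sqrt_near_compact {V S : Set ℂ} {a : ℂ} {r : ℝ} (h : NonThinAt V a r)
    (hV : IsOpen V) (hS : IsCompact S) (hSV : S ⊆ V) (hSr : S ⊆ ball a r) :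
    ∃ σ : ℂ → ℂ, ∀ x ∈ S, ContinuousAt σ x ∧ ∀ᶠ z in 𝓝 x, σ z ^ 2 = z - a := by
  obtain ⟨δ, hδ, hδV⟩ := hS.exists_thickening_subset_open hV hSV
  obtain ⟨σ, hσc, hσ⟩ := h (δ / 2) (half_pos hδ)
  have hnhds : ∀ x ∈ S, {z | z ∈ ball a r ∧ ∀ w ∉ V, δ / 2 ≤ dist z w} ∈ 𝓝 x := by
    intro x hx
    filter_upwards [isOpen_ball.mem_nhds (hSr hx), ball_mem_nhds x (half_pos hδ)] with y hy hyx
    refine ⟨hy, fun w hw => ?_⟩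
    by_contra! hlt
    refine hw (hδV (mem_thickening_iff.2 ⟨x, hx, ?_⟩))
    rw [mem_ball] at hyx
    linarith [dist_triangle_left w x y]
  refine ⟨σ, fun x hx => ⟨hσc.continuousAt (hnhds x hx), ?_⟩⟩
  filter_upwards [hnhds x hx] with y hy using hσ y hy

section SheetLift

variable {a s : ℂ} {f : ℂ → ℝ} {ε M ρ : ℝ} {σ : ℂ → ℂ}

/-- The positive part of `f - ε`, lifted along `s ↦ a + s ^ 2` to the sheet selected by the branch
`σ` of the square root. -/
noncomputable def sheetLift (f : ℂ → ℝ) (a : ℂ) (ε : ℝ) (σ : ℂ → ℂ) (s : ℂ) : ℝ :=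
  open Classical in if ε ≤ f (a + s ^ 2) ∧ σ (a + s ^ 2) = s then f (a + s ^ 2) - ε else 0

theorem sheetLift_nonneg (s : ℂ) : 0 ≤ sheetLift f a ε σ s := by
  unfold sheetLift
  split_ifs with h
  · exact sub_nonneg.2 h.1
  · exact le_rfl

theorem sheetLift_sqrt {z : ℂ} (hσ : σ z ^ 2 = z - a) (hz : ε ≤ f z) :
    sheetLift f a ε σ (σ z) = f z - ε := by
  have hsq : a + σ z ^ 2 = z := by rw [hσ, add_sub_cancel]
  simp only [sheetLift, hsq, hz, and_self, if_true]

/-- The points `s` and `-s` lie on different sheets, so at most one of the two values is nonzero. -/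
theorem sheetLift_add_sheetLift_neg_le (hε : 0 < ε) (hM : 0 ≤ M) (ha : f a ≤ 0)
    (hf : f (a + s ^ 2) ≤ M) : sheetLift f a ε σ s + sheetLift f a ε σ (-s) ≤ M := by
  unfold sheetLift
  rw [neg_sq]
  split_ifs with h h' h'
  · obtain rfl : s = 0 := self_eq_neg.1 (h.2.symm.trans h'.2)
    have hεa := h.1
    rw [zero_pow two_ne_zero, add_zero] at hεa
    linarith
  all_goals linarith

theorem sheetLift_eventuallyEq_max (hs : s ≠ 0) (hσs : σ (a + s ^ 2) = s)
    (hσc : ContinuousAt σ (a + s ^ 2)) (hσ : ∀ᶠ z in 𝓝 (a + s ^ 2), σ z ^ 2 = z - a) :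
    sheetLift f a ε σ =ᶠ[𝓝 s] fun t => max (f (a + t ^ 2) - ε) 0 := by
  have hsq : Tendsto (fun t : ℂ => a + t ^ 2) (𝓝 s) (𝓝 (a + s ^ 2)) :=
    Continuous.tendsto (by fun_prop) s
  have hσt : Tendsto (fun t : ℂ => σ (a + t ^ 2)) (𝓝 s) (𝓝 s) :=
    (hσc.tendsto.comp hsq).trans_eq (congrArg 𝓝 hσs)
  have hne : ∀ᶠ t in 𝓝 s, σ (a + t ^ 2) + t ≠ 0 :=
    (hσt.add tendsto_id).eventually_ne (add_self_eq_zero.not.2 hs)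
  filter_upwards [hne, hsq.eventually hσ] with t ht hσt
  have hsheet : σ (a + t ^ 2) = t := by
    rw [add_sub_cancel_left, sq_eq_sq_iff_eq_or_eq_neg] at hσt
    exact hσt.resolve_right fun h => ht (by rw [h, neg_add_cancel])
  unfold sheetLift
  by_cases hle : ε ≤ f (a + t ^ 2)
  · rw [if_pos ⟨hle, hsheet⟩, max_eq_left (sub_nonneg.2 hle)]
  · rw [if_neg fun h => hle h.1, max_eq_right (by linarith)]

theorem sheetLift_eventuallyEq_zero_or_max (hε : 0 < ε) (ha : f a ≤ 0)
    (hf : ContinuousAt f (a + s ^ 2))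
    (hσ : ε ≤ f (a + s ^ 2) →
      ContinuousAt σ (a + s ^ 2) ∧ ∀ᶠ z in 𝓝 (a + s ^ 2), σ z ^ 2 = z - a) :
    sheetLift f a ε σ =ᶠ[𝓝 s] (fun _ => 0) ∨ s ≠ 0 ∧ ε ≤ f (a + s ^ 2) ∧
      sheetLift f a ε σ =ᶠ[𝓝 s] fun t => max (f (a + t ^ 2) - ε) 0 := by
  have hsq : Tendsto (fun t : ℂ => a + t ^ 2) (𝓝 s) (𝓝 (a + s ^ 2)) :=
    Continuous.tendsto (by fun_prop) s
  rcases lt_or_ge (f (a + s ^ 2)) ε with hlt | hle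
  · left
    filter_upwards [hsq.eventually (hf.eventually (gt_mem_nhds hlt))] with t ht
    exact if_neg fun h => h.1.not_gt ht
  obtain ⟨hσc, hσs⟩ := hσ hle
  by_cases hsheet : σ (a + s ^ 2) = s
  · have hs : s ≠ 0 := by
      rintro rfl
      rw [zero_pow two_ne_zero, add_zero] at hle
      linarith
    exact Or.inr ⟨hs, hle, sheetLift_eventuallyEq_max hs hsheet hσc hσs⟩
  · left
    have hne : ∀ᶠ t in 𝓝 s, σ (a + t ^ 2) - t ≠ 0 :=
      ((hσc.tendsto.comp hsq).sub tendsto_id).eventually_ne (sub_ne_zero.2 hsheet)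
    filter_upwards [hne] with t ht
    exact if_neg fun h => ht (sub_eq_zero.2 h.2)

theorem continuousAt_sheetLift (hε : 0 < ε) (ha : f a ≤ 0) (hf : ContinuousAt f (a + s ^ 2))
    (hσ : ε ≤ f (a + s ^ 2) →
      ContinuousAt σ (a + s ^ 2) ∧ ∀ᶠ z in 𝓝 (a + s ^ 2), σ z ^ 2 = z - a) :
    ContinuousAt (sheetLift f a ε σ) s := by
  rcases sheetLift_eventuallyEq_zero_or_max hε ha hf hσ with hzero | ⟨-, -, hmax⟩
  · exact (continuousAt_congr hzero).2 continuousAt_const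
  · have hcomp : ContinuousAt (fun t : ℂ => f (a + t ^ 2)) s :=
      ContinuousAt.comp (f := fun t : ℂ => a + t ^ 2) hf (by fun_prop)
    exact (continuousAt_congr hmax).2 ((hcomp.sub continuousAt_const).max continuousAt_const)

theorem subharmonicAt_sheetLift (hε : 0 < ε) (ha : f a ≤ 0) (hf : ContinuousAt f (a + s ^ 2))
    (hσ : ε ≤ f (a + s ^ 2) →
      ContinuousAt σ (a + s ^ 2) ∧ ∀ᶠ z in 𝓝 (a + s ^ 2), σ z ^ 2 = z - a)
    (hsub : ε ≤ f (a + s ^ 2) → SubharmonicAt f (a + s ^ 2)) :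
    SubharmonicAt (sheetLift f a ε σ) s := by
  have hzero : SubharmonicAt (fun _ => 0) s := subharmonicAt_of_harmonicAt (harmonicAt_const 0 s)
  rcases sheetLift_eventuallyEq_zero_or_max hε ha hf hσ with hv | ⟨hs, hle, hv⟩
  · exact hzero.congr hv.symm
  · exact ((((hsub hle).comp_add_sq hs).sub_const ε).max hzero).congr hv.symm

/-- On each circle the lift has average at most `M / 2`, by `sheetLift_add_sheetLift_neg_le`; the
Harnack inequality then improves the bound `M` in the concentric disc of a quarter of the radius. -/
theorem sheetLift_le_three_quarters (hρ : 0 < ρ) (hε : 0 < ε) (hM : 0 ≤ M) (ha : f a ≤ 0)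
    (hf : ∀ x ∈ closedBall a (ρ ^ 2), ContinuousAt f x)
    (hfM : ∀ x ∈ closedBall a (ρ ^ 2), f x ≤ M)
    (hσ : ∀ x ∈ closedBall a (ρ ^ 2), ε ≤ f x →
      ContinuousAt σ x ∧ ∀ᶠ z in 𝓝 x, σ z ^ 2 = z - a)
    (hsub : ∀ x ∈ closedBall a (ρ ^ 2), ε ≤ f x → SubharmonicAt f x) (hs : ‖s‖ ≤ ρ / 4) :
    sheetLift f a ε σ s ≤ 3 / 4 * M := by
  set v := sheetLift f a ε σ
  have hmem : ∀ t ∈ closedBall (0 : ℂ) ρ, a + t ^ 2 ∈ closedBall a (ρ ^ 2) := fun t ht => by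
    rw [mem_closedBall_zero_iff] at ht
    rw [mem_closedBall_iff_norm, add_sub_cancel_left, norm_pow]
    gcongr
  have hvc : ContinuousOn v (closedBall 0 ρ) := fun t ht =>
    (continuousAt_sheetLift hε ha (hf _ (hmem t ht)) (hσ _ (hmem t ht))).continuousWithinAt
  have hvs : ∀ t ∈ ball (0 : ℂ) ρ, SubharmonicAt v t := fun t ht =>
    have ht' := hmem t (ball_subset_closedBall ht)
    subharmonicAt_sheetLift hε ha (hf _ ht') (hσ _ ht') (hsub _ ht')
  have hsum : ∀ t ∈ sphere (0 : ℂ) ρ, v t + v (-t) ≤ M := fun t ht =>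
    sheetLift_add_sheetLift_neg_le hε hM ha (hfM _ (hmem t (sphere_subset_closedBall ht)))
  have hvM : ∀ t ∈ sphere (0 : ℂ) ρ, v t ≤ M := fun t ht =>
    (le_add_of_nonneg_right (sheetLift_nonneg (-t))).trans (hsum t ht)
  have hvc' := hvc.mono sphere_subset_closedBall
  calc v s ≤ poissonModification 0 ρ v s := le_poissonModification hρ hvc hvs s
    _ = poissonIntegral 0 ρ v s :=
      poissonModification_of_mem (mem_ball_zero_iff.2 (by linarith))
    _ ≤ 3 / 4 * M := poissonIntegral_le_of_circleAverage_le hρ hM (hvc'.circleIntegrable hρ.le)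
      hvM (circleAverage_le_half_of_add_neg_le hρ.le hvc' hsum) (by rwa [sub_zero])

end SheetLift

section NonThin

variable {V : Set ℂ} {a : ℂ} {r M : ℝ} {f : ℂ → ℝ}

theorem NonThinAt.le_three_quarters (hn : NonThinAt V a r) (hV : IsOpen V) (ha : a ∉ V)
    (hf : ContinuousOn f (ball a r)) (hs : ∀ z ∈ V ∩ ball a r, SubharmonicAt f z)
    (h0 : ∀ z ∈ ball a r, z ∉ V → f z ≤ 0) (hfM : ∀ z ∈ ball a r, f z ≤ M) (hM : 0 ≤ M) :
    ∀ z ∈ ball a (r / 16), f z ≤ 3 / 4 * M := by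
  intro z hz
  refine le_of_forall_pos_le_add fun ε hε => ?_
  rcases lt_or_ge (f z) ε with hfz | hfz
  · linarith
  rw [mem_ball_iff_norm] at hz
  have hz0 := norm_nonneg (z - a)
  have hfa : f a ≤ 0 := h0 a (mem_ball_self (by linarith)) ha
  obtain ⟨ρ, hρ, hzρ, hρr⟩ : ∃ ρ : ℝ, 0 < ρ ∧ 16 * ‖z - a‖ ≤ ρ ^ 2 ∧ ρ ^ 2 < r := by
    refine ⟨Real.sqrt ((16 * ‖z - a‖ + r) / 2), Real.sqrt_pos.2 (by linarith), ?_⟩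
    rw [Real.sq_sqrt (by linarith)]
    constructor <;> linarith
  have hcb : closedBall a (ρ ^ 2) ⊆ ball a r := closedBall_subset_ball hρr
  set S := closedBall a (ρ ^ 2) ∩ f ⁻¹' Ici ε
  have hSV : S ⊆ V := fun x hx => by
    by_contra hxV
    exact (h0 x (hcb hx.1) hxV).not_gt (hε.trans_le hx.2)
  have hS : IsCompact S := (isCompact_closedBall a (ρ ^ 2)).of_isClosed_subset
    ((hf.mono hcb).preimage_isClosed_of_isClosed isClosed_closedBall isClosed_Ici)
    inter_subset_left
  obtain ⟨σ, hσ⟩ := hn.exists_sqrt_near_compact hV hS hSV (inter_subset_left.trans hcb)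
  have hσz : σ z ^ 2 = z - a :=
    (hσ z ⟨mem_closedBall_iff_norm.2 (by linarith), hfz⟩).2.self_of_nhds
  have hσz4 : ‖σ z‖ ≤ ρ / 4 := by
    refine le_of_sq_le_sq ?_ (by positivity)
    rw [← norm_pow, hσz, div_pow]
    linarith
  have hle := sheetLift_le_three_quarters hρ hε hM hfa
    (fun x hx => hf.continuousAt (isOpen_ball.mem_nhds (hcb hx))) (fun x hx => hfM x (hcb hx))
    (fun x hx hεx => hσ x ⟨hx, hεx⟩) (fun x hx hεx => hs x ⟨hSV ⟨hx, hεx⟩, hcb hx⟩) hσz4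
  rw [sheetLift_sqrt hσz hfz] at hle
  linarith

theorem NonThinAt.le_three_quarters_pow (hn : NonThinAt V a r) (hV : IsOpen V) (ha : a ∉ V)
    (hf : ContinuousOn f (ball a r)) (hs : ∀ z ∈ V ∩ ball a r, SubharmonicAt f z)
    (h0 : ∀ z ∈ ball a r, z ∉ V → f z ≤ 0) (hfM : ∀ z ∈ ball a r, f z ≤ M) (hM : 0 ≤ M) (j : ℕ) :
    ∀ z ∈ ball a (r / 16 ^ j), f z ≤ (3 / 4) ^ j * M := by
  rcases le_or_gt r 0 with hr | hr
  · intro z hz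
    rw [ball_eq_empty.2 (div_nonpos_of_nonpos_of_nonneg hr (by positivity))] at hz
    exact hz.elim
  induction j with
  | zero => simpa using hfM
  | succ j ih =>
    have hle : r / 16 ^ j ≤ r := div_le_self hr.le (one_le_pow₀ (by norm_num))
    have hsub := ball_subset_ball (x := a) hle
    rw [pow_succ, ← div_div, pow_succ', mul_assoc]
    exact (hn.mono hle).le_three_quarters hV ha (hf.mono hsub)
      (fun z hz => hs z ⟨hz.1, hsub hz.2⟩) (fun z hz => h0 z (hsub hz)) ih (by positivity)

theorem NonThinAt.abs_le_add_three_quarters_pow {η : ℝ} (hn : NonThinAt V a r) (hV : IsOpen V)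
    (ha : a ∉ V) (hf : ContinuousOn f (ball a r)) (hh : ∀ z ∈ V ∩ ball a r, HarmonicAt f z)
    (h0 : ∀ z ∈ ball a r, z ∉ V → |f z| ≤ η) (hfM : ∀ z ∈ ball a r, |f z| ≤ η + M) (hM : 0 ≤ M)
    (j : ℕ) : ∀ z ∈ ball a (r / 16 ^ j), |f z| ≤ η + (3 / 4) ^ j * M := by
  have one_sided : ∀ g : ℂ → ℝ, ContinuousOn g (ball a r) →
      (∀ z ∈ V ∩ ball a r, HarmonicAt g z) → (∀ z, g z ≤ |f z|) →
      ∀ z ∈ ball a (r / 16 ^ j), g z ≤ η + (3 / 4) ^ j * M := by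
    intro g hg hgh hgf z hz
    refine sub_le_iff_le_add'.1 (hn.le_three_quarters_pow hV ha (hg.sub continuousOn_const)
      (fun x hx => (subharmonicAt_of_harmonicAt (hgh x hx)).sub_const η)
      (fun x hx hxV => sub_nonpos.2 ((hgf x).trans (h0 x hx hxV)))
      (fun x hx => sub_le_iff_le_add'.2 ((hgf x).trans (hfM x hx))) hM j z hz)
  exact fun z hz => abs_le'.2 ⟨one_sided f hf hh (fun x => le_abs_self _) z hz,
    one_sided (-f) hf.neg (fun x hx => (hh x hx).neg) (fun x => neg_le_abs _) z hz⟩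

end NonThin

/-! ## Sweeping out -/

/-- The sweeping-out process: successive Poisson modifications of `s` along a sequence of discs, in
which each disc `B i` recurs infinitely often. -/
noncomputable def balayage (s : ℂ → ℝ) (B : ℕ → ℂ × ℝ) : ℕ → ℂ → ℝ
  | 0 => s
  | j + 1 => poissonModification (B j.unpair.1).1 (B j.unpair.1).2 (balayage s B j)

/-- The function obtained from `s` by sweeping out all the discs `B i`; it is the supremum of an
increasing sequence. -/
noncomputable def balayageLimit (s : ℂ → ℝ) (B : ℕ → ℂ × ℝ) (z : ℂ) : ℝ :=
  ⨆ j, balayage s B j z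

section Balayage

variable {s : ℂ → ℝ} {B : ℕ → ℂ × ℝ} {V : Set ℂ} {M : ℝ} {z a : ℂ}

theorem continuous_balayage (hs : Continuous s) (hB : ∀ i, 0 < (B i).2) (j : ℕ) :
    Continuous (balayage s B j) := by
  induction j with
  | zero => exact hs
  | succ j ih =>
    rw [← continuousOn_univ] at ih ⊢
    exact continuousOn_poissonModification (hB _) (subset_univ _) ih

theorem subharmonicAt_balayage (hs : Continuous s) (hsub : ∀ z, SubharmonicAt s z)
    (hB : ∀ i, 0 < (B i).2) (j : ℕ) (z : ℂ) : SubharmonicAt (balayage s B j) z := by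
  induction j generalizing z with
  | zero => exact hsub z
  | succ j ih =>
    exact subharmonicAt_poissonModification (hB _) (continuous_balayage hs hB j).continuousOn
      (fun z _ => ih z) (ih z)

theorem monotone_balayage (hs : Continuous s) (hsub : ∀ z, SubharmonicAt s z)
    (hB : ∀ i, 0 < (B i).2) (z : ℂ) : Monotone fun j => balayage s B j z :=
  monotone_nat_of_le_succ fun j =>
    le_poissonModification (hB _) (continuous_balayage hs hB j).continuousOn
      (fun z _ => subharmonicAt_balayage hs hsub hB j z) z

theorem balayage_of_notMem (hBV : ∀ i, closedBall (B i).1 (B i).2 ⊆ V) (hz : z ∉ V) (j : ℕ) :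
    balayage s B j z = s z := by
  induction j with
  | zero => rfl
  | succ j ih =>
    rw [balayage, poissonModification_of_notMem fun h => hz (hBV _ (ball_subset_closedBall h)), ih]

theorem balayage_le (hs : Continuous s) (hB : ∀ i, 0 < (B i).2)
    (hBV : ∀ i, closedBall (B i).1 (B i).2 ⊆ V) (hM : ∀ z ∈ V, s z ≤ M) (hz : z ∈ V) (j : ℕ) :
    balayage s B j z ≤ M := by
  induction j generalizing z with
  | zero => exact hM z hz
  | succ j ih =>
    by_cases h : z ∈ closedBall (B j.unpair.1).1 (B j.unpair.1).2
    · exact poissonModification_le (hB _) (continuous_balayage hs hB j).continuousOn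
        (fun z hz => ih (hBV _ hz)) h
    · rw [balayage, poissonModification_of_notMem fun h' => h (ball_subset_closedBall h')]
      exact ih hz

theorem tendsto_balayage (hs : Continuous s) (hsub : ∀ z, SubharmonicAt s z)
    (hB : ∀ i, 0 < (B i).2) (hBV : ∀ i, closedBall (B i).1 (B i).2 ⊆ V)
    (hM : ∀ z ∈ V, s z ≤ M) (z : ℂ) :
    Tendsto (fun j => balayage s B j z) atTop (𝓝 (balayageLimit s B z)) := by
  refine tendsto_atTop_ciSup (monotone_balayage hs hsub hB z) ?_
  by_cases hz : z ∈ V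
  · exact ⟨M, forall_mem_range.2 fun j => balayage_le hs hB hBV hM hz j⟩
  · exact ⟨s z, forall_mem_range.2 fun j => (balayage_of_notMem hBV hz j).le⟩

theorem balayageLimit_of_notMem (hBV : ∀ i, closedBall (B i).1 (B i).2 ⊆ V) (hz : z ∉ V) :
    balayageLimit s B z = s z := by
  simp only [balayageLimit, balayage_of_notMem hBV hz, ciSup_const]

theorem harmonicAt_balayageLimit (hs : Continuous s) (hsub : ∀ z, SubharmonicAt s z)
    (hB : ∀ i, 0 < (B i).2) (hBV : ∀ i, closedBall (B i).1 (B i).2 ⊆ V)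
    (hM : ∀ z ∈ V, |s z| ≤ M) {i : ℕ} (hz : z ∈ ball (B i).1 (B i).2) :
    HarmonicAt (balayageLimit s B) z := by
  have hsM : ∀ z ∈ V, s z ≤ M := fun z hz => (abs_le.1 (hM z hz)).2
  have hlim := tendsto_balayage hs hsub hB hBV hsM
  have hpair : Tendsto (fun n => Nat.pair i n) atTop atTop :=
    tendsto_atTop_mono (fun n => Nat.right_le_pair i n) tendsto_id
  have hmeas : ∀ n, Measurable (balayage s B (Nat.pair i n)) := fun n =>
    (continuous_balayage hs hB _).measurable
  have habs : ∀ n, ∀ w ∈ sphere (B i).1 (B i).2, |balayage s B (Nat.pair i n) w| ≤ M := by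
    intro n w hw
    have hwV : w ∈ V := hBV i (sphere_subset_closedBall hw)
    exact abs_le.2 ⟨(abs_le.1 (hM w hwV)).1.trans (monotone_balayage hs hsub hB w (Nat.zero_le _)),
      balayage_le hs hB hBV hsM hwV _⟩
  have hpoisson : ∀ w ∈ ball (B i).1 (B i).2,
      balayageLimit s B w = poissonIntegral (B i).1 (B i).2 (balayageLimit s B) w := by
    intro w hw
    refine tendsto_nhds_unique ((hlim w).comp ((tendsto_add_atTop_nat 1).comp hpair))
      ((tendsto_poissonIntegral_of_tendsto_of_abs_le hw hmeas habs
        fun y => (hlim y).comp hpair).congr fun n => ?_)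
    rw [Function.comp_apply, Function.comp_apply, balayage, Nat.unpair_pair,
      poissonModification_of_mem hw]
  refine (harmonicAt_congr_nhds ?_).2 (harmonicAt_poissonIntegral
    (circleIntegrable_of_tendsto_of_abs_le (hB i).le hmeas habs fun y => (hlim y).comp hpair) hz)
  filter_upwards [isOpen_ball.mem_nhds hz] with w hw using hpoisson w hw

theorem NonThinAt.eventually_forall_le_add {ι : Type*} {f : ι → ℂ → ℝ} {r ε : ℝ}
    (hn : NonThinAt V a r) (hr : 0 < r) (hV : IsOpen V) (ha : a ∉ V) (hs : ContinuousAt s a)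
    (hf : ∀ i, Continuous (f i)) (hsub : ∀ i, ∀ z ∈ V, SubharmonicAt (f i) z)
    (hfs : ∀ i, ∀ z ∉ V, f i z ≤ s z) (hM : ∀ i, ∀ z ∈ V, f i z ≤ M) (hε : 0 < ε) :
    ∀ᶠ z in 𝓝 a, ∀ i, f i z ≤ s a + ε := by
  obtain ⟨δ, hδ, hsδ⟩ := Metric.eventually_nhds_iff_ball.1
    (hs.eventually (gt_mem_nhds (show s a < s a + ε / 2 by linarith)))
  set N := max (M - (s a + ε / 2)) 0
  obtain ⟨k, hk⟩ : ∃ k : ℕ, (3 / 4 : ℝ) ^ k * N < ε / 2 := by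
    have hpow := (tendsto_pow_atTop_nhds_zero_of_lt_one (r := (3 / 4 : ℝ)) (by norm_num)
      (by norm_num)).mul_const N
    rw [zero_mul] at hpow
    exact (hpow.eventually_lt_const (half_pos hε)).exists
  have hd : 0 < min δ r / 16 ^ k := by positivity
  filter_upwards [ball_mem_nhds a hd] with z hz i
  have hboundary : ∀ w ∈ ball a (min δ r), w ∉ V → f i w - (s a + ε / 2) ≤ 0 := fun w hw hwV => by
    linarith [hfs i w hwV, hsδ w (ball_subset_ball (min_le_left _ _) hw)]
  have hN : ∀ w ∈ ball a (min δ r), f i w - (s a + ε / 2) ≤ N := fun w hw => by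
    by_cases hwV : w ∈ V
    · exact le_max_of_le_left (by linarith [hM i w hwV])
    · exact le_max_of_le_right (hboundary w hw hwV)
  have hdecay := (hn.mono (min_le_right δ r)).le_three_quarters_pow hV ha
    ((hf i).sub continuous_const).continuousOn (fun w hw => (hsub i w hw.1).sub_const _)
    hboundary hN (le_max_right _ _) k z hz
  rw [Pi.sub_apply] at hdecay
  linarith

theorem continuousAt_balayageLimit_of_nonThinAt {r : ℝ} (hs : Continuous s)
    (hsub : ∀ z, SubharmonicAt s z) (hB : ∀ i, 0 < (B i).2)
    (hBV : ∀ i, closedBall (B i).1 (B i).2 ⊆ V) (hM : ∀ z ∈ V, s z ≤ M) (hV : IsOpen V)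
    (ha : a ∉ V) (hr : 0 < r) (hn : NonThinAt V a r) :
    ContinuousAt (balayageLimit s B) a := by
  rw [ContinuousAt, balayageLimit_of_notMem hBV ha]
  refine tendsto_order.2 ⟨fun b hb => ?_, fun b hb => ?_⟩
  · filter_upwards [hs.continuousAt.eventually (lt_mem_nhds hb)] with z hz
    exact hz.trans_le (ge_of_tendsto' (tendsto_balayage hs hsub hB hBV hM z) fun j =>
      monotone_balayage hs hsub hB z (Nat.zero_le j))
  · have hupper := hn.eventually_forall_le_add (f := balayage s B) (ε := (b - s a) / 2) hr hV ha
      hs.continuousAt (continuous_balayage hs hB)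
      (fun j z _ => subharmonicAt_balayage hs hsub hB j z)
      (fun j z hz => (balayage_of_notMem hBV hz j).le)
      (fun j z hz => balayage_le hs hB hBV hM hz j) (by linarith)
    filter_upwards [hupper] with z hz
    exact (ciSup_le hz).trans_lt (by linarith)

end Balayage

theorem exists_seq_closedBall_subset_and_mem_ball {X : Type*} [PseudoMetricSpace X]
    [HereditarilyLindelofSpace X] {V : Set X} (hV : IsOpen V) (hne : V.Nonempty) :
    ∃ B : ℕ → X × ℝ, (∀ i, 0 < (B i).2) ∧ (∀ i, closedBall (B i).1 (B i).2 ⊆ V) ∧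
      ∀ z ∈ V, ∃ i, z ∈ ball (B i).1 (B i).2 := by
  have hball : ∀ z : V, ∃ r : ℝ, 0 < r ∧ closedBall (z : X) r ⊆ V := fun z =>
    nhds_basis_closedBall.mem_iff.1 (hV.mem_nhds z.2)
  choose r hr hrV using hball
  obtain ⟨t, htc, ht⟩ := eq_open_union_countable (fun z : V => ball (z : X) (r z))
    fun z => isOpen_ball
  have hcover : ∀ z ∈ V, ∃ x ∈ t, z ∈ ball (x : X) (r x) := fun z hz => by
    have hmem : z ∈ ⋃ x : V, ball (x : X) (r x) := mem_iUnion.2 ⟨⟨z, hz⟩, mem_ball_self (hr _)⟩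
    rw [← ht] at hmem
    simpa only [mem_iUnion, exists_prop] using hmem
  obtain ⟨e, rfl⟩ := htc.exists_eq_range (hne.elim fun z hz => (hcover z hz).imp fun _ h => h.1)
  refine ⟨fun n => (e n, r (e n)), fun n => hr _, fun n => hrV _, fun z hz => ?_⟩
  obtain ⟨-, ⟨n, rfl⟩, hzn⟩ := hcover z hz
  exact ⟨n, hzn⟩

theorem exists_harmonic_eq_off_of_subharmonicAt {V : Set ℂ} (hV : IsOpen V)
    (hVb : Bornology.IsBounded V) (hn : ∀ a ∈ frontier V, ∃ r > 0, NonThinAt V a r) {s : ℂ → ℝ}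
    (hs : Continuous s) (hsub : ∀ z, SubharmonicAt s z) :
    ∃ u : ℂ → ℝ, Continuous u ∧ (∀ z ∈ V, HarmonicAt u z) ∧ ∀ z ∉ V, u z = s z := by
  rcases V.eq_empty_or_nonempty with rfl | hne
  · exact ⟨s, hs, fun z hz => hz.elim, fun z _ => rfl⟩
  obtain ⟨B, hB, hBV, hcover⟩ := exists_seq_closedBall_subset_and_mem_ball hV hne
  obtain ⟨M, hM⟩ := hVb.isCompact_closure.exists_bound_of_continuousOn hs.continuousOn
  replace hM : ∀ z ∈ V, |s z| ≤ M := fun z hz => hM z (subset_closure hz)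
  have hharm : ∀ z ∈ V, HarmonicAt (balayageLimit s B) z := fun z hz =>
    (hcover z hz).elim fun _ hi => harmonicAt_balayageLimit hs hsub hB hBV hM hi
  have hoff : ∀ z ∉ V, balayageLimit s B z = s z := fun z hz => balayageLimit_of_notMem hBV hz
  refine ⟨balayageLimit s B, continuous_iff_continuousAt.2 fun a => ?_, hharm, hoff⟩
  by_cases haV : a ∈ V
  · exact (hharm a haV).1.continuousAt
  by_cases hacl : a ∈ closure V
  · obtain ⟨r, hr, hnr⟩ := hn a (by rw [hV.frontier_eq]; exact ⟨hacl, haV⟩)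
    exact continuousAt_balayageLimit_of_nonThinAt hs hsub hB hBV
      (fun z hz => (abs_le.1 (hM z hz)).2) hV haV hr hnr
  · refine (continuousAt_congr ?_).2 hs.continuousAt
    filter_upwards [isClosed_closure.isOpen_compl.mem_nhds hacl] with z hz
    exact hoff z fun h => hz (subset_closure h)

/-! ## The Dirichlet problem -/

theorem abs_sub_le_of_abs_sub_le_on_frontier {V : Set ℂ} (hV : IsOpen V)
    (hVb : Bornology.IsBounded V) {u v : ℂ → ℝ} {ε : ℝ} (hu : HarmonicContOnCl u V)
    (hv : HarmonicContOnCl v V) (hle : ∀ z ∈ frontier V, |u z - v z| ≤ ε) :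
    ∀ z ∈ closure V, |u z - v z| ≤ ε := by
  have hcomparison : ∀ {f g : ℂ → ℝ}, HarmonicContOnCl f V → HarmonicContOnCl g V →
      (∀ z ∈ frontier V, f z ≤ g z + ε) → ∀ z ∈ closure V, f z ≤ g z + ε := fun hf hg h z hz =>
    le_of_subharmonicAt_of_harmonicContOnCl hV hVb hf.continuousOn
      (fun w hw => subharmonicAt_of_harmonicAt (hf.harmonicOnNhd w hw)) (hg.add_const ε) h z hz
  intro z hz
  rw [abs_sub_le_iff]
  constructor
  · linarith [hcomparison hu hv (fun w hw => by linarith [(abs_sub_le_iff.1 (hle w hw)).1]) z hz]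
  · linarith [hcomparison hv hu (fun w hw => by linarith [(abs_sub_le_iff.1 (hle w hw)).2]) z hz]

theorem eqOn_closure_of_eqOn_frontier {V : Set ℂ} (hV : IsOpen V) (hVb : Bornology.IsBounded V)
    {u v : ℂ → ℝ} (hu : HarmonicContOnCl u V) (hv : HarmonicContOnCl v V)
    (huv : EqOn u v (frontier V)) : EqOn u v (closure V) := fun z hz =>
  sub_eq_zero.1 <| abs_nonpos_iff.1 <| abs_sub_le_of_abs_sub_le_on_frontier hV hVb hu hv
    (fun w hw => by rw [huv hw, sub_self, abs_zero]) z hz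

theorem harmonicAt_of_tendstoUniformlyOn {V : Set ℂ} (hV : IsOpen V) {f : ℕ → ℂ → ℝ} {u : ℂ → ℝ}
    (hf : ∀ n, ∀ z ∈ V, HarmonicAt (f n) z) (hfu : TendstoUniformlyOn f u atTop V) {z : ℂ}
    (hz : z ∈ V) : HarmonicAt u z := by
  obtain ⟨r, hr, hrV⟩ := nhds_basis_closedBall.mem_iff.1 (hV.mem_nhds hz)
  have hsphere : sphere z r ⊆ V := sphere_subset_closedBall.trans hrV
  have hfc : ∀ n, ContinuousOn (f n) V := fun n w hw =>
    (hf n w hw).1.continuousAt.continuousWithinAt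
  have huc : ContinuousOn u V := hfu.continuousOn (Frequently.of_forall hfc)
  have hui : CircleIntegrable u z r := (huc.mono hsphere).circleIntegrable hr.le
  have hfi : ∀ n, CircleIntegrable (f n) z r := fun n =>
    ((hfc n).mono hsphere).circleIntegrable hr.le
  have hmean : ∀ n, ∀ w ∈ ball z r, poissonIntegral z r (f n) w = f n w := fun n w hw =>
    poissonIntegral_of_harmonicContOnCl
      ⟨fun y hy => hf n y (hrV (ball_subset_closedBall hy)),
        (hfc n).mono (closure_ball_subset_closedBall.trans hrV)⟩ hw
  have hlim : ∀ w ∈ ball z r, Tendsto (fun n => f n w) atTop (𝓝 (poissonIntegral z r u w)) := by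
    intro w hw
    rw [Metric.tendsto_nhds]
    intro ε hε
    filter_upwards [Metric.tendstoUniformlyOn_iff.1 hfu (ε / 2) (half_pos hε)] with n hn
    have hle := abs_poissonIntegral_sub_le (G := fun _ => ε / 2) (a := 0) hw ((hfi n).sub hui)
      harmonicContOnCl_const fun ζ hζ => by
        rw [sub_zero, Pi.sub_apply, ← Real.dist_eq, dist_comm]
        exact (hn ζ (hsphere hζ)).le
    rw [sub_zero, show f n - u = fun y => f n y - u y from rfl,
      poissonIntegral_sub hw (hfi n) hui, hmean n w hw] at hle
    rw [Real.dist_eq]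
    linarith
  refine (harmonicAt_congr_nhds ?_).2 (harmonicAt_poissonIntegral hui (mem_ball_self hr))
  filter_upwards [ball_mem_nhds z hr] with w hw
  exact tendsto_nhds_unique (hfu.tendsto_at (hrV (ball_subset_closedBall hw))) (hlim w hw)

theorem exists_harmonicContOnCl_of_tendstoUniformlyOn_frontier {V : Set ℂ} (hV : IsOpen V)
    (hVb : Bornology.IsBounded V) {f : ℕ → ℂ → ℝ} {φ : ℂ → ℝ} (hf : ∀ n, HarmonicContOnCl (f n) V)
    (hfφ : TendstoUniformlyOn f φ atTop (frontier V)) :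
    ∃ u, HarmonicContOnCl u V ∧ EqOn u φ (frontier V) := by
  have hcauchy : UniformCauchySeqOn f atTop (closure V) := by
    rw [Metric.uniformCauchySeqOn_iff]
    intro ε hε
    obtain ⟨N, hN⟩ := Metric.uniformCauchySeqOn_iff.1 hfφ.uniformCauchySeqOn (ε / 2) (half_pos hε)
    refine ⟨N, fun m hm n hn z hz => ?_⟩
    have hle := abs_sub_le_of_abs_sub_le_on_frontier hV hVb (hf m) (hf n)
      (fun w hw => (hN m hm n hn w hw).le) z hz
    rw [Real.dist_eq]
    linarith
  have hlim : ∀ z ∈ closure V, Tendsto (fun n => f n z) atTop (𝓝 (limUnder atTop fun n => f n z)) :=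
    fun z hz => (hcauchy.cauchySeq hz).tendsto_limUnder
  have hunif := hcauchy.tendstoUniformlyOn_of_tendsto hlim
  refine ⟨fun z => limUnder atTop fun n => f n z, ⟨fun z hz => ?_, ?_⟩, fun z hz => ?_⟩
  · exact harmonicAt_of_tendstoUniformlyOn hV (fun n => (hf n).harmonicOnNhd)
      (hunif.mono subset_closure) hz
  · exact hunif.continuousOn (Frequently.of_forall fun n => (hf n).continuousOn)
  · exact tendsto_nhds_unique (hlim z (frontier_subset_closure hz)) (hfφ.tendsto_at hz)

section AffineSup

/-- The function `z ↦ sup_{y ∈ K} (φ y - t ‖z - y‖²) + t ‖z‖²`: a supremum of affine functions, as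
the two quadratic terms in `z` cancel. -/
noncomputable def affineSup (K : Set ℂ) (φ : ℂ → ℝ) (t : ℝ) (z : ℂ) : ℝ :=
  sSup ((fun y => φ y - t * ‖z - y‖ ^ 2) '' K) + t * ‖z‖ ^ 2

theorem norm_sub_sq_sub_norm_sq_sub (y z w : ℂ) :
    ‖w - y‖ ^ 2 - ‖w‖ ^ 2 - (‖z - y‖ ^ 2 - ‖z‖ ^ 2) = -(2 * starRingEnd ℂ y * (w - z)).re := by
  simp only [← Complex.normSq_eq_norm_sq, Complex.normSq_apply, Complex.mul_re, Complex.mul_im,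
    Complex.sub_re, Complex.sub_im, Complex.conj_re, Complex.conj_im, Complex.re_ofNat,
    Complex.im_ofNat]
  ring

theorem subharmonicAt_mul_norm_sq {t : ℝ} (ht : 0 ≤ t) (z : ℂ) :
    SubharmonicAt (fun w : ℂ => t * ‖w‖ ^ 2) z := by
  refine .of_supporting_affine (p := t * (2 * starRingEnd ℂ z)) (Eventually.of_forall fun w => ?_)
  have hparallelogram := norm_sub_sq_sub_norm_sq_sub z z w
  rw [sub_self, norm_zero] at hparallelogram
  rw [mul_assoc, Complex.re_ofReal_mul, ← mul_add]
  gcongr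
  linarith [sq_nonneg ‖w - z‖]

variable {K : Set ℂ} {φ : ℂ → ℝ} {t : ℝ}

theorem continuousOn_sub_mul_norm_sub_sq (hφ : ContinuousOn φ K) (z : ℂ) :
    ContinuousOn (fun y => φ y - t * ‖z - y‖ ^ 2) K :=
  hφ.sub (by fun_prop : Continuous fun y : ℂ => t * ‖z - y‖ ^ 2).continuousOn

theorem le_affineSup (hK : IsCompact K) (hφ : ContinuousOn φ K) {y : ℂ} (hy : y ∈ K) (z : ℂ) :
    φ y - t * ‖z - y‖ ^ 2 + t * ‖z‖ ^ 2 ≤ affineSup K φ t z :=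
  add_le_add_left (le_csSup (hK.bddAbove_image (continuousOn_sub_mul_norm_sub_sq hφ z))
    (mem_image_of_mem _ hy)) _

theorem exists_affineSup_eq (hK : IsCompact K) (hne : K.Nonempty) (hφ : ContinuousOn φ K) (z : ℂ) :
    ∃ y ∈ K, affineSup K φ t z = φ y - t * ‖z - y‖ ^ 2 + t * ‖z‖ ^ 2 := by
  obtain ⟨y, hy, hmax⟩ := hK.exists_sSup_image_eq hne (continuousOn_sub_mul_norm_sub_sq hφ z)
  exact ⟨y, hy, congrArg (· + t * ‖z‖ ^ 2) hmax⟩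

theorem exists_affineSup_add_le (hK : IsCompact K) (hne : K.Nonempty) (hφ : ContinuousOn φ K)
    (z : ℂ) : ∃ y ∈ K, ∀ w,
      affineSup K φ t z + (t * (2 * starRingEnd ℂ y) * (w - z)).re ≤ affineSup K φ t w := by
  obtain ⟨y, hy, hyz⟩ := exists_affineSup_eq (t := t) hK hne hφ z
  refine ⟨y, hy, fun w => le_trans (le_of_eq ?_) (le_affineSup hK hφ hy w)⟩
  rw [hyz, mul_assoc, Complex.re_ofReal_mul]
  linear_combination t * norm_sub_sq_sub_norm_sq_sub y z w

theorem subharmonicAt_affineSup (hK : IsCompact K) (hne : K.Nonempty) (hφ : ContinuousOn φ K)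
    (z : ℂ) : SubharmonicAt (affineSup K φ t) z :=
  (exists_affineSup_add_le hK hne hφ z).elim fun _ hy =>
    .of_supporting_affine (Eventually.of_forall hy.2)

theorem continuous_affineSup (hK : IsCompact K) (hne : K.Nonempty) (hφ : ContinuousOn φ K) :
    Continuous (affineSup K φ t) := by
  obtain ⟨ρ, hρ⟩ := hK.isBounded.subset_closedBall 0
  have hρ0 : 0 ≤ ρ := nonempty_closedBall.1 (hne.mono hρ)
  refine (LipschitzWith.of_le_add_mul (|t| * (2 * ρ)).toNNReal fun z w => ?_).continuous
  obtain ⟨y, hy, hyz⟩ := exists_affineSup_add_le (t := t) hK hne hφ z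
  have hslope : -(t * (2 * starRingEnd ℂ y) * (w - z)).re ≤ |t| * (2 * ρ) * dist z w := by
    rw [← Complex.neg_re, dist_comm, dist_eq_norm]
    refine (Complex.re_le_norm _).trans ?_
    simp only [norm_neg, norm_mul, Complex.norm_real, Real.norm_eq_abs, Complex.norm_ofNat,
      RCLike.norm_conj]
    gcongr
    exact mem_closedBall_zero_iff.1 (hρ hy)
  rw [Real.coe_toNNReal _ (by positivity)]
  linarith [hyz w]

theorem tendstoUniformlyOn_affineSup_sub (hK : IsCompact K) (hne : K.Nonempty)
    (hφ : ContinuousOn φ K) :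
    TendstoUniformlyOn (fun (n : ℕ) z => affineSup K φ n z - n * ‖z‖ ^ 2) φ atTop K := by
  rw [Metric.tendstoUniformlyOn_iff]
  intro ε hε
  obtain ⟨C, -, hC⟩ := exists_forall_abs_sub_le_add_mul_dist_sq hK hφ (half_pos hε)
  filter_upwards [eventually_ge_atTop ⌈C⌉₊] with n hn z hz
  obtain ⟨y, hy, hyz⟩ := exists_affineSup_eq (t := n) hK hne hφ z
  have hlower := le_affineSup (t := n) hK hφ hz z
  rw [sub_self, norm_zero] at hlower
  have hosc := (abs_le.1 (hC y hy z hz)).2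
  rw [dist_comm, dist_eq_norm] at hosc
  have hCn : C * ‖z - y‖ ^ 2 ≤ n * ‖z - y‖ ^ 2 := by
    gcongr
    exact Nat.ceil_le.1 hn
  rw [dist_comm, Real.dist_eq, abs_lt]
  constructor <;> linarith

end AffineSup

theorem exists_harmonicContOnCl_eqOn_frontier {V : Set ℂ} (hV : IsOpen V)
    (hVb : Bornology.IsBounded V) (hn : ∀ a ∈ frontier V, ∃ r > 0, NonThinAt V a r) {φ : ℂ → ℝ}
    (hφ : ContinuousOn φ (frontier V)) :
    ∃ u : ℂ → ℝ, HarmonicContOnCl u V ∧ EqOn u φ (frontier V) := by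
  rcases (frontier V).eq_empty_or_nonempty with hempty | hne
  · exact ⟨fun _ => 0, harmonicContOnCl_const, by simp only [hempty, eqOn_empty]⟩
  have hK : IsCompact (frontier V) :=
    hVb.isCompact_closure.of_isClosed_subset isClosed_frontier frontier_subset_closure
  choose p hpc hpV hp using fun n : ℕ => exists_harmonic_eq_off_of_subharmonicAt hV hVb hn
    (continuous_affineSup (t := n) hK hne hφ) (subharmonicAt_affineSup hK hne hφ)
  choose q hqc hqV hq using fun n : ℕ => exists_harmonic_eq_off_of_subharmonicAt hV hVb hn
    (by fun_prop) (subharmonicAt_mul_norm_sq n.cast_nonneg)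
  refine exists_harmonicContOnCl_of_tendstoUniformlyOn_frontier (f := fun n => p n - q n) hV hVb
    (fun n => ⟨fun z hz => (hpV n z hz).sub (hqV n z hz), ((hpc n).sub (hqc n)).continuousOn⟩) ?_
  refine (tendstoUniformlyOn_affineSup_sub hK hne hφ).congr (Eventually.of_forall fun n z hz => ?_)
  rw [hV.frontier_eq] at hz
  rw [Pi.sub_apply, hp n z hz.2, hq n z hz.2]

theorem exists_continuousOn_sq_eq_one_add {X : Type*} [TopologicalSpace X] {W : Set X} {f : X → ℂ}
    (hf : ContinuousOn f W) (hlt : ∀ z ∈ W, ‖f z‖ < 1) :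
    ∃ τ : X → ℂ, ContinuousOn τ W ∧ ∀ z, τ z ^ 2 = 1 + f z :=
  ⟨fun z => (1 + f z) ^ (((2 : ℕ) : ℂ)⁻¹),
    (continuousOn_const.add hf).cpow_const fun z hz =>
      Complex.mem_slitPlane_of_norm_lt_one (hlt z hz),
    fun _ => Complex.cpow_nat_inv_pow _ two_ne_zero⟩

theorem HasSqrtOn.of_forall_dist_lt {W : Set ℂ} {p q : ℂ} (h : HasSqrtOn W p)
    (hd : ∀ z ∈ W, dist p q < dist z p) : HasSqrtOn W q := by
  obtain ⟨σ, hσ, hσp⟩ := h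
  have hne : ∀ z ∈ W, z - p ≠ 0 := fun z hz =>
    sub_ne_zero.2 (dist_pos.1 (dist_nonneg.trans_lt (hd z hz)))
  have hlt : ∀ z ∈ W, ‖(p - q) / (z - p)‖ < 1 := by
    intro z hz
    rw [norm_div, div_lt_one (norm_pos_iff.2 (hne z hz)), ← dist_eq_norm, ← dist_eq_norm]
    exact hd z hz
  have hcont : ContinuousOn (fun z => (p - q) / (z - p)) W :=
    continuousOn_const.div (by fun_prop) hne
  obtain ⟨τ, hτ, hτq⟩ := exists_continuousOn_sq_eq_one_add hcont hlt
  refine ⟨σ * τ, hσ.mul hτ, fun z hz => ?_⟩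
  rw [Pi.mul_apply, mul_pow, hσp z hz, hτq, mul_add, mul_one, mul_div_cancel₀ _ (hne z hz),
    sub_add_sub_cancel]

theorem hasSqrtOn_of_forall_dist_lt {W : Set ℂ} {a b : ℂ} (h : ∀ z ∈ W, dist z a < dist b a) :
    HasSqrtOn W b := by
  rcases eq_or_ne b a with rfl | hne
  · exact ⟨0, continuousOn_const, fun z hz => absurd (h z hz) (by simp only [dist_self, not_lt,
      dist_nonneg])⟩
  have hab : a - b ≠ 0 := sub_ne_zero.2 hne.symm
  have hlt : ∀ z ∈ W, ‖(z - a) / (a - b)‖ < 1 := by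
    intro z hz
    rw [norm_div, div_lt_one (norm_pos_iff.2 hab), ← dist_eq_norm, ← dist_eq_norm, dist_comm a b]
    exact h z hz
  obtain ⟨τ, hτ, hτb⟩ := exists_continuousOn_sq_eq_one_add (by fun_prop) hlt
  refine ⟨fun z => (a - b) ^ (((2 : ℕ) : ℂ)⁻¹) * τ z, continuousOn_const.mul hτ, fun z _ => ?_⟩
  rw [mul_pow, Complex.cpow_nat_inv_pow _ two_ne_zero, hτb, mul_add, mul_one,
    mul_div_cancel₀ _ hab, add_comm, sub_add_sub_cancel]

theorem HasSqrtOn.of_isPreconnected {W G : Set ℂ} {δ : ℝ} (hδ : 0 < δ) (hG : IsPreconnected G)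
    (hfar : ∀ z ∈ W, ∀ p ∈ G, δ ≤ dist z p) {a b : ℂ} (ha : a ∈ G) (hb : b ∈ G)
    (h : HasSqrtOn W b) : HasSqrtOn W a := by
  have hlocal : ∀ p ∈ G, ∀ q, dist p q < δ → HasSqrtOn W p → HasSqrtOn W q :=
    fun p hp q hpq hsqrt => hsqrt.of_forall_dist_lt fun z hz => hpq.trans_le (hfar z hz p hp)
  refine (hG.induction₂ (fun p q => HasSqrtOn W p ↔ HasSqrtOn W q) (fun p hp => ?_)
    (fun _ _ _ _ _ _ => Iff.trans) (fun _ _ _ _ => Iff.symm) hb ha).1 h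
  filter_upwards [mem_nhdsWithin_of_mem_nhds (ball_mem_nhds p hδ), self_mem_nhdsWithin]
    with q hqp hq
  exact ⟨hlocal p hp q (mem_ball'.1 hqp), hlocal q hq p hqp⟩

theorem nonThinAt_of_forall_exists_isPreconnected {V : Set ℂ} {a b : ℂ}
    (h : ∀ δ > 0, ∃ G, IsPreconnected G ∧ a ∈ G ∧ b ∈ G ∧ ∀ p ∈ G, ∃ y ∉ V, dist p y ≤ δ) :
    NonThinAt V a (dist b a) := by
  intro δ hδ
  obtain ⟨G, hG, ha, hb, hclose⟩ := h (δ / 2) (half_pos hδ)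
  refine HasSqrtOn.of_isPreconnected (half_pos hδ) hG (fun z hz p hp => ?_) ha hb
    (hasSqrtOn_of_forall_dist_lt fun z hz => hz.1)
  obtain ⟨y, hyV, hpy⟩ := hclose p hp
  linarith [hz.2 y hyV, dist_triangle z p y]

theorem nonThinAt_of_mem_sphere {V : Set ℂ} {c : ℂ} {R : ℝ} (hV : V ⊆ ball c R) {a : ℂ}
    (ha : a ∈ sphere c R) (r : ℝ) : NonThinAt V a r := by
  intro δ hδ
  refine hasSqrtOn_of_forall_dist_lt (a := c) fun z hz => ?_
  have hzV : z ∈ V := by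
    by_contra hzV
    exact hδ.not_ge (dist_self z ▸ hz.2 z hzV)
  exact (mem_ball.1 (hV hzV)).trans_eq (mem_sphere.1 ha).symm

theorem exists_div_two_pow_lt (c : ℝ) {δ : ℝ} (hδ : 0 < δ) : ∃ n : ℕ, c / 2 ^ n < δ := by
  have h : Tendsto (fun n : ℕ => c / 2 ^ n) atTop (𝓝 0) :=
    tendsto_const_nhds.div_atTop (tendsto_pow_atTop_atTop_of_one_lt one_lt_two)
  exact (h.eventually (gt_mem_nhds hδ)).exists

theorem exists_le_two_pow (x : ℝ) : ∃ n : ℕ, x ≤ 2 ^ n :=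
  (pow_unbounded_of_one_lt x one_lt_two).imp fun _ => le_of_lt

theorem IsComputableApproximation.nonThinAt {K V : Set ℂ} {C : ℕ → List (ℤ × ℤ)}
    (hC : IsComputableApproximation K C) (hKV : Disjoint K V) {a b : ℂ} (ha : a ∈ K)
    (hb : b ∈ K) : NonThinAt V a (dist b a) := by
  refine nonThinAt_of_forall_exists_isPreconnected fun δ hδ => ?_
  obtain ⟨n, hn⟩ := exists_div_two_pow_lt 4 hδ
  refine ⟨_, (hC.connected n).isPreconnected, hC.covers n ha, hC.covers n hb, fun p hp => ?_⟩
  obtain ⟨y, hy, hpy⟩ := hC.close n p hp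
  exact ⟨y, disjoint_left.1 hKV hy, hpy.trans hn.le⟩

theorem IsComputableApproximation.exists_forall_nonThinAt {K V : Set ℂ} {C : ℕ → List (ℤ × ℤ)}
    (hC : IsComputableApproximation K C) (hK : K.Nontrivial) (hKV : Disjoint K V) :
    ∃ A : ℕ, ∀ a ∈ K, NonThinAt V a (1 / 2 ^ A) := by
  obtain ⟨p, hp, q, hq, hpq⟩ := hK
  obtain ⟨A, hA⟩ := exists_div_two_pow_lt 1 (half_pos (dist_pos.2 hpq))
  refine ⟨A, fun a ha => ?_⟩
  rcases le_total (dist q a) (dist p a) with h | h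
  · exact (hC.nonThinAt hKV ha hp).mono (by linarith [dist_triangle_right p q a])
  · exact (hC.nonThinAt hKV ha hq).mono (by linarith [dist_triangle_right p q a])

theorem isClosed_gridSquare (n : ℕ) (c : ℤ × ℤ) : IsClosed (gridSquare n c) := by
  simp only [gridSquare, ofPred_and]
  exact (isClosed_le continuous_const Complex.continuous_re).inter
    ((isClosed_le Complex.continuous_re continuous_const).inter
      ((isClosed_le continuous_const Complex.continuous_im).inter
        (isClosed_le Complex.continuous_im continuous_const)))

theorem TendsToZeroComputably.exists_abs_lt {ε : ℕ → ℝ} (hε : TendsToZeroComputably ε) {δ : ℝ}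
    (hδ : 0 < δ) : ∃ n, |ε n| < δ := by
  obtain ⟨m, -, hm⟩ := hε
  obtain ⟨k, hk⟩ := exists_div_two_pow_lt 1 hδ
  exact ⟨m k, (hm k _ le_rfl).trans_lt hk⟩

theorem IsComputableCondition.continuousOn {K : Set ℂ} {C : ℕ → List (ℤ × ℤ)} {φ : ℂ → ℝ}
    (hC : IsComputableApproximation K C) (hφ : IsComputableCondition K C φ) :
    ContinuousOn φ K := by
  obtain ⟨ψ, ε, -, -, hε, hψ, -⟩ := hφ
  intro y hy
  rw [Metric.continuousWithinAt_iff']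
  intro δ hδ
  obtain ⟨n, hn⟩ := hε.exists_abs_lt (half_pos hδ)
  have hsquares : ∀ᶠ x in 𝓝 y, ∀ c ∈ {c | c ∈ C n}, x ∈ gridSquare n c → y ∈ gridSquare n c := by
    refine (eventually_all_finite (List.finite_toSet _)).2 fun c _ => ?_
    by_cases hyc : y ∈ gridSquare n c
    · exact Eventually.of_forall fun _ _ => hyc
    · filter_upwards [(isClosed_gridSquare n c).isOpen_compl.mem_nhds hyc] with x hx hxc
      exact absurd hxc hx
  filter_upwards [mem_nhdsWithin_of_mem_nhds hsquares, self_mem_nhdsWithin] with x hx hxK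
  obtain ⟨c, hc, hxc⟩ := mem_iUnion₂.1 (hC.covers n hxK)
  calc dist (φ x) (φ y) ≤ |ψ n c - φ x| + |ψ n c - φ y| := dist_triangle_left _ _ _
    _ ≤ ε n + ε n := add_le_add (hψ n c hc x ⟨hxK, hxc⟩) (hψ n c hc y ⟨hy, hx c hc hxc⟩)
    _ < δ := by linarith [le_abs_self (ε n)]

theorem nontrivial_frontier {E : Type*} [NormedAddCommGroup E] [NormedSpace ℝ E]
    (hE : 1 < Module.rank ℝ E) {U : Set E} (hU : IsOpen U) (hne : U.Nonempty)
    (hb : Bornology.IsBounded U) : (frontier U).Nontrivial := by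
  have : Nontrivial E := rank_pos_iff_nontrivial.1 (zero_lt_one.trans hE)
  by_contra hK
  obtain ⟨p, hp⟩ : ∃ p, frontier U ⊆ {p} := by
    rcases (not_nontrivial_iff.1 hK).eq_empty_or_singleton with h | ⟨p, h⟩
    · exact ⟨0, h ▸ empty_subset _⟩
    · exact ⟨p, h.subset⟩
  have : (𝓝[≠] p).NeBot := Module.punctured_nhds_neBot ℝ E p
  have hpU : {p}ᶜ ⊆ U := by
    refine (isConnected_compl_singleton_of_one_lt_rank hE p).isPreconnected
      |>.subset_of_closure_inter_subset hU ?_ fun z hz => ?_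
    · rw [inter_comm]
      exact (dense_compl_singleton p).inter_open_nonempty U hU hne
    · by_contra hzU
      exact hz.2 (hp (hU.frontier_eq ▸ ⟨hz.1, hzU⟩))
  exact NormedSpace.unbounded_univ ℝ E
    (((hb.subset hpU).union Bornology.isBounded_singleton).subset (compl_union_self {p}).ge)

theorem closedBall_subset_closure_ball_diff {E : Type*} [NormedAddCommGroup E] [NormedSpace ℝ E]
    {K : Set E} (hK : interior K = ∅) (c : E) {R : ℝ} (hR : R ≠ 0) :
    closedBall c R ⊆ closure (ball c R \ K) := by
  rw [← closure_ball c hR]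
  exact closure_minimal ((interior_eq_empty_iff_dense_compl.1 hK).open_subset_closure_inter
    isOpen_ball) isClosed_closure

theorem exists_continuousOn_harmonic_ball_diff {K : Set ℂ} (hK : IsCompact K)
    (hint : interior K = ∅) {c : ℂ} {R : ℝ} (hKR : K ⊆ ball c R)
    (hn : ∀ a ∈ K, ∃ r > 0, NonThinAt (ball c R \ K) a r) {φ : ℂ → ℝ} (hφ : ContinuousOn φ K) :
    ∃ u : ℂ → ℝ, ContinuousOn u (closedBall c R) ∧ (∀ z ∈ ball c R \ K, HarmonicAt u z) ∧
      EqOn u φ K := by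
  rcases eq_or_ne R 0 with rfl | hR
  · have hempty : K = ∅ := subset_empty_iff.1 (hKR.trans_eq ball_zero)
    exact ⟨0, continuousOn_const, fun z hz => absurd hz.1 (by simp only [ball_zero, notMem_empty,
      not_false_eq_true]), fun z hz => absurd (hempty ▸ hz) (notMem_empty z)⟩
  set V := ball c R \ K
  have hVo : IsOpen V := isOpen_ball.sdiff hK.isClosed
  have hcl : closedBall c R ⊆ closure V := closedBall_subset_closure_ball_diff hint c hR
  have hKV : K ⊆ frontier V := fun z hz => hVo.frontier_eq ▸
    ⟨hcl (ball_subset_closedBall (hKR hz)), fun h => h.2 hz⟩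
  have hfrontier : ∀ a ∈ frontier V, ∃ r > 0, NonThinAt V a r := by
    intro a ha
    by_cases haK : a ∈ K
    · exact hn a haK
    rw [hVo.frontier_eq] at ha
    have haR : a ∈ sphere c R ∪ ball c R := by
      rw [sphere_union_ball]
      exact closure_ball_subset_closedBall (closure_mono sdiff_subset ha.1)
    exact ⟨1, one_pos, nonThinAt_of_mem_sphere sdiff_subset
      (haR.resolve_right fun h => ha.2 ⟨h, haK⟩) 1⟩
  obtain ⟨g, hg⟩ := ContinuousMap.exists_restrict_eq hK.isClosed
    (⟨K.domRestrict φ, hφ.domRestrict⟩ : C(K, ℝ))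
  obtain ⟨u, hu, hug⟩ := exists_harmonicContOnCl_eqOn_frontier hVo
    (isBounded_ball.subset sdiff_subset) hfrontier (φ := g) g.continuous.continuousOn
  refine ⟨u, hu.continuousOn.mono hcl, hu.harmonicOnNhd, fun z hz => ?_⟩
  exact (hug (hKV hz)).trans (congrFun (congrArg DFunLike.coe hg) ⟨z, hz⟩)

/-- The function `u` solves the Dirichlet problem with boundary values `φ` on both sides of `K`,
inside a disc of radius `2 ^ (b + 2)` much larger than `K`, with arbitrary values on the circle; it
is bounded by `2 ^ M`, and `K` is nowhere thin at the scale `1 / 2 ^ A`. The natural numbers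
`b`, `M`, `A` are the only data about the geometry that the algorithm depends on. -/
structure IsTwoSidedSolution (K : Set ℂ) (φ u : ℂ → ℝ) (b M A : ℕ) : Prop where
  isCompact : IsCompact K
  subset : K ⊆ closedBall 0 (2 ^ b - 1)
  continuousOn : ContinuousOn u (closedBall 0 (2 ^ (b + 2)))
  harmonic : ∀ z ∈ ball 0 (2 ^ (b + 2)) \ K, HarmonicAt u z
  boundary : ∀ z ∈ K, u z = φ z
  bound : ∀ z ∈ closedBall (0 : ℂ) (2 ^ (b + 2)), |u z| ≤ 2 ^ M
  nonThin : ∀ a ∈ K, NonThinAt (ball 0 (2 ^ (b + 2)) \ K) a (1 / 2 ^ A)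

theorem closedBall_subset_ball_two_pow (b : ℕ) :
    closedBall (0 : ℂ) (2 ^ b - 1) ⊆ ball 0 (2 ^ (b + 2)) := by
  refine closedBall_subset_ball ?_
  rw [pow_add]
  linarith [pow_pos (two_pos (α := ℝ)) b]

theorem exists_isTwoSidedSolution {U : Set ℂ} (hU : IsOpen U) (hne : U.Nonempty)
    (hb : Bornology.IsBounded U) {C : ℕ → List (ℤ × ℤ)}
    (hC : IsComputableApproximation (frontier U) C) {φ : ℂ → ℝ}
    (hφ : ContinuousOn φ (frontier U)) :
    ∃ (u : ℂ → ℝ) (b M A : ℕ), IsTwoSidedSolution (frontier U) φ u b M A ∧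
      closure U ⊆ closedBall 0 (2 ^ b - 1) := by
  have hK : IsCompact (frontier U) :=
    hb.isCompact_closure.of_isClosed_subset isClosed_frontier frontier_subset_closure
  have hint : interior (frontier U) = ∅ := by
    rw [← frontier_compl]
    exact interior_frontier hU.isClosed_compl
  obtain ⟨ρ, hρ⟩ := hb.closure.subset_closedBall 0
  obtain ⟨b, hρb⟩ := exists_le_two_pow (ρ + 1)
  have hcl : closure U ⊆ closedBall 0 (2 ^ b - 1) :=
    hρ.trans (closedBall_subset_closedBall (by linarith))
  have hKb : frontier U ⊆ closedBall 0 (2 ^ b - 1) := frontier_subset_closure.trans hcl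
  obtain ⟨A, hA⟩ := hC.exists_forall_nonThinAt
    (nontrivial_frontier (Complex.rank_real_complex ▸ Nat.one_lt_ofNat) hU hne hb)
    (V := ball 0 (2 ^ (b + 2)) \ frontier U) disjoint_sdiff_right
  obtain ⟨u, huc, huh, huφ⟩ := exists_continuousOn_harmonic_ball_diff hK hint
    (hKb.trans (closedBall_subset_ball_two_pow b))
    (fun a ha => ⟨_, by positivity, hA a ha⟩) hφ
  obtain ⟨m, hm⟩ := (isCompact_closedBall (0 : ℂ) _).exists_bound_of_continuousOn huc
  obtain ⟨M, hM⟩ := exists_le_two_pow m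
  exact ⟨u, b, M, A, ⟨hK, hKb, huc, huh, huφ, fun z hz => (hm z hz).trans hM, hA⟩, hcl⟩

/-! ## Computability of integer arithmetic, bounded quantifiers and searches -/

theorem encode_int_ofNat (n : ℕ) : Encodable.encode (Int.ofNat n) = 2 * n := rfl

theorem encode_int_negSucc (n : ℕ) : Encodable.encode (Int.negSucc n) = 2 * n + 1 := rfl

theorem primrec_int_toNat : Primrec Int.toNat := by
  have h : Primrec fun x : ℤ => if Encodable.encode x % 2 = 0 then Encodable.encode x / 2 else 0 :=
    Primrec.ite (Primrec.eq.comp (Primrec.nat_mod.comp .encode (.const 2)) (.const 0))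
      (Primrec.nat_div.comp .encode (.const 2)) (.const 0)
  refine h.of_eq fun x => ?_
  cases x with
  | ofNat n => rw [encode_int_ofNat]; simp
  | negSucc n => rw [encode_int_negSucc, if_neg (by omega), Int.toNat_negSucc]

theorem primrec_int_toNat_neg : Primrec fun x : ℤ => (-x).toNat := by
  have h : Primrec fun x : ℤ => if Encodable.encode x % 2 = 0 then 0
      else Encodable.encode x / 2 + 1 :=
    Primrec.ite (Primrec.eq.comp (Primrec.nat_mod.comp .encode (.const 2)) (.const 0))
      (.const 0) (Primrec.succ.comp (Primrec.nat_div.comp .encode (.const 2)))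
  refine h.of_eq fun x => ?_
  cases x with
  | ofNat n => rw [encode_int_ofNat]; simp
  | negSucc n =>
    rw [encode_int_negSucc, if_neg (by omega), Int.neg_negSucc, Int.toNat_natCast]
    omega

theorem primrec₂_nat_sub_int : Primrec₂ fun a b : ℕ => (a : ℤ) - b := by
  have h : Primrec₂ fun a b : ℕ => if b ≤ a then 2 * (a - b) else 2 * (b - a - 1) + 1 :=
    Primrec.ite (Primrec.nat_le.comp .snd .fst)
      (Primrec.nat_mul.comp (.const 2) (Primrec.nat_sub.comp .fst .snd))
      (Primrec.succ.comp (Primrec.nat_mul.comp (.const 2)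
        (Primrec.nat_sub.comp (Primrec.nat_sub.comp .snd .fst) (.const 1))))
  refine Primrec₂.encode_iff.1 (h.of_eq fun a b => ?_)
  split_ifs with hab
  · rw [show (a : ℤ) - b = Int.ofNat (a - b) by simp only [Int.ofNat_eq_natCast]; omega,
      encode_int_ofNat]
  · rw [show (a : ℤ) - b = Int.negSucc (b - a - 1) by omega, encode_int_negSucc]

theorem primrec_natCast_int : Primrec fun n : ℕ => (n : ℤ) :=
  (primrec₂_nat_sub_int.comp .id (.const 0)).of_eq fun n => by simp

theorem primrec₂_int_add : Primrec₂ fun x y : ℤ => x + y := by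
  have h : Primrec₂ fun x y : ℤ => ((x.toNat + y.toNat : ℕ) : ℤ) - ((-x).toNat + (-y).toNat : ℕ) :=
    primrec₂_nat_sub_int.comp
      (Primrec.nat_add.comp (primrec_int_toNat.comp .fst) (primrec_int_toNat.comp .snd))
      (Primrec.nat_add.comp (primrec_int_toNat_neg.comp .fst) (primrec_int_toNat_neg.comp .snd))
  exact h.of_eq fun x y => by omega

theorem primrec_int_neg : Primrec fun x : ℤ => -x :=
  (primrec₂_nat_sub_int.comp primrec_int_toNat_neg primrec_int_toNat).of_eq fun x => by omega

theorem primrec₂_int_sub : Primrec₂ fun x y : ℤ => x - y :=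
  (primrec₂_int_add.comp .fst (primrec_int_neg.comp .snd)).of_eq fun p =>
    (sub_eq_add_neg p.1 p.2).symm

theorem primrec₂_int_mul : Primrec₂ fun x y : ℤ => x * y := by
  have hx : Primrec fun p : ℤ × ℤ => p.1.toNat := primrec_int_toNat.comp .fst
  have hy : Primrec fun p : ℤ × ℤ => p.2.toNat := primrec_int_toNat.comp .snd
  have hx' : Primrec fun p : ℤ × ℤ => (-p.1).toNat := primrec_int_toNat_neg.comp .fst
  have hy' : Primrec fun p : ℤ × ℤ => (-p.2).toNat := primrec_int_toNat_neg.comp .snd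
  have h := primrec₂_nat_sub_int.comp
    (Primrec.nat_add.comp (Primrec.nat_mul.comp hx hy) (Primrec.nat_mul.comp hx' hy'))
    (Primrec.nat_add.comp (Primrec.nat_mul.comp hx hy') (Primrec.nat_mul.comp hx' hy))
  refine h.of_eq fun p => ?_
  have e1 : p.1 = p.1.toNat - (-p.1).toNat := by omega
  have e2 : p.2 = p.2.toNat - (-p.2).toNat := by omega
  conv_rhs => rw [e1, e2]
  push_cast
  ring

theorem primrec₂_int_le : Primrec₂ fun x y : ℤ => decide (x ≤ y) := by
  have h : Primrec₂ fun x y : ℤ => decide (x.toNat + (-y).toNat ≤ y.toNat + (-x).toNat) :=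
    (primrecRel_iff_primrec_decide.1 Primrec.nat_le).comp
      (Primrec.nat_add.comp (primrec_int_toNat.comp .fst) (primrec_int_toNat_neg.comp .snd))
      (Primrec.nat_add.comp (primrec_int_toNat.comp .snd) (primrec_int_toNat_neg.comp .fst))
  exact h.of_eq fun x y => decide_eq_decide.2 (by omega)

theorem primrec_two_pow : Primrec fun n : ℕ => 2 ^ n :=
  (Primrec₂.unpaired'.1 Nat.Primrec.pow : Primrec₂ fun a b : ℕ => a ^ b).comp (.const 2) .id

theorem primrec_int_two_pow : Primrec fun n : ℕ => (2 : ℤ) ^ n :=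
  (primrec_natCast_int.comp primrec_two_pow).of_eq fun n => by push_cast; rfl

section Lists

variable {α β : Type*} [Primcodable α] [Primcodable β]

theorem computable_list_all {L : α → List β} {p : α → β → Bool} (hL : Computable L)
    (hp : Computable₂ p) : Computable fun a => (L a).all (p a) := by
  have hrec : Computable fun a => Nat.rec (motive := fun _ => Bool) true
      (fun i acc => acc && ((L a)[i]?.map (p a)).getD true) (L a).length := by
    refine Computable.nat_rec (Computable.list_length.comp hL) (Computable.const true)
      (h := fun a (q : ℕ × Bool) => q.2 && ((L a)[q.1]?.map (p a)).getD true) ?_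
    refine Primrec.and.to_comp.comp (Computable.snd.comp .snd) ?_
    refine Computable.option_getD (Computable.option_map ?_ ?_) (Computable.const true)
    · exact Computable.list_getElem?.comp (hL.comp .fst) (Computable.fst.comp .snd)
    · exact hp.comp (Computable.fst.comp .fst) .snd
  refine hrec.of_eq fun a => ?_
  have all_take : ∀ n ≤ (L a).length, Nat.rec (motive := fun _ => Bool) true
      (fun i acc => acc && ((L a)[i]?.map (p a)).getD true) n = ((L a).take n).all (p a) := by
    intro n
    induction n with
    | zero => simp
    | succ n ih =>
      intro hn
      simp only [ih (Nat.le_of_succ_le hn), List.take_add_one, List.all_append]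
      simp [List.getElem?_eq_getElem (Nat.lt_of_succ_le hn)]
  rw [all_take _ le_rfl, List.take_length]

theorem computable_list_any {L : α → List β} {p : α → β → Bool} (hL : Computable L)
    (hp : Computable₂ p) : Computable fun a => (L a).any (p a) := by
  have hnot : Computable₂ fun a b => !p a b := Primrec.not.to_comp.comp hp
  exact (Primrec.not.to_comp.comp (computable_list_all hL hnot)).of_eq fun a => by
    simp [List.any_eq_not_all_not]

theorem exists_computable_forall_eq_true {p : α → β → Bool} (hp : Computable₂ p)
    (h : ∀ a, ∃ b, p a b = true) : ∃ f : α → β, Computable f ∧ ∀ a, p a (f a) = true := by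
  set g : α → ℕ → Option β := fun a n =>
    (Encodable.decode n).bind fun b => bif p a b then some b else none
  have hg : Computable₂ g := by
    refine Computable.option_bind (Computable.decode.comp .snd) ?_
    exact Computable.cond (hp.comp (Computable.fst.comp .fst) .snd)
      (Computable.option_some.comp .snd) (.const none)
  have hdom : ∀ a, (Nat.rfindOpt (g a)).Dom := fun a => by
    obtain ⟨b, hb⟩ := h a
    exact Nat.rfindOpt_dom.2 ⟨Encodable.encode b, b, by simp [g, hb]⟩
  refine ⟨fun a => (Nat.rfindOpt (g a)).get (hdom a),
    (Partrec.rfindOpt hg).of_eq_tot fun a => Part.get_mem _, fun a => ?_⟩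
  obtain ⟨n, hn⟩ := Nat.rfindOpt_spec (Part.get_mem (hdom a))
  obtain ⟨b, -, hb⟩ := Option.bind_eq_some_iff.1 (Option.mem_def.1 hn)
  cases hpb : p a b with
  | false => simp [hpb] at hb
  | true =>
    obtain rfl : b = _ := by simpa [hpb] using hb
    exact hpb

end Lists

/-! ## Grid points, grid squares and the discrete Laplacian -/

/-- The point `z` is within `δ`, in each coordinate, of the grid square `c` of level `n`. Unlike
the distance to the square, this can be decided when `z` and `δ` are dyadic. -/
def GridNear (n : ℕ) (c : ℤ × ℤ) (δ : ℝ) (z : ℂ) : Prop :=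
  ((c.1 : ℝ) / 2 ^ n ≤ z.re + δ ∧ z.re ≤ ((c.1 : ℝ) + 1) / 2 ^ n + δ) ∧
    (c.2 : ℝ) / 2 ^ n ≤ z.im + δ ∧ z.im ≤ ((c.2 : ℝ) + 1) / 2 ^ n + δ

theorem gridNear_of_dist_le {n : ℕ} {c : ℤ × ℤ} {δ : ℝ} {y z : ℂ} (hy : y ∈ gridSquare n c)
    (h : dist z y ≤ δ) : GridNear n c δ z := by
  rw [dist_eq_norm] at h
  obtain ⟨hre, hre'⟩ := abs_le.1 ((Complex.abs_re_le_norm (z - y)).trans h)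
  obtain ⟨him, him'⟩ := abs_le.1 ((Complex.abs_im_le_norm (z - y)).trans h)
  rw [Complex.sub_re] at hre hre'
  rw [Complex.sub_im] at him him'
  obtain ⟨hl, hr, hb, ht⟩ := hy
  refine ⟨⟨?_, ?_⟩, ?_, ?_⟩ <;> linarith

theorem exists_mem_Icc_abs_sub_le {l r x δ : ℝ} (hlr : l ≤ r) (hl : l ≤ x + δ) (hr : x ≤ r + δ)
    (hδ : 0 ≤ δ) : ∃ y ∈ Icc l r, |x - y| ≤ δ :=
  ⟨max l (min x r), ⟨le_max_left _ _, max_le hlr (min_le_right _ _)⟩, by grind⟩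

theorem GridNear.exists_dist_le {n : ℕ} {c : ℤ × ℤ} {δ : ℝ} {z : ℂ} (hδ : 0 ≤ δ)
    (h : GridNear n c δ z) : ∃ y ∈ gridSquare n c, dist z y ≤ 2 * δ := by
  have hle : ∀ i : ℤ, (i : ℝ) / 2 ^ n ≤ ((i : ℝ) + 1) / 2 ^ n := fun i => by gcongr; linarith
  obtain ⟨x, hx, hzx⟩ := exists_mem_Icc_abs_sub_le (hle _) h.1.1 h.1.2 hδ
  obtain ⟨y, hy, hzy⟩ := exists_mem_Icc_abs_sub_le (hle _) h.2.1 h.2.2 hδ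
  refine ⟨⟨x, y⟩, ⟨hx.1, hx.2, hy.1, hy.2⟩, ?_⟩
  rw [dist_eq_norm, two_mul]
  exact (Complex.norm_le_abs_re_add_abs_im _).trans (add_le_add hzx hzy)

theorem forall_gridAdjacent_iff {q : ℤ × ℤ} {P : ℤ × ℤ → Prop} :
    (∀ p, GridAdjacent q p → P p) ↔
      P (q.1 + 1, q.2) ∧ P (q.1 - 1, q.2) ∧ P (q.1, q.2 + 1) ∧ P (q.1, q.2 - 1) := by
  constructor
  · intro h
    refine ⟨h _ ?_, h _ ?_, h _ ?_, h _ ?_⟩ <;> simp [GridAdjacent]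
  · rintro ⟨hr, hl, hu, hd⟩ ⟨x, y⟩ hadj
    have hcases : (x = q.1 + 1 ∧ y = q.2) ∨ (x = q.1 - 1 ∧ y = q.2) ∨
        (x = q.1 ∧ y = q.2 + 1) ∨ (x = q.1 ∧ y = q.2 - 1) := by
      simp only [GridAdjacent] at hadj
      grind
    rcases hcases with ⟨rfl, rfl⟩ | ⟨rfl, rfl⟩ | ⟨rfl, rfl⟩ | ⟨rfl, rfl⟩ <;> assumption

/-- The discrete Laplacian on `ℤ × ℤ`, with the five-point stencil and without normalization by
the mesh size. -/
def discreteLaplacian {R : Type*} [Ring R] (w : ℤ × ℤ → R) (q : ℤ × ℤ) : R :=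
  w (q.1 + 1, q.2) + w (q.1 - 1, q.2) + w (q.1, q.2 + 1) + w (q.1, q.2 - 1) - 4 * w q

theorem discreteLaplacian_congr {R : Type*} [Ring R] {v w : ℤ × ℤ → R} {q : ℤ × ℤ}
    (hq : v q = w q) (h : ∀ p, GridAdjacent q p → v p = w p) :
    discreteLaplacian v q = discreteLaplacian w q := by
  obtain ⟨hr, hl, hu, hd⟩ := forall_gridAdjacent_iff.1 h
  rw [discreteLaplacian, discreteLaplacian, hq, hr, hl, hu, hd]

theorem discreteLaplacian_sub {R : Type*} [Ring R] (v w : ℤ × ℤ → R) (q : ℤ × ℤ) :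
    discreteLaplacian (v - w) q = discreteLaplacian v q - discreteLaplacian w q := by
  simp only [discreteLaplacian, Pi.sub_apply, mul_sub]
  abel

theorem discreteLaplacian_neg {R : Type*} [Ring R] (w : ℤ × ℤ → R) (q : ℤ × ℤ) :
    discreteLaplacian (-w) q = -discreteLaplacian w q := by
  simp only [discreteLaplacian, Pi.neg_apply, mul_neg]
  abel

theorem abs_discreteLaplacian_le {R : Type*} [CommRing R] [LinearOrder R]
    [IsStrictOrderedRing R] {w : ℤ × ℤ → R} {δ : R} (hw : ∀ q, |w q| ≤ δ) (q : ℤ × ℤ) :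
    |discreteLaplacian w q| ≤ 8 * δ := by
  have hle := fun p => abs_le.1 (hw p)
  rw [discreteLaplacian, abs_le]
  constructor <;> linarith [hle q, hle (q.1 + 1, q.2), hle (q.1 - 1, q.2), hle (q.1, q.2 + 1),
    hle (q.1, q.2 - 1)]

section MaximumPrinciple

variable {G : Set (ℤ × ℤ)} {e : ℤ × ℤ → ℝ} {B κ R : ℝ}

/- Adding `κ * (x ^ 2 + y ^ 2)`, whose discrete Laplacian is `4 * κ`, makes the function strictly
subharmonic, so that its maximum cannot be attained at an interior point. -/
theorem le_of_neg_le_discreteLaplacian (hG : G.Finite) (hκ : 0 < κ)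
    (h : ∀ q ∈ G, e q ≤ B ∨ (∀ p, GridAdjacent q p → p ∈ G) ∧ -κ ≤ discreteLaplacian e q)
    (hR : ∀ q ∈ G, (q.1 : ℝ) ^ 2 + (q.2 : ℝ) ^ 2 ≤ R) : ∀ q ∈ G, e q ≤ B + κ * R := by
  intro q hq
  set f : ℤ × ℤ → ℝ := fun q => e q + κ * ((q.1 : ℝ) ^ 2 + (q.2 : ℝ) ^ 2) with hf
  obtain ⟨p, hp, hle⟩ := exists_max_image G f hG ⟨q, hq⟩
  rcases h p hp with hpB | ⟨hadj, hlap⟩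
  · have hqp := hle q hq
    have hpR := mul_le_mul_of_nonneg_left (hR p hp) hκ.le
    have hq0 : 0 ≤ κ * ((q.1 : ℝ) ^ 2 + (q.2 : ℝ) ^ 2) := by positivity
    simp only [hf] at hqp
    linarith
  · obtain ⟨hr, hl, hu, hd⟩ := forall_gridAdjacent_iff.1 fun x hx => hle x (hadj x hx)
    simp only [hf, Int.cast_add, Int.cast_sub, Int.cast_one] at hr hl hu hd
    rw [discreteLaplacian] at hlap
    nlinarith

theorem abs_le_of_abs_discreteLaplacian_le (hG : G.Finite) (hκ : 0 < κ)
    (h : ∀ q ∈ G, |e q| ≤ B ∨ (∀ p, GridAdjacent q p → p ∈ G) ∧ |discreteLaplacian e q| ≤ κ)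
    (hR : ∀ q ∈ G, (q.1 : ℝ) ^ 2 + (q.2 : ℝ) ^ 2 ≤ R) : ∀ q ∈ G, |e q| ≤ B + κ * R := by
  refine fun q hq => abs_le'.2 ⟨le_of_neg_le_discreteLaplacian hG hκ (fun p hp => ?_) hR q hq,
    le_of_neg_le_discreteLaplacian (e := -e) hG hκ (fun p hp => ?_) hR q hq⟩
  · exact (h p hp).imp (le_of_abs_le ·) (And.imp_right fun hlap => (abs_le.1 hlap).1)
  · rw [discreteLaplacian_neg]
    exact (h p hp).imp (neg_le_of_abs_le · |> neg_le.1) (And.imp_right fun hlap =>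
      neg_le_neg (le_of_abs_le hlap))

end MaximumPrinciple

theorem dyadicPoint_add (m : ℕ) (q : ℤ × ℤ) :
    dyadicPoint m (q.1 + 1, q.2) = dyadicPoint m q + ((1 / 2 ^ m : ℝ) : ℂ) ∧
    dyadicPoint m (q.1 - 1, q.2) = dyadicPoint m q - ((1 / 2 ^ m : ℝ) : ℂ) ∧
    dyadicPoint m (q.1, q.2 + 1) = dyadicPoint m q + ((1 / 2 ^ m : ℝ) : ℂ) * Complex.I ∧
    dyadicPoint m (q.1, q.2 - 1) = dyadicPoint m q - ((1 / 2 ^ m : ℝ) : ℂ) * Complex.I := by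
  refine ⟨?_, ?_, ?_, ?_⟩ <;>
  · apply Complex.ext <;>
    · simp only [dyadicPoint, Complex.add_re, Complex.add_im, Complex.sub_re, Complex.sub_im,
        Complex.mul_re, Complex.mul_im, Complex.ofReal_re, Complex.ofReal_im, Complex.I_re,
        Complex.I_im]
      push_cast
      ring

theorem dist_dyadicPoint_le_of_gridAdjacent (m : ℕ) {p q : ℤ × ℤ} (h : GridAdjacent q p) :
    dist (dyadicPoint m p) (dyadicPoint m q) ≤ 1 / 2 ^ m := by
  have hcast : |(q.1 : ℝ) - p.1| + |(q.2 : ℝ) - p.2| = 1 := by exact_mod_cast h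
  rw [dist_comm, dist_eq_norm, ← hcast, add_div]
  refine (Complex.norm_le_abs_re_add_abs_im _).trans (le_of_eq ?_)
  simp only [dyadicPoint, Complex.sub_re, Complex.sub_im, ← sub_div, abs_div, abs_pow, abs_two]

/-- The grid points of level `m` in the square of half side `2 ^ b` centred at the origin. -/
def InBox (b m : ℕ) (q : ℤ × ℤ) : Prop :=
  |q.1| ≤ 2 ^ (b + m) ∧ |q.2| ≤ 2 ^ (b + m)

section InBox

variable {b m : ℕ} {q : ℤ × ℤ}

theorem inBox_iff : InBox b m q ↔
    |(dyadicPoint m q).re| ≤ 2 ^ b ∧ |(dyadicPoint m q).im| ≤ 2 ^ b := by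
  have habs : ∀ i : ℤ, |i| ≤ 2 ^ (b + m) ↔ |(i : ℝ) / 2 ^ m| ≤ 2 ^ b := fun i => by
    rw [abs_div, abs_pow, abs_two, div_le_iff₀ (by positivity), ← pow_add]
    exact_mod_cast Iff.rfl
  exact and_congr (habs _) (habs _)

theorem inBox_of_norm_le (h : ‖dyadicPoint m q‖ ≤ 2 ^ b) : InBox b m q :=
  inBox_iff.2 ⟨(Complex.abs_re_le_norm _).trans h, (Complex.abs_im_le_norm _).trans h⟩

theorem inBox_of_dist_le {z : ℂ} (hz : z ∈ closedBall 0 (2 ^ b - 1))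
    (hq : dist z (dyadicPoint m q) ≤ 1 / 2 ^ m) : InBox b m q := by
  have hm : (1 : ℝ) / 2 ^ m ≤ 1 := div_le_self zero_le_one (one_le_pow₀ one_le_two)
  refine inBox_of_norm_le ?_
  rw [← dist_zero_right]
  linarith [dist_triangle_left (dyadicPoint m q) 0 z, mem_closedBall.1 hz]

theorem InBox.norm_le (h : InBox b m q) : ‖dyadicPoint m q‖ ≤ 2 * 2 ^ b := by
  rw [two_mul]
  exact (Complex.norm_le_abs_re_add_abs_im _).trans
    (add_le_add (inBox_iff.1 h).1 (inBox_iff.1 h).2)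

theorem InBox.succ (h : InBox b m q) : InBox (b + 1) m q := by
  have hle : (2 : ℤ) ^ (b + m) ≤ 2 ^ (b + 1 + m) := pow_le_pow_right₀ one_le_two (by omega)
  exact ⟨h.1.trans hle, h.2.trans hle⟩

theorem InBox.of_gridAdjacent {p : ℤ × ℤ} (h : InBox b m q) (hadj : GridAdjacent q p) :
    InBox (b + 1) m p := by
  have hpow : (2 : ℤ) ^ (b + 1 + m) = 2 ^ (b + m) + 2 ^ (b + m) := by ring
  have hone : (1 : ℤ) ≤ 2 ^ (b + m) := one_le_pow₀ one_le_two
  obtain ⟨hx, hy⟩ := h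
  rw [GridAdjacent] at hadj
  rw [InBox, hpow]
  constructor <;> grind

theorem finite_inBox (b m : ℕ) : {q | InBox b m q}.Finite :=
  ((Set.finite_Icc (-(2 ^ (b + m) : ℤ)) (2 ^ (b + m))).prod
    (Set.finite_Icc (-(2 ^ (b + m) : ℤ)) (2 ^ (b + m)))).subset fun _ hq =>
      ⟨abs_le.1 hq.1, abs_le.1 hq.2⟩

end InBox

/-- The grid point `q` of level `m` is close to the set of squares `L` of level `N`. -/
def CloseTo (N m : ℕ) (L : List (ℤ × ℤ)) (q : ℤ × ℤ) : Prop :=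
  ∃ c ∈ L, GridNear N c (1 / 2 ^ N) (dyadicPoint m q)

/-! ## Error bounds for approximate discrete solutions -/

section Soundness

variable {K U : Set ℂ} {φ u : ℂ → ℝ} {b M A₀ A n j N m : ℕ} {C : ℕ → List (ℤ × ℤ)} {q : ℤ × ℤ}
  {w : ℤ × ℤ → ℝ} {B κ κ' : ℝ}

theorem IsTwoSidedSolution.abs_sub_le (h : IsTwoSidedSolution K φ u b M A₀) (hA : A₀ < A) {a : ℂ}
    (ha : a ∈ K) {t η : ℝ} (hη : ∀ y ∈ K, dist y a < 1 / 2 ^ A → |φ y - t| ≤ η) (j : ℕ) {z : ℂ}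
    (hz : dist z a < 1 / 2 ^ A / 16 ^ j) : |u z - t| ≤ η + (3 / 4) ^ j * (2 * 2 ^ M) := by
  have hA0 : (0 : ℝ) < 1 / 2 ^ A := by positivity
  have hA1 : (1 : ℝ) / 2 ^ A ≤ 1 := div_le_self zero_le_one (one_le_pow₀ one_le_two)
  have hAA₀ : (1 : ℝ) / 2 ^ A ≤ 1 / 2 ^ A₀ :=
    one_div_pow_le_one_div_pow_of_le one_le_two hA.le
  have hball : ball a (1 / 2 ^ A) ⊆ ball 0 (2 ^ (b + 2)) := fun y hy => by
    have haK := mem_closedBall.1 (h.subset ha)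
    have hpow : (2 : ℝ) ^ (b + 2) = 4 * 2 ^ b := by ring
    have hpos : (0 : ℝ) < 2 ^ b := by positivity
    rw [mem_ball] at hy ⊢
    linarith [dist_triangle y a 0]
  have hcb := hball.trans ball_subset_closedBall
  have hφa := hη a ha (by rwa [dist_self])
  have hua := h.bound a (hcb (mem_ball_self hA0))
  rw [h.boundary a ha] at hua
  refine ((h.nonThin a ha).mono hAA₀).abs_le_add_three_quarters_pow (f := fun y => u y - t)
    (isOpen_ball.sdiff h.isCompact.isClosed) (fun haV => haV.2 ha)
    ((h.continuousOn.mono hcb).sub continuousOn_const)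
    (fun y hy => (h.harmonic y hy.1).sub (harmonicAt_const t)) (fun y hy hyV => ?_)
    (fun y hy => ?_) (by positivity) j z hz
  · have hyK : y ∈ K := by_contra fun hyK => hyV ⟨hball hy, hyK⟩
    rw [h.boundary y hyK]
    exact hη y hyK hy
  · calc |u y - t| ≤ |u y| + |φ a - t| + |φ a| := by grind
      _ ≤ η + 2 * 2 ^ M := by linarith [h.bound y (hcb hy)]

theorem three_quarters_pow_le (i : ℕ) : (3 / 4 : ℝ) ^ (3 * i) ≤ 1 / 2 ^ i := by
  rw [pow_mul, one_div, ← inv_pow]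
  gcongr
  norm_num

theorem CloseTo.exists_dist_le (hC : IsComputableApproximation K C) (h : CloseTo N m (C N) q) :
    ∃ a ∈ K, dist (dyadicPoint m q) a ≤ 6 / 2 ^ N := by
  obtain ⟨c, hc, hn⟩ := h
  obtain ⟨y, hy, hqy⟩ := hn.exists_dist_le (by positivity)
  obtain ⟨a, ha, hya⟩ := hC.close N y (mem_iUnion₂.2 ⟨c, hc, hy⟩)
  refine ⟨a, ha, (dist_triangle _ y a).trans ((add_le_add hqy hya).trans (le_of_eq ?_))⟩
  ring

theorem disjoint_closedBall_of_not_closeTo (hC : IsComputableApproximation K C)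
    (h : ¬ CloseTo N m (C N) q) : Disjoint (closedBall (dyadicPoint m q) (1 / 2 ^ N)) K := by
  refine disjoint_left.2 fun y hy hyK => ?_
  obtain ⟨c, hc, hyc⟩ := mem_iUnion₂.1 (hC.covers N hyK)
  exact h ⟨c, hc, gridNear_of_dist_le hyc (by rwa [dist_comm])⟩

theorem InBox.closedBall_subset (hq : InBox b m q) :
    closedBall (dyadicPoint m q) (1 / 2 ^ N) ⊆ ball 0 (2 ^ (b + 2)) := by
  intro y hy
  have hq0 := hq.norm_le
  rw [← dist_zero_right] at hq0
  have hb : (1 : ℝ) ≤ 2 ^ b := one_le_pow₀ one_le_two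
  have hpow : (2 : ℝ) ^ (b + 2) = 4 * 2 ^ b := by ring
  have hN : (1 : ℝ) / 2 ^ N ≤ 1 := div_le_self zero_le_one (one_le_pow₀ one_le_two)
  rw [mem_closedBall] at hy
  rw [mem_ball]
  linarith [dist_triangle y (dyadicPoint m q) 0]

theorem IsTwoSidedSolution.harmonicContOnCl (h : IsTwoSidedSolution K φ u b M A₀)
    (hC : IsComputableApproximation K C) (hq : InBox b m q) (hfar : ¬ CloseTo N m (C N) q) :
    HarmonicContOnCl u (ball (dyadicPoint m q) (1 / 2 ^ N)) ∧
      ∀ z ∈ sphere (dyadicPoint m q) (1 / 2 ^ N), |u z| ≤ 2 ^ M := by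
  have hsub : closedBall (dyadicPoint m q) (1 / 2 ^ N) ⊆ ball 0 (2 ^ (b + 2)) :=
    hq.closedBall_subset
  have hK := disjoint_closedBall_of_not_closeTo hC hfar
  have hcb := hsub.trans ball_subset_closedBall
  exact ⟨⟨fun y hy => h.harmonic y ⟨hsub (ball_subset_closedBall hy),
      disjoint_left.1 hK (ball_subset_closedBall hy)⟩,
    h.continuousOn.mono (closure_ball_subset_closedBall.trans hcb)⟩,
    fun z hz => h.bound z (hcb (sphere_subset_closedBall hz))⟩

theorem one_div_two_pow_le_half (hNm : N < m) : (1 : ℝ) / 2 ^ m ≤ 1 / 2 ^ N / 2 := by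
  rw [div_div, ← pow_succ]
  exact one_div_pow_le_one_div_pow_of_le one_le_two hNm

theorem IsTwoSidedSolution.abs_discreteLaplacian_le (h : IsTwoSidedSolution K φ u b M A₀)
    (hC : IsComputableApproximation K C) (hq : InBox b m q) (hfar : ¬ CloseTo N m (C N) q)
    (hNm : N < m) :
    |discreteLaplacian (u ∘ dyadicPoint m) q| ≤ 16 * (2 ^ N / 2 ^ m) ^ 4 * 2 ^ M := by
  obtain ⟨hu, hM⟩ := h.harmonicContOnCl hC hq hfar
  obtain ⟨hr, hl, hu', hd⟩ := dyadicPoint_add m q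
  have hnorm : ‖((1 / 2 ^ m : ℝ) : ℂ)‖ = 1 / 2 ^ m := by
    rw [Complex.norm_real, Real.norm_of_nonneg (by positivity)]
  have hle := abs_stencil_sum_le_of_harmonicContOnCl (by positivity) hu hM
    (hnorm.trans_le (one_div_two_pow_le_half hNm))
  rw [hnorm, div_div_eq_mul_div, div_one, one_div_mul_eq_div] at hle
  simpa only [discreteLaplacian, Function.comp_apply, hr, hl, hu', hd] using hle

theorem IsTwoSidedSolution.abs_sub_le_of_closeTo (h : IsTwoSidedSolution K φ u b M A₀)
    (hC : IsComputableApproximation K C) (hA : A₀ ≤ A) {ψ : ℤ × ℤ → ℝ} {ε : ℝ}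
    (hψ : ∀ c ∈ C n, ∀ y ∈ K ∩ gridSquare n c, |ψ c - φ y| ≤ ε) {t η : ℝ}
    (hN : A + 4 * j + 5 ≤ N) (hcl : CloseTo N m (C N) q)
    (hη : ∀ c ∈ C n, GridNear n c (1 / 2 ^ A) (dyadicPoint m q) → |t - ψ c| ≤ η) {z : ℂ}
    (hz : dist z (dyadicPoint m q) ≤ 1 / 2 ^ N) :
    |u z - t| ≤ η + ε + (3 / 4) ^ j * (2 * 2 ^ M) := by
  obtain ⟨a, ha, hqa⟩ := hcl.exists_dist_le hC
  have hA' : (1 : ℝ) / 2 ^ A = 2 * (1 / 2 ^ (A + 1)) := by rw [pow_succ]; field_simp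
  have hj : (1 : ℝ) / 2 ^ (A + 1) / 16 ^ j ≤ 1 / 2 ^ (A + 1) :=
    div_le_self (by positivity) (one_le_pow₀ (by norm_num))
  have hscale : 16 * (1 / 2 ^ N) ≤ (1 : ℝ) / 2 ^ (A + 1) / 16 ^ j :=
    calc 16 * ((1 : ℝ) / 2 ^ N) ≤ 16 * (1 / 2 ^ (A + 4 * j + 5)) := by gcongr; norm_num
      _ = 1 / 2 ^ (A + 1) / 16 ^ j := by
        rw [show A + 4 * j + 5 = A + 1 + 4 * j + 4 by ring, pow_add _ _ 4, pow_add _ _ (4 * j),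
          pow_mul]
        field_simp
        norm_num
  have hN0 : (0 : ℝ) < 1 / 2 ^ N := by positivity
  rw [div_eq_mul_one_div] at hqa
  refine h.abs_sub_le (A := A + 1) (by omega) ha (η := η + ε) (fun y hy hya => ?_) j ?_
  · obtain ⟨c, hc, hyc⟩ := mem_iUnion₂.1 (hC.covers n hy)
    have hqy : dist (dyadicPoint m q) y ≤ 1 / 2 ^ A := by
      linarith [dist_triangle_right (dyadicPoint m q) y a]
    calc |φ y - t| ≤ |t - ψ c| + |ψ c - φ y| := by grind
      _ ≤ η + ε := add_le_add (hη c hc (gridNear_of_dist_le hyc hqy)) (hψ c hc y ⟨hy, hyc⟩)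
  · linarith [dist_triangle z (dyadicPoint m q) a]

theorem closedBall_subset_of_not_closeTo (hUo : IsOpen U)
    (hC : IsComputableApproximation (frontier U) C) (h : ¬ CloseTo N m (C N) q) {z : ℂ}
    (hz : z ∈ closedBall (dyadicPoint m q) (1 / 2 ^ N)) (hzU : z ∈ closure U) :
    closedBall (dyadicPoint m q) (1 / 2 ^ N) ⊆ U := by
  have hK := disjoint_closedBall_of_not_closeTo hC h
  have hmem : ∀ y ∈ closedBall (dyadicPoint m q) (1 / 2 ^ N), y ∈ closure U → y ∈ U :=
    fun y hy hyU => by_contra fun hn =>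
      disjoint_left.1 hK hy (hUo.frontier_eq ▸ ⟨hyU, hn⟩)
  exact (convex_closedBall _ _).isPreconnected.subset_left_of_subset_union hUo
    isClosed_closure.isOpen_compl (disjoint_compl_right.mono_left subset_closure)
    (fun y hy => or_iff_not_imp_right.2 fun hn => hmem y hy (not_not.1 hn))
    ⟨z, hz, hmem z hz hzU⟩

theorem sq_add_sq_le_of_norm_dyadicPoint_le (h : ‖dyadicPoint m q‖ ≤ 2 ^ b) :
    (q.1 : ℝ) ^ 2 + (q.2 : ℝ) ^ 2 ≤ 4 ^ (m + b) := by
  have hsq := pow_le_pow_left₀ (norm_nonneg _) h 2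
  have hpow : (4 : ℝ) ^ (m + b) = (2 ^ b) ^ 2 * (2 ^ m) ^ 2 := by
    rw [← mul_pow, ← pow_add, ← pow_mul, add_comm b, mul_comm _ 2, pow_mul]
    norm_num
  rw [Complex.sq_norm, Complex.normSq_apply] at hsq
  simp only [dyadicPoint, ← sq, div_pow, ← add_div] at hsq
  rwa [div_le_iff₀ (by positivity), ← hpow] at hsq

theorem IsTwoSidedSolution.abs_sub_le_of_discreteLaplacian
    (h : IsTwoSidedSolution (frontier U) φ u b M A₀) (hUo : IsOpen U)
    (hC : IsComputableApproximation (frontier U) C) (hU : closure U ⊆ closedBall 0 (2 ^ b - 1))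
    (hNm : N < m)
    (hnear : ∀ q, InBox b m q → CloseTo N m (C N) q →
      ∀ z, dist z (dyadicPoint m q) ≤ 1 / 2 ^ N → |u z - w q| ≤ B)
    (hfar : ∀ q, InBox b m q → ¬ CloseTo N m (C N) q → |discreteLaplacian w q| ≤ κ)
    (hκ0 : 0 < κ') (hκ : 16 * (2 ^ N / 2 ^ m) ^ 4 * 2 ^ M + κ ≤ κ') (hq : dyadicPoint m q ∈ U) :
    |u (dyadicPoint m q) - w q| ≤ B + κ' * 4 ^ (m + b) := by
  set G : Set (ℤ × ℤ) := {q | dyadicPoint m q ∈ U}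
  have hnorm : ∀ q ∈ G, ‖dyadicPoint m q‖ ≤ 2 ^ b := fun q hq => by
    linarith [mem_closedBall_zero_iff.1 (hU (subset_closure hq))]
  have hbox : ∀ q ∈ G, InBox b m q := fun q hq => inBox_of_norm_le (hnorm q hq)
  have hball : ∀ q, dyadicPoint m q ∈ closedBall (dyadicPoint m q) (1 / 2 ^ N) :=
    fun q => mem_closedBall_self (by positivity)
  refine abs_le_of_abs_discreteLaplacian_le (e := u ∘ dyadicPoint m - w)
    ((finite_inBox b m).subset hbox) hκ0 (fun p hp => ?_)
    (fun p hp => sq_add_sq_le_of_norm_dyadicPoint_le (hnorm p hp)) q hq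
  by_cases hcl : CloseTo N m (C N) p
  · exact Or.inl (hnear p (hbox p hp) hcl _ (hball p))
  · refine Or.inr ⟨fun p' hadj => ?_, ?_⟩
    · refine closedBall_subset_of_not_closeTo hUo hC hcl (hball p) (subset_closure hp) ?_
      exact (dist_dyadicPoint_le_of_gridAdjacent m hadj).trans
        (one_div_pow_le_one_div_pow_of_le one_le_two hNm.le)
    · rw [discreteLaplacian_sub]
      exact (abs_sub _ _).trans <| (add_le_add (h.abs_discreteLaplacian_le hC (hbox p hp) hcl hNm)
        (hfar p (hbox p hp) hcl)).trans hκ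

theorem IsTwoSidedSolution.abs_sub_le_of_dist_le
    (h : IsTwoSidedSolution (frontier U) φ u b M A₀) (hUo : IsOpen U)
    (hC : IsComputableApproximation (frontier U) C) (hU : closure U ⊆ closedBall 0 (2 ^ b - 1))
    (hNm : N < m)
    (hnear : ∀ q, InBox b m q → CloseTo N m (C N) q →
      ∀ z, dist z (dyadicPoint m q) ≤ 1 / 2 ^ N → |u z - w q| ≤ B)
    (hfar : ∀ q, InBox b m q → ¬ CloseTo N m (C N) q → |discreteLaplacian w q| ≤ κ)
    (hκ0 : 0 < κ') (hκ : 16 * (2 ^ N / 2 ^ m) ^ 4 * 2 ^ M + κ ≤ κ') {z : ℂ} (hz : z ∈ closure U)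
    (hq : dist z (dyadicPoint m q) ≤ 1 / 2 ^ m) :
    |u z - w q| ≤ B + κ' * 4 ^ (m + b) + 4 * (2 ^ N / 2 ^ m) * 2 ^ M := by
  have hN0 : (0 : ℝ) < 1 / 2 ^ N := by positivity
  have hmN := one_div_two_pow_le_half hNm
  have hzq : dist z (dyadicPoint m q) ≤ 1 / 2 ^ N := by linarith
  have hqb : InBox b m q := inBox_of_dist_le (hU hz) hq
  by_cases hcl : CloseTo N m (C N) q
  · have hκ4 : 0 ≤ κ' * 4 ^ (m + b) := by positivity
    have hgrad : (0 : ℝ) ≤ 4 * (2 ^ N / 2 ^ m) * 2 ^ M := by positivity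
    linarith [hnear q hqb hcl z hzq]
  · have hqU : dyadicPoint m q ∈ U :=
      closedBall_subset_of_not_closeTo hUo hC hcl hzq hz (mem_closedBall_self hN0.le)
    obtain ⟨hu, hM⟩ := h.harmonicContOnCl hC hqb hcl
    have hdist : dist z (dyadicPoint m q) / (1 / 2 ^ N) ≤ 2 ^ N / 2 ^ m :=
      by
      rw [div_div_eq_mul_div, div_one, ← one_div_mul_eq_div]
      gcongr
    calc |u z - w q| ≤ |u (dyadicPoint m q) - w q| + |u z - u (dyadicPoint m q)| := by grind
      _ ≤ B + κ' * 4 ^ (m + b) + 4 * (dist z (dyadicPoint m q) / (1 / 2 ^ N)) * 2 ^ M :=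
        add_le_add
          (h.abs_sub_le_of_discreteLaplacian hUo hC hU hNm hnear hfar hκ0 hκ hqU)
          (abs_sub_le_of_harmonicContOnCl hN0 hu hM (hq.trans hmN))
      _ ≤ B + κ' * 4 ^ (m + b) + 4 * (2 ^ N / 2 ^ m) * 2 ^ M := by gcongr

end Soundness

/-! ## Certificates -/

theorem two_pow_div_two_pow_le {a b c : ℕ} (h : a + c ≤ b) : (2 : ℝ) ^ a / 2 ^ b ≤ 1 / 2 ^ c := by
  rw [div_le_div_iff₀ (by positivity) (by positivity), ← pow_add, one_mul]
  exact pow_le_pow_right₀ one_le_two h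

theorem abs_le_two_pow_sub_iff {x : ℤ} {j s : ℕ} (h : j ≤ s) :
    |x| ≤ 2 ^ (s - j) ↔ |(x : ℝ) / 2 ^ s| ≤ 1 / 2 ^ j := by
  rw [abs_div, abs_pow, abs_two, div_le_div_iff₀ (by positivity) (by positivity), one_mul,
    ← pow_sub_mul_pow 2 h, mul_le_mul_iff_left₀ (by positivity)]
  exact_mod_cast Iff.rfl

/-- The scales `N`, `m`, `s` are fine enough for a solution with bound `2 ^ M` on a set of size
`2 ^ b` to be approximated up to `1 / 2 ^ k` by the values at the grid points of level `m` of an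
approximate discrete solution which is rounded to multiples of `1 / 2 ^ s`, and which agrees with
the boundary values at the points at distance about `1 / 2 ^ N` from the boundary. Each
condition controls one error: the boundary decay between the scales `1 / 2 ^ A` and `1 / 2 ^ N`, the
variation of the solution between grid points, the accumulation of the discrete Laplacians (by the
maximum principle, up to `4 ^ (m + b)` times), and the discrete Laplacian of the solution itself. -/
structure AreFineScales (b M k A N m s : ℕ) : Prop where
  decay : A + 12 * (k + M + 7) + 5 ≤ N
  gradient : N + M + k + 7 ≤ m
  accumulation : 2 * (m + b) + k + 8 ≤ s
  laplacian : s + 4 * N + M + 1 ≤ 4 * m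

/-- The conditions at the grid point `q` of level `m` on the integers `t` and `r`, which make
`t q / 2 ^ s` and `r q / 2 ^ k` approximate the solution of the Dirichlet problem, where
`γ c / 2 ^ s` approximates the boundary values in the squares `c` of the list `L` of level `n`, and
`L'` is the list of squares of level `N`. -/
structure IsCertificateAt (k n A N m s : ℕ) (L L' : List (ℤ × ℤ)) (γ t r : ℤ × ℤ → ℤ)
    (q : ℤ × ℤ) : Prop where
  rounding : |2 * (r q * 2 ^ (s - k) - t q)| ≤ 2 ^ (s - k)
  near : CloseTo N m L' q → ∀ c ∈ L, GridNear n c (1 / 2 ^ A) (dyadicPoint m q) →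
    |t q - γ c| ≤ 2 ^ (s - (k + 3))
  far : ¬ CloseTo N m L' q → |discreteLaplacian t q| ≤ 16

theorem abs_two_mul_sub_le_iff {k s : ℕ} {r t : ℤ} (h : k ≤ s) :
    |2 * (r * 2 ^ (s - k) - t)| ≤ 2 ^ (s - k) ↔
      |(t : ℝ) / 2 ^ s - r / 2 ^ k| ≤ 1 / 2 ^ (k + 1) := by
  have heq : ((2 * (r * 2 ^ (s - k) - t) : ℤ) : ℝ) / 2 ^ s = 2 * (r / 2 ^ k - t / 2 ^ s) := by
    rw [← pow_sub_mul_pow 2 h]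
    push_cast
    field_simp
  rw [abs_le_two_pow_sub_iff h, heq, abs_mul, abs_two, abs_sub_comm]
  have hk : (1 : ℝ) / 2 ^ (k + 1) = 1 / 2 ^ k / 2 := by ring
  constructor <;> intro hle <;> linarith

theorem discreteLaplacian_intCast_div (t : ℤ × ℤ → ℤ) (x : ℝ) (q : ℤ × ℤ) :
    discreteLaplacian (fun q => (t q : ℝ) / x) q = (discreteLaplacian t q : ℤ) / x := by
  simp only [discreteLaplacian]
  push_cast
  ring

section Certificates

variable {K U : Set ℂ} {φ u : ℂ → ℝ} {b M A₀ A n k s N m : ℕ} {C : ℕ → List (ℤ × ℤ)}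
  {γ t r : ℤ × ℤ → ℤ} {ψ : ℤ × ℤ → ℝ} {ε η : ℝ} {q : ℤ × ℤ}

namespace AreFineScales

theorem lt (h : AreFineScales b M k A N m s) : N < m := by
  linarith [h.gradient]

theorem add_eight_le (h : AreFineScales b M k A N m s) : k + 8 ≤ s := by
  linarith [h.accumulation]

theorem laplacian_error_le (h : AreFineScales b M k A N m s) :
    16 * ((2 : ℝ) ^ N / 2 ^ m) ^ 4 * 2 ^ M ≤ 8 / 2 ^ s :=
  calc 16 * ((2 : ℝ) ^ N / 2 ^ m) ^ 4 * 2 ^ M = 8 * (2 ^ (4 * N + M + 1) / 2 ^ (4 * m)) := by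
        ring
    _ ≤ 8 * (1 / 2 ^ s) := by
        have := h.laplacian
        gcongr ?_ * ?_
        exact two_pow_div_two_pow_le (by omega)
    _ = 8 / 2 ^ s := by ring

theorem gradient_error_le (h : AreFineScales b M k A N m s) :
    4 * ((2 : ℝ) ^ N / 2 ^ m) * 2 ^ M ≤ 1 / 2 ^ k / 32 :=
  calc 4 * ((2 : ℝ) ^ N / 2 ^ m) * 2 ^ M = 2 ^ (N + M + 2) / 2 ^ m := by ring
    _ ≤ 1 / 2 ^ (k + 5) := two_pow_div_two_pow_le (by linarith [h.gradient])
    _ = 1 / 2 ^ k / 32 := by ring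

theorem accumulation_error_le (h : AreFineScales b M k A N m s) :
    24 / 2 ^ s * (4 : ℝ) ^ (m + b) ≤ 1 / 2 ^ k * (3 / 32) :=
  calc 24 / 2 ^ s * (4 : ℝ) ^ (m + b) = 24 * (2 ^ (2 * (m + b)) / 2 ^ s) := by
        rw [pow_mul]
        ring
    _ ≤ 24 * (1 / 2 ^ (k + 8)) := by
        have := h.accumulation
        gcongr ?_ * ?_
        exact two_pow_div_two_pow_le (by omega)
    _ = 1 / 2 ^ k * (3 / 32) := by ring

end AreFineScales

theorem decay_error_le (k M : ℕ) :
    (3 / 4 : ℝ) ^ (3 * (k + M + 7)) * (2 * 2 ^ M) ≤ 1 / 2 ^ k / 64 :=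
  calc (3 / 4 : ℝ) ^ (3 * (k + M + 7)) * (2 * 2 ^ M) ≤ 1 / 2 ^ (k + M + 7) * (2 * 2 ^ M) := by
        gcongr
        exact three_quarters_pow_le _
    _ = 1 / 2 ^ k / 64 := by
        rw [pow_add, pow_add]
        field_simp
        norm_num

theorem IsTwoSidedSolution.abs_sub_le_of_isCertificateAt_of_closeTo
    (h : IsTwoSidedSolution K φ u b M A₀) (hC : IsComputableApproximation K C) (hA : A₀ ≤ A)
    (hscales : AreFineScales b M k A N m s)
    (hγ : ∀ c ∈ C n, ∀ y ∈ K ∩ gridSquare n c, |(γ c : ℝ) / 2 ^ s - φ y| ≤ 1 / 2 ^ (k + 4))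
    (hcert : IsCertificateAt k n A N m s (C n) (C N) γ t r q) (hcl : CloseTo N m (C N) q) {z : ℂ}
    (hz : dist z (dyadicPoint m q) ≤ 1 / 2 ^ N) :
    |u z - (t q : ℝ) / 2 ^ s| ≤ 1 / 2 ^ k / 4 := by
  have hsk : k + 3 ≤ s := by linarith [hscales.add_eight_le]
  have hle := h.abs_sub_le_of_closeTo hC hA hγ (t := (t q : ℝ) / 2 ^ s) (η := 1 / 2 ^ (k + 3))
    (j := 3 * (k + M + 7)) (by linarith [hscales.decay]) hcl (fun c hc hqc => ?_) hz
  · have hk3 : (1 : ℝ) / 2 ^ (k + 3) = 1 / 2 ^ k / 8 := by ring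
    have hk4 : (1 : ℝ) / 2 ^ (k + 4) = 1 / 2 ^ k / 16 := by ring
    have hk : (0 : ℝ) < 1 / 2 ^ k := by positivity
    linarith [decay_error_le k M]
  · rw [← sub_div]
    exact_mod_cast (abs_le_two_pow_sub_iff hsk).1 (hcert.near hcl c hc hqc)

theorem IsTwoSidedSolution.abs_sub_le_of_isCertificateAt
    (h : IsTwoSidedSolution (frontier U) φ u b M A₀) (hUo : IsOpen U)
    (hC : IsComputableApproximation (frontier U) C) (hU : closure U ⊆ closedBall 0 (2 ^ b - 1))
    (hA : A₀ ≤ A) (hscales : AreFineScales b M k A N m s)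
    (hγ : ∀ c ∈ C n, ∀ y ∈ frontier U ∩ gridSquare n c,
      |(γ c : ℝ) / 2 ^ s - φ y| ≤ 1 / 2 ^ (k + 4))
    (hcert : ∀ q, InBox b m q → IsCertificateAt k n A N m s (C n) (C N) γ t r q)
    {z : ℂ} (hz : z ∈ closure U) (hq : dist z (dyadicPoint m q) ≤ 1 / 2 ^ m) :
    |u z - (r q : ℝ) / 2 ^ k| ≤ 1 / 2 ^ k := by
  have hfar : ∀ p, InBox b m p → ¬ CloseTo N m (C N) p →
      |discreteLaplacian (fun q => (t q : ℝ) / 2 ^ s) p| ≤ 16 / 2 ^ s := fun p hp hcl => by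
    rw [discreteLaplacian_intCast_div, abs_div, abs_pow, abs_two]
    gcongr
    exact_mod_cast (hcert p hp).far hcl
  have hut := h.abs_sub_le_of_dist_le hUo hC hU hscales.lt (w := fun q => (t q : ℝ) / 2 ^ s)
    (fun p hp hcl y hy => h.abs_sub_le_of_isCertificateAt_of_closeTo hC hA hscales hγ
      (hcert p hp) hcl hy) hfar (κ' := 24 / 2 ^ s) (by positivity)
    ((add_le_add_left hscales.laplacian_error_le _).trans_eq (by ring)) hz hq
  have htr := (abs_two_mul_sub_le_iff (by linarith [hscales.add_eight_le])).1
    (hcert q (inBox_of_dist_le (hU hz) hq)).rounding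
  have hk1 : (1 : ℝ) / 2 ^ (k + 1) = 1 / 2 ^ k / 2 := by ring
  have hk : (0 : ℝ) < 1 / 2 ^ k := by positivity
  calc |u z - (r q : ℝ) / 2 ^ k|
      ≤ |u z - (t q : ℝ) / 2 ^ s| + |(t q : ℝ) / 2 ^ s - r q / 2 ^ k| := _root_.abs_sub_le _ _ _
    _ ≤ 1 / 2 ^ k := by
      linarith [hscales.gradient_error_le, hscales.accumulation_error_le]

theorem isCompact_gridSquare (n : ℕ) (c : ℤ × ℤ) : IsCompact (gridSquare n c) :=
  (isCompact_Icc.reProdIm isCompact_Icc).of_isClosed_subset (isClosed_gridSquare n c)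
    fun _ hz => ⟨⟨hz.1, hz.2.1⟩, hz.2.2⟩

theorem IsTwoSidedSolution.exists_forall_gridNear_of_square (h : IsTwoSidedSolution K φ u b M A₀)
    {c : ℤ × ℤ} {x : ℝ} (hx : ∀ y ∈ K ∩ gridSquare n c, |x - φ y| ≤ ε) (hη : 0 < η) :
    ∃ A₁ : ℕ, ∀ A, A₁ ≤ A → ∀ z ∈ closedBall (0 : ℂ) (2 ^ (b + 2)),
      (∃ a ∈ K, dist z a ≤ 1 / 2 ^ A) → GridNear n c (1 / 2 ^ A) z → |u z - x| ≤ ε + η := by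
  set S : Set ℂ := closedBall 0 (2 ^ (b + 2)) ∩ (fun z => |u z - x|) ⁻¹' Ici (ε + η)
  have hS : IsCompact S := (isCompact_closedBall _ _).of_isClosed_subset
    ((h.continuousOn.sub continuousOn_const).abs.preimage_isClosed_of_isClosed
      isClosed_closedBall isClosed_Ici) inter_subset_left
  have hpos : ∀ p ∈ S ×ˢ K ×ˢ gridSquare n c, 0 < dist p.1 p.2.1 + dist p.1 p.2.2 := by
    rintro ⟨z, a, y⟩ ⟨hzS, ha, hy⟩
    by_contra! hle
    obtain rfl : z = a := dist_le_zero.1 (by linarith [dist_nonneg (x := z) (y := y)])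
    obtain rfl : z = y := dist_le_zero.1 (by linarith [dist_nonneg (x := z) (y := z)])
    have hzx : ε + η ≤ |u z - x| := hzS.2
    rw [h.boundary z ha, abs_sub_comm] at hzx
    linarith [hx z ⟨ha, hy⟩]
  obtain ⟨δ, hδ, hle⟩ := (hS.prod (h.isCompact.prod (isCompact_gridSquare n c))).exists_forall_le'
    (by fun_prop) hpos
  obtain ⟨A₁, hA₁⟩ := exists_div_two_pow_lt 3 hδ
  refine ⟨A₁, fun A hA z hz ⟨a, ha, hza⟩ hzc => ?_⟩
  by_contra! hlt
  obtain ⟨y, hy, hzy⟩ := hzc.exists_dist_le (by positivity)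
  have hδA : δ ≤ 3 / 2 ^ A₁ :=
    calc δ ≤ dist z a + dist z y := hle (z, a, y) ⟨⟨hz, hlt.le⟩, ha, hy⟩
      _ ≤ 1 / 2 ^ A + 2 * (1 / 2 ^ A) := add_le_add hza hzy
      _ = 3 / 2 ^ A := by ring
      _ ≤ 3 / 2 ^ A₁ := by gcongr; exact one_le_two
  exact hδA.not_gt hA₁

theorem IsTwoSidedSolution.exists_forall_gridNear (h : IsTwoSidedSolution K φ u b M A₀)
    {L : List (ℤ × ℤ)} (hψ : ∀ c ∈ L, ∀ y ∈ K ∩ gridSquare n c, |ψ c - φ y| ≤ ε) (hη : 0 < η) :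
    ∃ A₁ : ℕ, ∀ A, A₁ ≤ A → ∀ c ∈ L, ∀ z ∈ closedBall (0 : ℂ) (2 ^ (b + 2)),
      (∃ a ∈ K, dist z a ≤ 1 / 2 ^ A) → GridNear n c (1 / 2 ^ A) z → |u z - ψ c| ≤ ε + η := by
  choose! f hf using fun c hc => h.exists_forall_gridNear_of_square (hψ c hc) hη
  refine ⟨(L.map f).sum, fun A hA c hc => hf c hc A (le_trans ?_ hA)⟩
  exact List.single_le_sum (fun _ _ => Nat.zero_le _) _ (List.mem_map_of_mem hc)

theorem abs_sub_round_mul_div_le (x : ℝ) (s : ℕ) :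
    |x - (round (x * 2 ^ s) : ℝ) / 2 ^ s| ≤ 1 / 2 / 2 ^ s := by
  have heq : x - round (x * 2 ^ s) / 2 ^ s = (x * 2 ^ s - round (x * 2 ^ s)) / 2 ^ s := by
    field_simp
  rw [heq, abs_div, abs_pow, abs_two]
  gcongr
  exact abs_sub_round _

theorem abs_round_sub_le_of_closeTo
    (hC : IsComputableApproximation K C) (hscales : AreFineScales b M k A N m s) {c : ℤ × ℤ}
    (hnear : ∀ z ∈ closedBall (0 : ℂ) (2 ^ (b + 2)), (∃ a ∈ K, dist z a ≤ 1 / 2 ^ A) →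
      GridNear n c (1 / 2 ^ A) z → |u z - (γ c : ℝ) / 2 ^ s| ≤ 1 / 2 ^ (k + 4))
    (hq : InBox b m q) (hcl : CloseTo N m (C N) q)
    (hqc : GridNear n c (1 / 2 ^ A) (dyadicPoint m q)) :
    |round (u (dyadicPoint m q) * 2 ^ s) - γ c| ≤ 2 ^ (s - (k + 3)) := by
  obtain ⟨a, ha, hqa⟩ := hcl.exists_dist_le hC
  have hqaA : dist (dyadicPoint m q) a ≤ 1 / 2 ^ A :=
    calc dist (dyadicPoint m q) a ≤ 6 / 2 ^ N := hqa
      _ ≤ 2 ^ 3 / 2 ^ N := by gcongr; norm_num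
      _ ≤ 1 / 2 ^ A := two_pow_div_two_pow_le (by linarith [hscales.decay])
  have hu := hnear _ (ball_subset_closedBall
    (hq.closedBall_subset (N := 0) (mem_closedBall_self (by positivity)))) ⟨a, ha, hqaA⟩ hqc
  have hs : (1 : ℝ) / 2 / 2 ^ s ≤ 1 / 2 ^ (k + 4) :=
    calc (1 : ℝ) / 2 / 2 ^ s ≤ 1 / 2 ^ s := by gcongr; norm_num
      _ ≤ 1 / 2 ^ (k + 4) :=
        one_div_pow_le_one_div_pow_of_le one_le_two (by linarith [hscales.add_eight_le])
  have hround := abs_sub_round_mul_div_le (u (dyadicPoint m q)) s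
  have hk : (1 : ℝ) / 2 ^ (k + 3) = 2 * (1 / 2 ^ (k + 4)) := by rw [pow_succ _ (k + 3)]; field_simp
  rw [abs_le_two_pow_sub_iff (by linarith [hscales.add_eight_le])]
  push_cast
  rw [sub_div, hk]
  rw [abs_le] at hu hround ⊢
  constructor <;> linarith

theorem IsTwoSidedSolution.abs_discreteLaplacian_round_le (h : IsTwoSidedSolution K φ u b M A₀)
    (hC : IsComputableApproximation K C) (hscales : AreFineScales b M k A N m s)
    (hq : InBox b m q) (hfar : ¬ CloseTo N m (C N) q) :
    |discreteLaplacian (fun p => round (u (dyadicPoint m p) * 2 ^ s)) q| ≤ 16 := by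
  set v := u ∘ dyadicPoint m
  set w : ℤ × ℤ → ℝ := fun p => (round (v p * 2 ^ s) : ℝ) / 2 ^ s
  have hsp : (0 : ℝ) < 2 ^ s := by positivity
  have hv : |discreteLaplacian v q| ≤ 8 / 2 ^ s :=
    (h.abs_discreteLaplacian_le hC hq hfar hscales.lt).trans hscales.laplacian_error_le
  have hvw : |discreteLaplacian (v - w) q| ≤ 8 * (1 / 2 / 2 ^ s) :=
    _root_.abs_discreteLaplacian_le (fun p => abs_sub_round_mul_div_le (v p) s) q
  have hw : |discreteLaplacian w q| ≤ 16 / 2 ^ s :=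
    calc |discreteLaplacian w q| ≤ |discreteLaplacian v q| + |discreteLaplacian (v - w) q| := by
          rw [discreteLaplacian_sub]
          grind
      _ ≤ 8 / 2 ^ s + 8 * (1 / 2 / 2 ^ s) := add_le_add hv hvw
      _ ≤ 16 / 2 ^ s := by
          rw [← mul_div_assoc, ← add_div]
          gcongr
          norm_num
  rw [discreteLaplacian_intCast_div, abs_div, abs_pow, abs_two, div_le_div_iff_of_pos_right hsp]
    at hw
  exact_mod_cast hw

theorem IsTwoSidedSolution.exists_isCertificateAt (h : IsTwoSidedSolution K φ u b M A₀)
    (hC : IsComputableApproximation K C) (hscales : AreFineScales b M k A N m s)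
    (hnear : ∀ c ∈ C n, ∀ z ∈ closedBall (0 : ℂ) (2 ^ (b + 2)), (∃ a ∈ K, dist z a ≤ 1 / 2 ^ A) →
      GridNear n c (1 / 2 ^ A) z → |u z - (γ c : ℝ) / 2 ^ s| ≤ 1 / 2 ^ (k + 4)) :
    ∃ t r : ℤ × ℤ → ℤ, ∀ q, InBox b m q → IsCertificateAt k n A N m s (C n) (C N) γ t r q := by
  set t : ℤ × ℤ → ℤ := fun q => round (u (dyadicPoint m q) * 2 ^ s)
  refine ⟨t, fun q => round ((t q : ℝ) / 2 ^ s * 2 ^ k), fun q hq => ⟨?_, fun hcl c hc hqc =>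
    abs_round_sub_le_of_closeTo hC hscales (hnear c hc) hq hcl hqc, fun hfar =>
    h.abs_discreteLaplacian_round_le hC hscales hq hfar⟩⟩
  rw [abs_two_mul_sub_le_iff (by linarith [hscales.add_eight_le])]
  exact (abs_sub_round_mul_div_le _ k).trans_eq (by rw [pow_succ', div_div])

end Certificates

/-! ## The algorithm -/

/-- The test of `GridNear n c (1 / 2 ^ A) (dyadicPoint m q)` by integer arithmetic, for `n ≤ m` and
`A ≤ m`. -/
def gridNearTest (n A m : ℕ) (c q : ℤ × ℤ) : Bool :=
  (decide (c.1 * 2 ^ (m - n) ≤ q.1 + 2 ^ (m - A)) &&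
      decide (q.1 ≤ (c.1 + 1) * 2 ^ (m - n) + 2 ^ (m - A))) &&
    (decide (c.2 * 2 ^ (m - n) ≤ q.2 + 2 ^ (m - A)) &&
      decide (q.2 ≤ (c.2 + 1) * 2 ^ (m - n) + 2 ^ (m - A)))

theorem gridNearTest_iff {n A m : ℕ} (hn : n ≤ m) (hA : A ≤ m) {c q : ℤ × ℤ} :
    gridNearTest n A m c q = true ↔ GridNear n c (1 / 2 ^ A) (dyadicPoint m q) := by
  have hdiv : ∀ (j : ℕ) (y : ℝ), j ≤ m → y / 2 ^ j = y * 2 ^ (m - j) / 2 ^ m := fun j y hj => by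
    rw [← pow_sub_mul_pow 2 hj]
    field_simp
  simp only [gridNearTest, Bool.and_eq_true, decide_eq_true_eq, GridNear, dyadicPoint, hdiv n _ hn,
    hdiv A _ hA, one_mul, ← add_div,
    div_le_div_iff_of_pos_right (show (0 : ℝ) < 2 ^ m by positivity)]
  exact_mod_cast Iff.rfl

/-- The entry of index `q` of a finite table `T` of pairs of integers, with the default entry
`(0, 0)`. A table is the part of a certificate that is searched for: its entries are the pairs of
integers `t q` and `r q` of `IsCertificateAt`. -/
def tableEntry (T : List (ℤ × ℤ)) (q : ℤ × ℤ) : ℤ × ℤ := T.getD (Encodable.encode q) (0, 0)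

theorem exists_tableEntry_eq {S : Set (ℤ × ℤ)} (hS : S.Finite) (f : ℤ × ℤ → ℤ × ℤ) :
    ∃ T, ∀ q ∈ S, tableEntry T q = f q := by
  obtain ⟨B, hB⟩ := (hS.image Encodable.encode).bddAbove
  refine ⟨(List.range (B + 1)).map fun i => ((Encodable.decode i).map f).getD (0, 0),
    fun q hq => ?_⟩
  have hlt : Encodable.encode q < B + 1 := Nat.lt_succ_of_le (hB (mem_image_of_mem _ hq))
  simp only [tableEntry, List.getD_eq_getElem?_getD, List.getElem?_map, List.getElem?_range hlt,
    Option.map_some, Encodable.encodek, Option.getD_some]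

/-- The list of the pairs of integers of absolute value at most `R`. -/
def gridBox (R : ℕ) : List (ℤ × ℤ) :=
  (List.range (2 * R + 1)).flatMap fun i : ℕ => (List.range (2 * R + 1)).map fun l : ℕ =>
    ((i : ℤ) - R, (l : ℤ) - R)

theorem mem_gridBox {R : ℕ} {q : ℤ × ℤ} : q ∈ gridBox R ↔ |q.1| ≤ R ∧ |q.2| ≤ R := by
  simp only [gridBox, List.mem_flatMap, List.mem_range, List.mem_map, abs_le, Prod.ext_iff]
  constructor
  · rintro ⟨i, hi, l, hl, hx, hy⟩
    omega
  · rintro ⟨hx, hy⟩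
    exact ⟨(q.1 + R).toNat, by omega, (q.2 + R).toNat, by omega, by omega, by omega⟩

theorem mem_gridBox_two_pow {b m : ℕ} {q : ℤ × ℤ} : q ∈ gridBox (2 ^ (b + m)) ↔ InBox b m q := by
  rw [mem_gridBox, InBox]
  push_cast
  exact Iff.rfl

/-- The test of the conditions `IsCertificateAt` on the entries of the table `T`. -/
def certificateTest (k n A N m s : ℕ) (L L' : List (ℤ × ℤ)) (γ : ℤ × ℤ → ℤ) (T : List (ℤ × ℤ))
    (q : ℤ × ℤ) : Bool :=
  decide (|2 * ((tableEntry T q).2 * 2 ^ (s - k) - (tableEntry T q).1)| ≤ 2 ^ (s - k)) &&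
    bif L'.any fun c => gridNearTest N N m c q then
      L.all fun c => !gridNearTest n A m c q ||
        decide (|(tableEntry T q).1 - γ c| ≤ 2 ^ (s - (k + 3)))
    else decide (|discreteLaplacian (fun p => (tableEntry T p).1) q| ≤ 16)

theorem certificateTest_iff {k n A N m s : ℕ} {L L' : List (ℤ × ℤ)} {γ : ℤ × ℤ → ℤ}
    {T : List (ℤ × ℤ)} {q : ℤ × ℤ} (hn : n ≤ m) (hA : A ≤ m) (hN : N ≤ m) :
    certificateTest k n A N m s L L' γ T q = true ↔ IsCertificateAt k n A N m s L L' γ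
      (fun p => (tableEntry T p).1) (fun p => (tableEntry T p).2) q := by
  have hclose : (L'.any fun c => gridNearTest N N m c q) = true ↔ CloseTo N m L' q := by
    simp only [List.any_eq_true, gridNearTest_iff hN hN, CloseTo]
  have hnear : (L.all fun c => !gridNearTest n A m c q ||
      decide (|(tableEntry T q).1 - γ c| ≤ 2 ^ (s - (k + 3)))) = true ↔
      ∀ c ∈ L, GridNear n c (1 / 2 ^ A) (dyadicPoint m q) →
        |(tableEntry T q).1 - γ c| ≤ 2 ^ (s - (k + 3)) := by
    simp only [List.all_eq_true, Bool.or_eq_true, Bool.not_eq_true', decide_eq_true_eq,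
      ← gridNearTest_iff hn hA, ← Bool.not_eq_true, imp_iff_not_or]
  rw [certificateTest, Bool.and_eq_true, decide_eq_true_eq]
  by_cases h : CloseTo N m L' q
  · rw [hclose.2 h, cond_true, hnear]
    exact ⟨fun ⟨hr, hL⟩ => ⟨hr, fun _ => hL, absurd h⟩, fun hcert => ⟨hcert.1, hcert.near h⟩⟩
  · rw [Bool.eq_false_iff.2 (mt hclose.1 h), cond_false, decide_eq_true_eq]
    exact ⟨fun ⟨hr, hΔ⟩ => ⟨hr, (absurd · h), fun _ => hΔ⟩, fun hcert => ⟨hcert.1, hcert.far h⟩⟩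

theorem IsCertificateAt.congr {k n A N m s : ℕ} {L L' : List (ℤ × ℤ)} {γ t r t' r' : ℤ × ℤ → ℤ}
    {q : ℤ × ℤ} (h : IsCertificateAt k n A N m s L L' γ t r q) (ht : t' q = t q)
    (hadj : ∀ p, GridAdjacent q p → t' p = t p) (hr : r' q = r q) :
    IsCertificateAt k n A N m s L L' γ t' r' q where
  rounding := by rw [hr, ht]; exact h.rounding
  near := by rw [ht]; exact h.near
  far := by rw [discreteLaplacian_congr ht hadj]; exact h.far

section Computability

variable {α : Type*} [Primcodable α]

theorem computable_int_add {x y : α → ℤ} (hx : Computable x) (hy : Computable y) :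
    Computable fun a => x a + y a :=
  primrec₂_int_add.to_comp.comp hx hy

theorem computable_int_sub {x y : α → ℤ} (hx : Computable x) (hy : Computable y) :
    Computable fun a => x a - y a :=
  primrec₂_int_sub.to_comp.comp hx hy

theorem computable_int_mul {x y : α → ℤ} (hx : Computable x) (hy : Computable y) :
    Computable fun a => x a * y a :=
  primrec₂_int_mul.to_comp.comp hx hy

theorem computable_int_le {x y : α → ℤ} (hx : Computable x) (hy : Computable y) :
    Computable fun a => decide (x a ≤ y a) :=
  primrec₂_int_le.to_comp.comp hx hy

theorem computable_int_abs_le {x y : α → ℤ} (hx : Computable x) (hy : Computable y) :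
    Computable fun a => decide (|x a| ≤ y a) :=
  (Primrec.and.to_comp.comp (computable_int_le hx hy)
    (computable_int_le (primrec_int_neg.to_comp.comp hx) hy)).of_eq fun a => by
      rw [← Bool.decide_and]
      exact decide_eq_decide.2 abs_le'.symm

theorem computable_two_pow_sub {i j : α → ℕ} (hi : Computable i) (hj : Computable j) :
    Computable fun a => (2 : ℤ) ^ (i a - j a) :=
  primrec_int_two_pow.to_comp.comp (Primrec.nat_sub.to_comp.comp hi hj)

theorem computable_gridNearTest {n A m : α → ℕ} {c q : α → ℤ × ℤ} (hn : Computable n)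
    (hA : Computable A) (hm : Computable m) (hc : Computable c) (hq : Computable q) :
    Computable fun a => gridNearTest (n a) (A a) (m a) (c a) (q a) := by
  have hside := computable_two_pow_sub hm hn
  have hmargin := computable_two_pow_sub hm hA
  have coordinate : ∀ i x : α → ℤ, Computable i → Computable x → Computable fun a =>
      decide (i a * 2 ^ (m a - n a) ≤ x a + 2 ^ (m a - A a)) &&
        decide (x a ≤ (i a + 1) * 2 ^ (m a - n a) + 2 ^ (m a - A a)) := fun i x hi hx =>
    Primrec.and.to_comp.comp
      (computable_int_le (computable_int_mul hi hside) (computable_int_add hx hmargin))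
      (computable_int_le hx (computable_int_add
        (computable_int_mul (computable_int_add hi (.const 1)) hside) hmargin))
  exact Primrec.and.to_comp.comp
    (coordinate _ _ (Computable.fst.comp hc) (Computable.fst.comp hq))
    (coordinate _ _ (Computable.snd.comp hc) (Computable.snd.comp hq))

theorem computable_tableEntry {T : α → List (ℤ × ℤ)} {q : α → ℤ × ℤ} (hT : Computable T)
    (hq : Computable q) : Computable fun a => tableEntry (T a) (q a) :=
  (Primrec.list_getD (0, 0)).to_comp.comp hT (Computable.encode.comp hq)

theorem primrec_gridBox : Primrec gridBox := by
  have hrange : Primrec fun R : ℕ => List.range (2 * R + 1) :=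
    Primrec.list_range.comp (Primrec.succ.comp (Primrec.nat_mul.comp (.const 2) .id))
  refine Primrec.list_flatMap hrange (Primrec.list_map (hrange.comp .fst) ?_)
  exact Primrec.pair (primrec₂_nat_sub_int.comp (Primrec.snd.comp .fst) (Primrec.fst.comp .fst))
    (primrec₂_nat_sub_int.comp .snd (Primrec.fst.comp .fst))

theorem computable_discreteLaplacian {t : α → ℤ × ℤ → ℤ} {q : α → ℤ × ℤ} (ht : Computable₂ t)
    (hq : Computable q) : Computable fun a => discreteLaplacian (t a) (q a) := by
  have hvalue : ∀ x y : α → ℤ, Computable x → Computable y → Computable fun a => t a (x a, y a) :=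
    fun x y hx hy => ht.comp .id (hx.pair hy)
  have hx : Computable fun a => (q a).1 := Computable.fst.comp hq
  have hy : Computable fun a => (q a).2 := Computable.snd.comp hq
  have hone : Computable fun _ : α => (1 : ℤ) := .const 1
  have hright := hvalue _ _ (computable_int_add hx hone) hy
  have hleft := hvalue _ _ (computable_int_sub hx hone) hy
  have hup := hvalue _ _ hx (computable_int_add hy hone)
  have hdown := hvalue _ _ hx (computable_int_sub hy hone)
  exact computable_int_sub
    (computable_int_add (computable_int_add (computable_int_add hright hleft) hup) hdown)
    (computable_int_mul (.const 4) (ht.comp .id hq))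

theorem computable_certificateTest {k n A N m s : α → ℕ} {L L' T : α → List (ℤ × ℤ)}
    {γ : α → ℤ × ℤ → ℤ} {q : α → ℤ × ℤ} (hk : Computable k) (hn : Computable n) (hA : Computable A)
    (hN : Computable N) (hm : Computable m) (hs : Computable s) (hL : Computable L)
    (hL' : Computable L') (hγ : Computable₂ γ) (hT : Computable T) (hq : Computable q) :
    Computable fun a => certificateTest (k a) (n a) (A a) (N a) (m a) (s a) (L a) (L' a) (γ a) (T a)
      (q a) := by
  have ht : Computable fun a => (tableEntry (T a) (q a)).1 :=
    Computable.fst.comp (computable_tableEntry hT hq)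
  have hr : Computable fun a => (tableEntry (T a) (q a)).2 :=
    Computable.snd.comp (computable_tableEntry hT hq)
  have hsk := computable_two_pow_sub hs hk
  have hrounding := computable_int_abs_le
    (computable_int_mul (.const 2) (computable_int_sub (computable_int_mul hr hsk) ht)) hsk
  have hclose : Computable fun a => (L' a).any fun c => gridNearTest (N a) (N a) (m a) c (q a) :=
    computable_list_any hL' (computable_gridNearTest (hN.comp .fst) (hN.comp .fst) (hm.comp .fst)
      .snd (hq.comp .fst))
  have hgap : Computable fun a => (2 : ℤ) ^ (s a - (k a + 3)) :=
    computable_two_pow_sub hs (Primrec.nat_add.to_comp.comp hk (.const 3))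
  have hnear : Computable fun a => (L a).all fun c => !gridNearTest (n a) (A a) (m a) c (q a) ||
      decide (|(tableEntry (T a) (q a)).1 - γ a c| ≤ 2 ^ (s a - (k a + 3))) :=
    computable_list_all hL (Primrec.or.to_comp.comp
      (Primrec.not.to_comp.comp (computable_gridNearTest (hn.comp .fst) (hA.comp .fst)
        (hm.comp .fst) .snd (hq.comp .fst)))
      (computable_int_abs_le (computable_int_sub (ht.comp .fst) hγ) (hgap.comp .fst)))
  have htable : Computable₂ fun a p => (tableEntry (T a) p).1 :=
    Computable.fst.comp (computable_tableEntry (hT.comp .fst) .snd)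
  have hfar := computable_int_abs_le (computable_discreteLaplacian htable hq) (.const 16)
  exact Primrec.and.to_comp.comp hrounding (Computable.cond hclose hnear hfar)

theorem exists_computable_areFineScales (b M : ℕ) :
    ∃ N m s : ℕ → ℕ → ℕ, Computable₂ N ∧ Computable₂ m ∧ Computable₂ s ∧
      ∀ k A, AreFineScales b M k A (N k A) (m k A) (s k A) := by
  set N : ℕ → ℕ → ℕ := fun k A => A + 12 * (k + M + 7) + 5
  set m : ℕ → ℕ → ℕ := fun k A => 2 * N k A + M + b + k + 9
  set s : ℕ → ℕ → ℕ := fun k A => 2 * (m k A + b) + k + 8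
  have hadd {α : Type} [Primcodable α] {i j : α → ℕ} (hi : Primrec i) (hj : Primrec j) :
      Primrec fun a => i a + j a := Primrec.nat_add.comp hi hj
  have hmul {α : Type} [Primcodable α] (c : ℕ) {j : α → ℕ} (hj : Primrec j) :
      Primrec fun a => c * j a := Primrec.nat_mul.comp (.const c) hj
  have hN : Primrec₂ N :=
    hadd (hadd .snd (hmul 12 (hadd (hadd .fst (.const M)) (.const 7)))) (.const 5)
  have hm : Primrec₂ m :=
    hadd (hadd (hadd (hadd (hmul 2 hN) (.const M)) (.const b)) .fst) (.const 9)
  have hs : Primrec₂ s := hadd (hadd (hmul 2 (hadd hm (.const b))) .fst) (.const 8)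
  refine ⟨N, m, s, hN.to_comp, hm.to_comp, hs.to_comp, fun k A => ⟨le_rfl, ?_, le_rfl, ?_⟩⟩ <;>
    grind

end Computability

theorem isComputableOn_of_forall_dist_le {u : ℂ → ℝ} {S : Set ℂ} {m : ℕ → ℕ} {r : ℕ → ℤ × ℤ → ℤ}
    (hm : Computable m) (hr : Computable₂ r)
    (h : ∀ k, ∀ z ∈ S, ∀ q, dist z (dyadicPoint (m k) q) ≤ 1 / 2 ^ m k →
      |u z - (r k q : ℝ) / 2 ^ k| ≤ 1 / 2 ^ k) : IsComputableOn u S := by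
  refine ⟨fun L k => L[m k]?.map (r k), ?_, fun z hz a ha k => ?_⟩
  · exact Computable.option_map (Computable.list_getElem?.comp .fst (hm.comp .snd))
      (hr.comp (Computable.snd.comp .fst) .snd)
  · have hget : ∀ l, ((List.range l).map a)[m k]? = if m k < l then some (a (m k)) else none :=
      fun l => by
        split_ifs with hl
        · rw [List.getElem?_map, List.getElem?_range hl, Option.map_some]
        · exact List.getElem?_eq_none (by simpa using hl)
    simp only [hget]
    refine ⟨⟨m k + 1, r k (a (m k)), by simp⟩, fun l x hx => ?_⟩
    obtain ⟨-, rfl⟩ : m k < l ∧ r k (a (m k)) = x := by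
      split_ifs at hx <;> simp_all
    exact h k z hz _ (ha _)

theorem abs_sub_div_two_pow_le {k s : ℕ} {x y : ℝ} {g : ℤ} (hs : k + 8 ≤ s)
    (hx : |x - g / 2 ^ s| ≤ 1 / 2 ^ s) (hy : |y - x| ≤ 1 / 2 ^ (k + 5) + 1 / 2 ^ (k + 6)) :
    |y - g / 2 ^ s| ≤ 1 / 2 ^ (k + 4) := by
  have hsk : (1 : ℝ) / 2 ^ s ≤ 1 / 2 ^ (k + 6) :=
    one_div_pow_le_one_div_pow_of_le one_le_two (by omega)
  calc |y - g / 2 ^ s| ≤ |y - x| + |x - g / 2 ^ s| := abs_sub_le _ _ _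
    _ ≤ 1 / 2 ^ (k + 5) + 1 / 2 ^ (k + 6) + 1 / 2 ^ (k + 6) := add_le_add hy (hx.trans hsk)
    _ = 1 / 2 ^ (k + 4) := by ring

section Main

variable {U : Set ℂ} {φ u : ℂ → ℝ} {C : ℕ → List (ℤ × ℤ)} {b M A₀ : ℕ}

theorem IsTwoSidedSolution.exists_isCertificateAt_tableEntry {K : Set ℂ} {n k : ℕ}
    {γ : ℕ → ℤ × ℤ → ℤ} {ψ : ℤ × ℤ → ℝ} {N m s : ℕ → ℕ} (h : IsTwoSidedSolution K φ u b M A₀)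
    (hC : IsComputableApproximation K C)
    (hscales : ∀ A, AreFineScales b M k A (N A) (m A) (s A))
    (hψ : ∀ c ∈ C n, ∀ y ∈ K ∩ gridSquare n c, |ψ c - φ y| ≤ 1 / 2 ^ (k + 5))
    (hγ : ∀ c ∈ C n, ∀ j, |ψ c - (γ j c : ℝ) / 2 ^ j| ≤ 1 / 2 ^ j) :
    ∃ A₁, ∀ A, A₁ ≤ A → ∃ T, ∀ q, InBox b (m A) q → IsCertificateAt k n A (N A) (m A) (s A) (C n)
      (C (N A)) (γ (s A)) (fun p => (tableEntry T p).1) (fun p => (tableEntry T p).2) q := by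
  obtain ⟨A₁, hA₁⟩ := h.exists_forall_gridNear hψ (η := 1 / 2 ^ (k + 6)) (by positivity)
  refine ⟨A₁, fun A hA => ?_⟩
  obtain ⟨t, r, htr⟩ := h.exists_isCertificateAt hC (hscales A) fun c hc z hz hza hzc =>
    abs_sub_div_two_pow_le (hscales A).add_eight_le (hγ c hc _) (hA₁ A hA c hc z hz hza hzc)
  obtain ⟨T, hT⟩ := exists_tableEntry_eq (finite_inBox (b + 1) (m A)) fun q => (t q, r q)
  refine ⟨T, fun q hq => (htr q hq).congr ?_ (fun p hp => ?_) ?_⟩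
  · rw [hT q hq.succ]
  · rw [hT p (hq.of_gridAdjacent hp)]
  · rw [hT q hq.succ]

theorem exists_computable_isCertificateAt {n : ℕ → ℕ} {A N m s : ℕ → ℕ → ℕ}
    {g : ℕ × (ℤ × ℤ) → ℕ → ℤ} (hn : Computable n) (hA : Computable₂ A) (hN : Computable₂ N)
    (hm : Computable₂ m) (hs : Computable₂ s) (hg : Computable₂ g) (hC : Computable C)
    (hnm : ∀ k e, n k ≤ m k e) (hAm : ∀ k e, A k e ≤ m k e) (hNm : ∀ k e, N k e ≤ m k e)
    (h : ∀ k, ∃ e T, ∀ q, InBox b (m k e) q → IsCertificateAt k (n k) (A k e) (N k e) (m k e)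
      (s k e) (C (n k)) (C (N k e)) (fun c => g (n k, c) (s k e)) (fun p => (tableEntry T p).1)
      (fun p => (tableEntry T p).2) q) :
    ∃ (e : ℕ → ℕ) (T : ℕ → List (ℤ × ℤ)), Computable e ∧ Computable T ∧ ∀ k q,
      InBox b (m k (e k)) q → IsCertificateAt k (n k) (A k (e k)) (N k (e k)) (m k (e k))
        (s k (e k)) (C (n k)) (C (N k (e k))) (fun c => g (n k, c) (s k (e k)))
        (fun p => (tableEntry (T k) p).1) (fun p => (tableEntry (T k) p).2) q := by
  set test : ℕ → ℕ × List (ℤ × ℤ) → Bool := fun k x => (gridBox (2 ^ (b + m k x.1))).all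
    (certificateTest k (n k) (A k x.1) (N k x.1) (m k x.1) (s k x.1) (C (n k)) (C (N k x.1))
      (fun c => g (n k, c) (s k x.1)) x.2)
  have htest : Computable₂ test := by
    have hk : Computable fun x : (ℕ × (ℕ × List (ℤ × ℤ))) × (ℤ × ℤ) => x.1.1 :=
      Computable.fst.comp .fst
    have he : Computable fun x : (ℕ × (ℕ × List (ℤ × ℤ))) × (ℤ × ℤ) => x.1.2.1 :=
      Computable.fst.comp (Computable.snd.comp .fst)
    refine computable_list_all (primrec_gridBox.to_comp.comp (primrec_two_pow.to_comp.comp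
      (Primrec.nat_add.to_comp.comp (.const b) (hm.comp .fst (Computable.fst.comp .snd))))) ?_
    exact computable_certificateTest hk (hn.comp hk) (hA.comp hk he) (hN.comp hk he)
      (hm.comp hk he) (hs.comp hk he) (hC.comp (hn.comp hk)) (hC.comp (hN.comp hk he))
      (hg.comp (.pair ((hn.comp hk).comp .fst) .snd) ((hs.comp hk he).comp .fst))
      (Computable.snd.comp (Computable.snd.comp .fst)) .snd
  have htest_iff : ∀ k x, test k x = true ↔ ∀ q, InBox b (m k x.1) q → IsCertificateAt k (n k)
      (A k x.1) (N k x.1) (m k x.1) (s k x.1) (C (n k)) (C (N k x.1))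
      (fun c => g (n k, c) (s k x.1)) (fun p => (tableEntry x.2 p).1)
      (fun p => (tableEntry x.2 p).2) q := fun k x => by
    simp only [test, List.all_eq_true, mem_gridBox_two_pow,
      certificateTest_iff (hnm k x.1) (hAm k x.1) (hNm k x.1)]
  obtain ⟨f, hf, hft⟩ := exists_computable_forall_eq_true htest fun k =>
    let ⟨e, T, heT⟩ := h k
    ⟨(e, T), (htest_iff k _).2 heT⟩
  exact ⟨fun k => (f k).1, fun k => (f k).2, Computable.fst.comp hf, Computable.snd.comp hf,
    fun k => (htest_iff k _).1 (hft k)⟩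

theorem IsTwoSidedSolution.isComputableOn (h : IsTwoSidedSolution (frontier U) φ u b M A₀)
    (hUo : IsOpen U) (hC : IsComputableApproximation (frontier U) C)
    (hU : closure U ⊆ closedBall 0 (2 ^ b - 1)) (hφ : IsComputableCondition (frontier U) C φ) :
    IsComputableOn u (closure U) := by
  obtain ⟨ψ, ε, ⟨g, hg, hgψ⟩, -, ⟨modulus, hmodulus, hε⟩, hψ, -⟩ := hφ
  obtain ⟨N, m, s, hN, hm, hs, hscales⟩ := exists_computable_areFineScales b M
  set n : ℕ → ℕ := fun k => modulus (k + 5)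
  set A : ℕ → ℕ → ℕ := fun k e => A₀ + n k + e
  have hn : Computable n := hmodulus.comp (Primrec.nat_add.to_comp.comp .id (.const 5))
  have hA : Computable₂ A := Primrec.nat_add.to_comp.comp
    (Primrec.nat_add.to_comp.comp (.const A₀) (hn.comp .fst)) .snd
  have hψφ : ∀ k, ∀ c ∈ C (n k), ∀ y ∈ frontier U ∩ gridSquare (n k) c,
      |ψ (n k) c - φ y| ≤ 1 / 2 ^ (k + 5) := fun k c hc y hy =>
    (hψ _ c hc y hy).trans ((le_abs_self _).trans (hε _ _ le_rfl))
  have hN' : Computable₂ fun k e => N k (A k e) := hN.comp .fst hA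
  have hm' : Computable₂ fun k e => m k (A k e) := hm.comp .fst hA
  have hs' : Computable₂ fun k e => s k (A k e) := hs.comp .fst hA
  have hNm : ∀ k e, N k (A k e) ≤ m k (A k e) := fun k e => (hscales k _).lt.le
  have hAm : ∀ k e, A k e ≤ m k (A k e) := fun k e =>
    le_trans (by linarith [(hscales k (A k e)).decay]) (hNm k e)
  obtain ⟨e, T, he, hT, hcert⟩ := exists_computable_isCertificateAt (b := b) hn hA hN' hm' hs' hg
    hC.computable (fun k e => le_trans (by simp only [A]; omega) (hAm k e)) hAm hNm fun k => by
      obtain ⟨A₁, hA₁⟩ := h.exists_isCertificateAt_tableEntry hC (hscales k) (hψφ k)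
        (γ := fun j c => g (n k, c) j) fun c hc => hgψ (n k, c) hc
      exact ⟨A₁, hA₁ (A k A₁) (by simp only [A]; omega)⟩
  refine isComputableOn_of_forall_dist_le (m := fun k => m k (A k (e k)))
    (r := fun k q => (tableEntry (T k) q).2) (hm.comp .id (hA.comp .id he))
    (Computable.snd.comp (computable_tableEntry (hT.comp .fst) .snd)) fun k z hz q hq =>
      h.abs_sub_le_of_isCertificateAt hUo hC hU (by simp only [A]; omega) (hscales k _)
        (fun c hc y hy => ?_) (hcert k) hz hq
  rw [abs_sub_comm]
  refine abs_sub_div_two_pow_le (hscales k _).add_eight_le (hgψ (n k, c) hc _) ?_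
  rw [abs_sub_comm]
  exact (hψφ k c hc y hy).trans (le_add_of_nonneg_right (by positivity))

end Main

theorem mainTheorem3_general (U : Set ℂ) (hU_open : IsOpen U) (hU_bdd : Bornology.IsBounded U)
    (φ : ℂ → ℝ) (C : ℕ → List (ℤ × ℤ)) (hC : IsComputableApproximation (frontier U) C)
    (hφ : IsComputableCondition (frontier U) C φ) :
    ∃ u : ℂ → ℝ, IsDirichletSolution U φ u ∧
      (∀ v : ℂ → ℝ, IsDirichletSolution U φ v → Set.EqOn v u (closure U)) ∧
      IsComputableOn u (closure U) := by
  have hne : U.Nonempty := by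
    obtain ⟨z, hz⟩ := (hC.connected 0).nonempty
    obtain ⟨y, hy, -⟩ := hC.close 0 z hz
    exact closure_nonempty_iff.1 ⟨y, frontier_subset_closure hy⟩
  obtain ⟨u, b, M, A, h, hcl⟩ :=
    exists_isTwoSidedSolution hU_open hne hU_bdd hC (hφ.continuousOn hC)
  have hsub : closure U ⊆ ball (0 : ℂ) (2 ^ (b + 2)) :=
    hcl.trans (closedBall_subset_ball_two_pow b)
  have hu : IsDirichletSolution U φ u :=
    { continuousOn := h.continuousOn.mono (hsub.trans ball_subset_closedBall)
      harmonic := fun z hz => h.harmonic z ⟨hsub (subset_closure hz), fun hzf =>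
        hU_open.inter_frontier_eq.subset ⟨hz, hzf⟩⟩
      boundary := h.boundary }
  refine ⟨u, hu, fun v hv => ?_, h.isComputableOn hU_open hC hcl hφ⟩
  exact eqOn_closure_of_eqOn_frontier hU_open hU_bdd ⟨hv.harmonic, hv.continuousOn⟩
    ⟨hu.harmonic, hu.continuousOn⟩ fun z hz => (hv.boundary z hz).trans (hu.boundary z hz).symm

theorem mainTheorem3 (U : Set ℂ) (hU_open : IsOpen U) (hU_conn : IsConnected U)
    (hU_bdd : Bornology.IsBounded U) (hU_cone : ∀ x ∈ frontier U, PoincareConeAt U x)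
    (φ : ℂ → ℝ) (C : ℕ → List (ℤ × ℤ))
    (hC : IsComputableApproximation (frontier U) C)
    (hφ : IsComputableCondition (frontier U) C φ) :
    ∃ u : ℂ → ℝ, IsDirichletSolution U φ u ∧
      (∀ v : ℂ → ℝ, IsDirichletSolution U φ v → Set.EqOn v u (closure U)) ∧
      IsComputableOn u (closure U) :=
  mainTheorem3_general U hU_open hU_bdd φ C hC hφ
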